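/- \textbf{Model.} Fix $\lambda_u,\lambda_t,h,r_c,\rho_u,\rho_t,\eta_l,\eta_n,\alpha_l,\alpha_n,\alpha_t,m_l,m_n>0$, $c_1\ge 0$, $c_2\in\mathbb R$ and $P_a\in[0,1]$; put $\lambda_u'=P_a\lambda_u$. A typical user is uniformly distributed in the disk of radius $r_c$ around the origin of the plane. A cluster UAV hovers at altitude $h$ above the origin and is available with probability $P_a$. The ground positions of the other UAVs, all at altitude $h$, form a homogeneous Poisson point process of density $\lambda_u$, each of these UAVs being available independently with probability $P_a$. Terrestrial base stations (TBSs) form a homogeneous Poisson point process of density $\lambda_t$ on the plane. All these objects and the fading gains below are independent. Given them, the link between the user and a UAV at Euclidean distance $r\ge h$ is line-of-sight (LoS), independently for different UAVs, with probability $$P_l(r)=\frac{1}{1+c_1\exp\!\big(-c_2\big(\tfrac{180}{\pi}\arctan\tfrac{h}{\sqrt{r^2-h^2}}-c_1\big)\big)},$$ the arctangent being $\pi/2$ at $r=h$, and otherwise NLoS, with probability $P_n(r)=1-P_l(r)$. A UAV at distance $D$ is received with power $\eta_l\rho_uG_lD^{-\alpha_l}$ (LoS) or $\eta_n\rho_uG_nD^{-\alpha_n}$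 (NLoS), a TBS at distance $D$ with power $\rho_tHD^{-\alpha_t}$; the fading gains of different stations are independent, $G_l,G_n$ are Gamma distributed with shape and scale $(m_l,1/m_l)$, $(m_n,1/m_n)$, and $H$ is exponential with mean $1$ (Rayleigh fading). The cluster UAV serves the user if it is available; otherwise the available UAV or TBS with the largest average received power ($\eta_l\rho_uD^{-\alpha_l}$, $\eta_n\rho_uD^{-\alpha_n}$ or $\rho_tD^{-\alpha_t}$) serves. Let $b_s$ be the serving base station, $\|x\|$ its Euclidean distance from the user, and $I\in[0,\infty]$ the aggregate interference, i.e. the sum of the received powers of all available NLoS UAVs, all available LoS UAVs of the Poisson process and all TBSs, other than $b_s$. \textbf{Lemma (Laplace transform).} Almost surely there is exactly one serving base station. For every $s\ge 0$, almost surely, the conditional expectation of $e^{-sI}$ given the serving base station (its kind, its position, and the position of the user) is $\mathcal L_I(s,\|x\|)$, where \begin{align*} \mathcal L_I(s,\|x\|)=&\exp\Big(-2\pi\lambda_u'\int_{a(\|x\|)}^\infty\Big[1-\Big(\frac{m_n}{m_n+s\eta_n\rho_u(z^2+h^2)^{-\alpha_n/2}}\Big)^{m_n}\Big]zP_n(\sqrt{z^2+h^2})\,dz\Big)\\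 \times&\exp\Big(-2\pi\lambda_u'\int_{b(\|x\|)}^\infty\Big[1-\Big(\frac{m_l}{m_l+s\eta_l\rho_u(z^2+h^2)^{-\alpha_l/2}}\Big)^{m_l}\Big]zP_l(\sqrt{z^2+h^2})\,dz\Big)\\ \times&\exp\Big(-2\pi\lambda_t\int_{c(\|x\|)}^\infty\Big[1-\frac{1}{1+s\rho_tz^{-\alpha_t}}\Big]z\,dz\Big). \end{align*} The integrals take values in $[0,\infty]$ (they are finite if all path-loss exponents exceed $2$), with the conventions $e^{-\infty}=0$ and $0\cdot\infty=0$. The lower limits at $r=\|x\|$ are - $a=b=c=0$ if $b_s$ is the cluster UAV; - $a=\sqrt{d_n^2(r)-h^2}$, $b=\sqrt{r^2-h^2}$, $c=d_{lt}(r)$ if $b_s$ is an available LoS UAV; - $a=\sqrt{r^2-h^2}$, $b=\sqrt{d_l^2(r)-h^2}$, $c=d_{nt}(r)$ if $b_s$ is an available NLoS UAV; - $a=\sqrt{d_{tn}^2(r)-h^2}$, $b=\sqrt{d_{tl}^2(r)-h^2}$, $c=r$ if $b_s$ is a TBS, where $d_{lt}(r)=\big(\frac{\rho_t}{\rho_u\eta_l}\big)^{1/\alpha_t}r^{\alpha_l/\alpha_t}$,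 $d_{nt}(r)=\big(\frac{\rho_t}{\rho_u\eta_n}\big)^{1/\alpha_t}r^{\alpha_n/\alpha_t}$, $d_n(r)=\max\big(h,(\frac{\eta_n}{\eta_l})^{1/\alpha_n}r^{\alpha_l/\alpha_n}\big)$, $d_l(r)=\max\big(h,(\frac{\eta_l}{\eta_n})^{1/\alpha_l}r^{\alpha_n/\alpha_l}\big)$, $d_{tl}(r)=\max\big(h,(\frac{\rho_u\eta_l}{\rho_t})^{1/\alpha_l}r^{\alpha_t/\alpha_l}\big)$ and $d_{tn}(r)=\max\big(h,(\frac{\rho_u\eta_n}{\rho_t})^{1/\alpha_n}r^{\alpha_t/\alpha_n}\big)$. -/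

import Mathlib

open MeasureTheory ProbabilityTheory
open scoped ENNReal

noncomputable section

namespace UAVNet

/-- The ground plane. -/
abbrev Plane : Type := EuclideanSpace ℝ (Fin 2)

/-- System parameters. The index `L` refers to line-of-sight (LoS) links, `N` to non-line-of-sight
(NLoS) links, `U` to UAVs and `T` to terrestrial base stations (TBSs). -/
structure Params where
  /-- density of UAVs -/
  lamU : ℝ
  /-- density of TBSs -/
  lamT : ℝ
  /-- availability probability of a UAV -/
  Pa : ℝ
  /-- altitude of the UAVs -/
  h : ℝ
  /-- radius of a user cluster -/
  rc : ℝ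
  /-- environment variables of the LoS probability -/
  c1 : ℝ
  c2 : ℝ
  /-- transmission powers -/
  rhoU : ℝ
  rhoT : ℝ
  /-- mean additional losses -/
  etaL : ℝ
  etaN : ℝ
  /-- path-loss exponents -/
  alphaL : ℝ
  alphaN : ℝ
  alphaT : ℝ
  /-- shape parameters of the Gamma fading -/
  mL : ℝ
  mN : ℝ
  lamU_pos : 0 < lamU
  lamT_pos : 0 < lamT
  Pa_nonneg : 0 ≤ Pa
  Pa_le_one : Pa ≤ 1
  h_pos : 0 < h
  rc_pos : 0 < rc
  c1_nonneg : 0 ≤ c1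
  rhoU_pos : 0 < rhoU
  rhoT_pos : 0 < rhoT
  etaL_pos : 0 < etaL
  etaN_pos : 0 < etaN
  alphaL_pos : 0 < alphaL
  alphaN_pos : 0 < alphaN
  alphaT_pos : 0 < alphaT
  mL_pos : 0 < mL
  mN_pos : 0 < mN

namespace Params

variable (p : Params)

/-- Density of the available UAVs. -/
def lamAvail : ℝ := p.Pa * p.lamU

/-- Elevation angle (radians) under which a UAV at Euclidean distance `r` is seen:
`arctan (h / √(r² - h²))`, which is `π / 2` for a UAV right overhead (`r = h`). -/
def elevation (r : ℝ) : ℝ :=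
  if r ≤ p.h then Real.pi / 2 else Real.arctan (p.h / √(r ^ 2 - p.h ^ 2))

/-- Probability that the link to a UAV at Euclidean distance `r` is LoS. -/
def Pl (r : ℝ) : ℝ :=
  1 / (1 + p.c1 * Real.exp (-p.c2 * (180 / Real.pi * p.elevation r - p.c1)))

/-- Probability that the link to a UAV at Euclidean distance `r` is NLoS. -/
def Pn (r : ℝ) : ℝ := 1 - p.Pl r

/-- Distances beyond which the interferers of the second kind have to lie when the serving base
station is of the first kind and at distance `r` (`l` LoS UAV, `n` NLoS UAV, `t` TBS). -/
def dlt (r : ℝ) : ℝ := (p.rhoT / (p.rhoU * p.etaL)) ^ (1 / p.alphaT) * r ^ (p.alphaL / p.alphaT)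

def dnt (r : ℝ) : ℝ := (p.rhoT / (p.rhoU * p.etaN)) ^ (1 / p.alphaT) * r ^ (p.alphaN / p.alphaT)

/-- LoS server, NLoS interferers. -/
def dn (r : ℝ) : ℝ :=
  max ((p.etaN / p.etaL) ^ (1 / p.alphaN) * r ^ (p.alphaL / p.alphaN)) p.h

/-- NLoS server, LoS interferers. -/
def dl (r : ℝ) : ℝ :=
  max p.h ((p.etaL / p.etaN) ^ (1 / p.alphaL) * r ^ (p.alphaN / p.alphaL))

def dtl (r : ℝ) : ℝ :=
  max p.h ((p.rhoU * p.etaL / p.rhoT) ^ (1 / p.alphaL) * r ^ (p.alphaT / p.alphaL))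

def dtn (r : ℝ) : ℝ :=
  max p.h ((p.rhoU * p.etaN / p.rhoT) ^ (1 / p.alphaN) * r ^ (p.alphaT / p.alphaN))

end Params

/-- Kinds of a serving base station: the cluster UAV, an available LoS or NLoS UAV, a TBS. -/
inductive Kind
  | cluster
  | los
  | nlos
  | tbs

instance : MeasurableSpace Kind := ⊤

namespace Params

variable (p : Params)

/-- Lower limit for the NLoS UAVs when a base station of kind `k` at distance `r` serves. -/
def lowerN : Kind → ℝ → ℝ
  | .cluster, _ => 0
  | .los, r => √(p.dn r ^ 2 - p.h ^ 2)
  | .nlos, r => √(r ^ 2 - p.h ^ 2)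
  | .tbs, r => √(p.dtn r ^ 2 - p.h ^ 2)

/-- Lower limit for the LoS UAVs. -/
def lowerL : Kind → ℝ → ℝ
  | .cluster, _ => 0
  | .los, r => √(r ^ 2 - p.h ^ 2)
  | .nlos, r => √(p.dl r ^ 2 - p.h ^ 2)
  | .tbs, r => √(p.dtl r ^ 2 - p.h ^ 2)

/-- Lower limit for the TBSs. -/
def lowerT : Kind → ℝ → ℝ
  | .cluster, _ => 0
  | .los, r => p.dlt r
  | .nlos, r => p.dnt r
  | .tbs, r => r

end Params

/-- `exp (-x)` for `x ∈ [0, ∞]`, with `exp (-∞) = 0`. -/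
def expNeg (x : ℝ≥0∞) : ℝ := if x = ∞ then 0 else Real.exp (-x.toReal)

namespace Params

variable (p : Params)

/-- The three integrals over `(a, ∞)`, `(b, ∞)`, `(c, ∞)`. The integrands are nonnegative, and the
integrals take values in `[0, ∞]`. -/
def integralN (k : Kind) (s r : ℝ) : ℝ≥0∞ :=
  ∫⁻ z in Set.Ioi (p.lowerN k r), ENNReal.ofReal
    ((1 - (p.mN / (p.mN + s * p.etaN * p.rhoU * (z ^ 2 + p.h ^ 2) ^ (-p.alphaN / 2))) ^ p.mN)
      * (z * p.Pn (√(z ^ 2 + p.h ^ 2))))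

def integralL (k : Kind) (s r : ℝ) : ℝ≥0∞ :=
  ∫⁻ z in Set.Ioi (p.lowerL k r), ENNReal.ofReal
    ((1 - (p.mL / (p.mL + s * p.etaL * p.rhoU * (z ^ 2 + p.h ^ 2) ^ (-p.alphaL / 2))) ^ p.mL)
      * (z * p.Pl (√(z ^ 2 + p.h ^ 2))))

def integralT (k : Kind) (s r : ℝ) : ℝ≥0∞ :=
  ∫⁻ z in Set.Ioi (p.lowerT k r), ENNReal.ofReal
    ((1 - 1 / (1 + s * p.rhoT * z ^ (-p.alphaT))) * z)

/-- The claimed Laplace transform `𝓛_I(s, r)` given a serving base station of kind `k` at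
distance `r`. -/
def laplaceFormula (k : Kind) (s r : ℝ) : ℝ :=
  expNeg (ENNReal.ofReal (2 * Real.pi * p.lamAvail) * p.integralN k s r)
    * expNeg (ENNReal.ofReal (2 * Real.pi * p.lamAvail) * p.integralL k s r)
    * expNeg (ENNReal.ofReal (2 * Real.pi * p.lamT) * p.integralT k s r)

end Params

section PointProcess

variable {Ω : Type*} [MeasurableSpace Ω]

/-- Number of points of an enumerated point process in `B`. -/
def count (X : ℕ → Ω → Plane) (B : Set Plane) (ω : Ω) : ℕ∞ := {i | X i ω ∈ B}.encard

/-- `X` enumerates the points of a homogeneous Poisson point process of density `lam` on the plane: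
numbers of points in bounded-area sets are Poisson distributed, numbers of points in disjoint sets
are independent. -/
structure IsPoissonProcess (X : ℕ → Ω → Plane) (lam : ℝ) (μ : Measure Ω) : Prop where
  measurable : ∀ i, Measurable (X i)
  poisson : ∀ B : Set Plane, MeasurableSet B → volume B < ∞ →
    HasLaw (count X B)
      ((poissonMeasure (lam.toNNReal * (volume B).toNNReal)).map (Nat.cast : ℕ → ℕ∞)) μ
  indep : ∀ (n : ℕ) (B : Fin n → Set Plane), (∀ j, MeasurableSet (B j)) →
    Pairwise (Function.onFun Disjoint B) → iIndepFun (fun j => count X (B j)) μ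

end PointProcess

/-- The random objects of the network seen by the typical user, whose cluster is centered at the
origin; the cluster UAV hovers above the origin. -/
structure Network (Ω : Type*) where
  /-- position of the typical user -/
  user : Ω → Plane
  /-- whether the cluster UAV is available -/
  clusterAvail : Ω → Bool
  /-- ground projections of the other UAVs -/
  uav : ℕ → Ω → Plane
  /-- whether a UAV is available -/
  avail : ℕ → Ω → Bool
  /-- whether the link between a UAV and the typical user is LoS -/
  los : ℕ → Ω → Bool
  /-- fading gain of a UAV in case of LoS -/
  gainL : ℕ → Ω → ℝ
  /-- fading gain of a UAV in case of NLoS -/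
  gainN : ℕ → Ω → ℝ
  /-- positions of the TBSs -/
  tbs : ℕ → Ω → Plane
  /-- fading gains of the TBSs -/
  gainT : ℕ → Ω → ℝ

/-- A base station: the cluster UAV, the UAV number `i`, or the TBS number `k`. -/
inductive Station
  | cluster
  | uav (i : ℕ)
  | tbs (k : ℕ)

namespace Network

variable {Ω : Type*} (N : Network Ω) (p : Params) (ω : Ω)

/-- Euclidean distance between the typical user and UAV `i`. -/
def distU (i : ℕ) : ℝ := √(dist (N.uav i ω) (N.user ω) ^ 2 + p.h ^ 2)

/-- Distance between the typical user and TBS `k`. -/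
def distT (k : ℕ) : ℝ := dist (N.tbs k ω) (N.user ω)

/-- The stations that a user whose cluster UAV is unavailable chooses from: the available UAVs and
the TBSs. -/
def IsCandidate : Station → Prop
  | .cluster => False
  | .uav i => N.avail i ω = true
  | .tbs _ => True

/-- Average received power (the fading gains have mean one). It is not used for the cluster UAV. -/
def avgPower : Station → ℝ
  | .cluster => 0
  | .uav i =>
      if N.los i ω = true then p.etaL * p.rhoU * N.distU p ω i ^ (-p.alphaL)
      else p.etaN * p.rhoU * N.distU p ω i ^ (-p.alphaN)
  | .tbs k => p.rhoT * N.distT ω k ^ (-p.alphaT)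

/-- Association rule: the cluster UAV serves if it is available; otherwise the available UAV or TBS
with the largest average received power serves. -/
def IsServing (b : Station) : Prop :=
  (N.clusterAvail ω = true ∧ b = .cluster) ∨
  (N.clusterAvail ω = false ∧ N.IsCandidate ω b ∧
    ∀ b', N.IsCandidate ω b' → b' ≠ b → N.avgPower p ω b' < N.avgPower p ω b)

open Classical in
/-- The serving base station (a dummy value if the rule determines none). -/
def serving : Station := if hb : ∃ b, N.IsServing p ω b then hb.choose else .cluster

/-- Kind of the serving base station. -/
def servingKind : Kind :=
  match N.serving p ω with
  | .cluster => .cluster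
  | .uav i => if N.los i ω = true then .los else .nlos
  | .tbs _ => .tbs

/-- Ground position of the serving base station. -/
def servingPos : Plane :=
  match N.serving p ω with
  | .cluster => 0
  | .uav i => N.uav i ω
  | .tbs k => N.tbs k ω

/-- Distance `‖x‖` between the typical user and its serving base station. -/
def servingDist : ℝ :=
  match N.serving p ω with
  | .cluster => √(dist 0 (N.user ω) ^ 2 + p.h ^ 2)
  | .uav i => N.distU p ω i
  | .tbs k => N.distT ω k

/-- What is given when the serving base station is given: its kind and its position, the position
of the typical user being known. -/
def servingInfo : Kind × Plane × Plane := (N.servingKind p ω, N.servingPos p ω, N.user ω)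

open Classical in
/-- Aggregate interference: NLoS UAVs, LoS UAVs (available ones) and TBSs, without the serving base
station, as an element of `[0, ∞]`. -/
def interference : ℝ≥0∞ :=
  (∑' i : ℕ, if N.avail i ω = true ∧ N.los i ω = false ∧ N.serving p ω ≠ .uav i then
      ENNReal.ofReal (p.etaN * p.rhoU * N.gainN i ω * N.distU p ω i ^ (-p.alphaN)) else 0)
  + (∑' i : ℕ, if N.avail i ω = true ∧ N.los i ω = true ∧ N.serving p ω ≠ .uav i then
      ENNReal.ofReal (p.etaL * p.rhoU * N.gainL i ω * N.distU p ω i ^ (-p.alphaL)) else 0)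
  + ∑' k : ℕ, if N.serving p ω ≠ .tbs k then
      ENNReal.ofReal (p.rhoT * N.gainT k ω * N.distT ω k ^ (-p.alphaT)) else 0

end Network

section Model

variable {Ω : Type*} [MeasurableSpace Ω]

/-- The σ-algebras generated by all random objects except the LoS states. -/
abbrev Network.sources (N : Network Ω) : Fin 8 → MeasurableSpace Ω :=
  ![MeasurableSpace.comap N.user inferInstance,
    MeasurableSpace.comap N.clusterAvail inferInstance,
    MeasurableSpace.comap (fun ω i => N.uav i ω) inferInstance,
    MeasurableSpace.comap (fun ω i => N.avail i ω) inferInstance,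
    MeasurableSpace.comap (fun ω i => N.gainL i ω) inferInstance,
    MeasurableSpace.comap (fun ω i => N.gainN i ω) inferInstance,
    MeasurableSpace.comap (fun ω k => N.tbs k ω) inferInstance,
    MeasurableSpace.comap (fun ω k => N.gainT k ω) inferInstance]

/-- The distributional assumptions of the network model. -/
structure IsModel (p : Params) (N : Network Ω) (μ : Measure Ω) : Prop where
  measurable_user : Measurable N.user
  measurable_clusterAvail : Measurable N.clusterAvail
  measurable_avail : ∀ i, Measurable (N.avail i)
  measurable_los : ∀ i, Measurable (N.los i)
  measurable_gainL : ∀ i, Measurable (N.gainL i)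
  measurable_gainN : ∀ i, Measurable (N.gainN i)
  measurable_gainT : ∀ k, Measurable (N.gainT k)
  /-- the typical user is uniform in the disk of its cluster -/
  user_law : pdf.IsUniform N.user (Metric.closedBall 0 p.rc) μ volume
  cluster_law : μ {ω | N.clusterAvail ω = true} = ENNReal.ofReal p.Pa
  uav_law : IsPoissonProcess N.uav p.lamU μ
  tbs_law : IsPoissonProcess N.tbs p.lamT μ
  /-- independent thinning -/
  avail_law : ∀ i, μ {ω | N.avail i ω = true} = ENNReal.ofReal p.Pa
  avail_indep : iIndepFun N.avail μ
  /-- Gamma fading, shape `m` and scale `1 / m` (rate `m`) -/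
  gainL_law : ∀ i, HasLaw (N.gainL i) (gammaMeasure p.mL p.mL) μ
  gainL_indep : iIndepFun N.gainL μ
  gainN_law : ∀ i, HasLaw (N.gainN i) (gammaMeasure p.mN p.mN) μ
  gainN_indep : iIndepFun N.gainN μ
  /-- Rayleigh fading: exponential power gains of unit mean -/
  gainT_law : ∀ k, HasLaw (N.gainT k) (expMeasure 1) μ
  gainT_indep : iIndepFun N.gainT μ
  /-- these objects are independent of each other -/
  indep : iIndep N.sources μ
  /-- given all of them, the links to the UAVs are LoS independently of each other, the link to a
  UAV at distance `r` with probability `Pl r` -/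
  los_law : ∀ (B : Set Ω), MeasurableSet[⨆ j, N.sources j] B → ∀ (S : Finset ℕ) (e : ℕ → Bool),
    μ (B ∩ {ω | ∀ i ∈ S, N.los i ω = e i}) =
      ∫⁻ ω in B, ∏ i ∈ S, ENNReal.ofReal
        (if e i = true then p.Pl (N.distU p ω i) else p.Pn (N.distU p ω i)) ∂μ

end Model

end UAVNet

end

/-! The tool behind the whole proof is a Laplace functional of the marked network. Give each
candidate (available UAV or TBS) a weight depending on its kind, its position, its gain and the
user. Let `κ` be a function of the user and the cluster availability with values at most 1.
Averaging `κ · exp (-total weight)` over link states, gains, availabilities and positions, one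
source at a time, leaves `κ · exp (-exponent)`. The exponent sums, over LoS UAVs, NLoS UAVs and
TBSs, the integral of the density times one minus the fading average of `exp (-weight)`
(`IsModel.lintegral_weights`). In effect, the three kinds are independent Poisson processes given
the user.

Conditioning on the server is done without Palm calculus. Fix a set `T` of average powers and call
candidates with power in `T` strong. A strong candidate gets weight `n` if its information lies in
`A` and weight `∞` otherwise; a weak one gets `s` times its received power. If `Wₙ` and `W∞` are the
resulting totals, then `eⁿ (exp (-Wₙ) - exp (-W∞))` lies between 0 and 1. It converges to `exp (-s ·
weak interference)` on the event that exactly one candidate is strong and its information is in `A`,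
and to 0 elsewhere (`tendsto_isolate`). The exponent splits into a strong part, independent of `s`,
and a deterministic weak part (`Params.exponent_levelWeight`). Hence `exp (-weak part)` factors out
of the limit (`IsModel.lintegral_isolated`). If `T = [t, ∞)` and the cluster UAV is unavailable, the
isolated candidate serves and the weak interference is `I`.

The fixed level must become the power of the server itself. That power is approximated from below by
dyadic levels. Almost surely the server is isolated at all fine enough levels, and the weak exponent
is left continuous in the level (`IsModel.setLIntegral_not_clusterAvail`). If the cluster UAV
serves, one takes `T = ∅`.

Almost sure existence of a strongest candidate (`IsModel.ae_strongest`) comes from the intensity of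
average powers. It has no atoms, is finite above every positive level and infinite in total, so the
power axis can be cut into cells of intensity `δ`. The events that the strongest candidate lies in a
given cell and is alone above its lower end are disjoint, and given an unavailable cluster UAV their
probabilities add up to at least `exp (-2δ)`; then `δ → 0`.

Finally, weaker means farther. Solving `c' D^(-a') < c r^(-a)` for `D` yields the lower limits of
integration, while polar coordinates and the Gamma Laplace transform yield the integrands. -/

noncomputable section

namespace UAVNet

open Filter Topology

/-! ### The exponential `exp (-x)` on `[0, ∞]` -/

/-- `exp (-x)` as a map `[0, ∞] → [0, ∞]`. -/
def eN (x : ℝ≥0∞) : ℝ≥0∞ := EReal.exp (-(x : EReal))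

/-- The inverse of `eN` on `[0, 1]`. -/
def nlog (y : ℝ≥0∞) : ℝ≥0∞ := (-ENNReal.log y).toENNReal

@[simp] lemma eN_zero : eN 0 = 1 := by simp [eN]

@[simp] lemma eN_top : eN ∞ = 0 := by simp [eN]

lemma eN_ofReal {x : ℝ} (hx : 0 ≤ x) : eN (ENNReal.ofReal x) = ENNReal.ofReal (Real.exp (-x)) := by
  rw [eN, EReal.coe_ennreal_ofReal, max_eq_left hx, ← EReal.coe_neg, EReal.exp_coe]

lemma ofReal_expNeg (x : ℝ≥0∞) : ENNReal.ofReal (expNeg x) = eN x := by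
  induction x with
  | top => simp [expNeg]
  | coe x =>
    rw [expNeg, if_neg ENNReal.coe_ne_top, ← eN_ofReal ENNReal.toReal_nonneg,
      ENNReal.ofReal_toReal ENNReal.coe_ne_top]

lemma expNeg_nonneg (x : ℝ≥0∞) : 0 ≤ expNeg x := by
  unfold expNeg; split_ifs <;> positivity

lemma eN_antitone : Antitone eN := fun x y h => by
  unfold eN; simpa using h

lemma eN_le_one (x : ℝ≥0∞) : eN x ≤ 1 := by
  simpa using eN_antitone (zero_le (a := x))

lemma eN_ne_top (x : ℝ≥0∞) : eN x ≠ ∞ := (eN_le_one x).trans_lt ENNReal.one_lt_top |>.ne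

lemma eN_add (x y : ℝ≥0∞) : eN (x + y) = eN x * eN y := by
  unfold eN
  rw [EReal.coe_ennreal_add, EReal.neg_add, sub_eq_add_neg, EReal.exp_add]
  · left; exact EReal.coe_ennreal_ne_bot x
  · right; exact EReal.coe_ennreal_ne_bot y

lemma continuous_eN : Continuous eN :=
  ENNReal.continuous_exp.comp (continuous_neg.comp continuous_coe_ennreal_ereal)

@[fun_prop]
lemma measurable_eN : Measurable eN := continuous_eN.measurable

@[fun_prop]
lemma measurable_nlog : Measurable nlog :=
  (ENNReal.measurable_log.neg).ereal_toENNReal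

/-- Each average of an `eN` can be turned back into an exponent by `nlog`. Successive averaging
therefore keeps the form `eN (∑' …)`, and infinite products never occur. -/
lemma eN_nlog {y : ℝ≥0∞} (hy : y ≤ 1) : eN (nlog y) = y := by
  have h : 0 ≤ -ENNReal.log y := by
    rw [EReal.neg_nonneg]; simpa using hy
  rw [eN, nlog, EReal.coe_toENNReal h, neg_neg, ENNReal.exp_log]

lemma eN_sum {ι : Type*} (s : Finset ι) (w : ι → ℝ≥0∞) :
    eN (∑ i ∈ s, w i) = ∏ i ∈ s, eN (w i) := by
  classical
  induction s using Finset.induction_on with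
  | empty => simp
  | insert a s ha ih => rw [Finset.sum_insert ha, Finset.prod_insert ha, eN_add, ih]

lemma tendsto_eN_sum (w : ℕ → ℝ≥0∞) :
    Tendsto (fun n => eN (∑ i ∈ Finset.range n, w i)) atTop (𝓝 (eN (∑' i, w i))) :=
  (continuous_eN.tendsto _).comp (ENNReal.tendsto_nat_tsum w)

lemma tendsto_lintegral_eN_sum {Ω : Type*} [MeasurableSpace Ω] {μ : Measure Ω} [IsFiniteMeasure μ]
    {w : ℕ → Ω → ℝ≥0∞} (hw : ∀ i, Measurable (w i)) :
    Tendsto (fun n => ∫⁻ ω, eN (∑ i ∈ Finset.range n, w i ω) ∂μ) atTop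
      (𝓝 (∫⁻ ω, eN (∑' i, w i ω) ∂μ)) := by
  refine tendsto_lintegral_of_dominated_convergence (fun _ => 1) (fun n => by fun_prop)
    (fun n => ae_of_all _ fun ω => eN_le_one _) (by simp) (ae_of_all _ fun ω => tendsto_eN_sum _)

/-! ### Integrating out independent components -/

section Freeze

variable {Ω ζ β : Type*} [MeasurableSpace Ω] [MeasurableSpace ζ] [MeasurableSpace β]
  {μ : Measure Ω} [IsProbabilityMeasure μ]

/-- The joint law is a product, so this is Tonelli: the value of `Z` is frozen while `V` is
averaged. -/
lemma lintegral_indepFun {V : Ω → β} {Z : Ω → ζ} (hV : Measurable V) (hZ : Measurable Z)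
    (h : IndepFun V Z μ) {F : ζ → β → ℝ≥0∞} (hF : Measurable (Function.uncurry F)) :
    ∫⁻ ω, F (Z ω) (V ω) ∂μ = ∫⁻ ω, ∫⁻ ω', F (Z ω) (V ω') ∂μ ∂μ := by
  have h1 := (indepFun_iff_map_prod_eq_prod_map_map hZ.aemeasurable hV.aemeasurable).1 h.symm
  have : ∀ z, ∫⁻ ω', F z (V ω') ∂μ = ∫⁻ v, F z v ∂(μ.map V) := fun z => by
    rw [lintegral_map (f := F z) (hF.comp measurable_prodMk_left) hV]
  simp_rw [this]
  rw [← lintegral_map (f := fun z => ∫⁻ v, F z v ∂(μ.map V)) hF.lintegral_prod_right' hZ]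
  change ∫⁻ ω, (Function.uncurry F) (Z ω, V ω) ∂μ = _
  rw [← lintegral_map hF (hZ.prodMk hV), h1, lintegral_prod _ hF.aemeasurable]
  rfl

/-- Independent marks, independent of `Z`, may be averaged out one by one. -/
lemma lintegral_marks {M : ℕ → Ω → β} {Z : Ω → ζ} (hM : ∀ i, Measurable (M i))
    (hZ : Measurable Z) (h : IndepFun (fun ω i => M i ω) Z μ) (hi : iIndepFun M μ)
    {ν : Measure β} (hν : ∀ i, HasLaw (M i) ν μ) {K : ζ → ℝ≥0∞} (hK : Measurable K)
    {φ : ℕ → ζ → β → ℝ≥0∞} (hφ : ∀ i, Measurable (Function.uncurry (φ i))) :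
    ∫⁻ ω, K (Z ω) * eN (∑' i, φ i (Z ω) (M i ω)) ∂μ
      = ∫⁻ ω, K (Z ω) * eN (∑' i, nlog (∫⁻ m, eN (φ i (Z ω) m) ∂ν)) ∂μ := by
  have hν1 : IsProbabilityMeasure ν := (hν 0).isProbabilityMeasure_iff.1 inferInstance
  have hφ' : ∀ i z, Measurable (φ i z) := fun i z => (hφ i).comp measurable_prodMk_left
  have key := lintegral_indepFun (F := fun z v => K z * eN (∑' i, φ i z (v i)))
    (measurable_pi_lambda _ hM) hZ h (by
      refine (hK.comp measurable_fst).mul (measurable_eN.comp (Measurable.tsum fun i => ?_))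
      exact (hφ i).comp (measurable_fst.prodMk ((measurable_pi_apply i).comp measurable_snd)))
  rw [key]
  refine lintegral_congr fun ω => ?_
  have hm : ∀ i, Measurable fun ω' => φ i (Z ω) (M i ω') := fun i => (hφ' i _).comp (hM i)
  rw [lintegral_const_mul (f := fun ω' => eN (∑' i, φ i (Z ω) (M i ω'))) _
    (measurable_eN.comp (Measurable.tsum hm))]
  congr 1
  -- Both sides are limits of their truncations to finitely many marks, where independence turns the
  -- integral of a product into a product of integrals.
  refine tendsto_nhds_unique (tendsto_lintegral_eN_sum hm) ?_
  convert tendsto_eN_sum _ using 2 with n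
  rw [eN_sum]
  simp_rw [eN_sum]
  have hind : iIndepFun (fun i ω' => eN (φ i (Z ω) (M i ω'))) μ :=
    hi.comp (fun i m => eN (φ i (Z ω) m)) fun i => measurable_eN.comp (hφ' i _)
  have hf : ∀ n, ∫⁻ ω', ∏ i ∈ Finset.range n, eN (φ i (Z ω) (M i ω')) ∂μ
      = ∏ i ∈ Finset.range n, ∫⁻ ω', eN (φ i (Z ω) (M i ω')) ∂μ := fun n =>
    lintegral_prod_eq_prod_lintegral_of_indepFun (Finset.range n) _ hind
      fun i => (measurable_eN.comp (hm i))
  rw [hf]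
  refine Finset.prod_congr rfl fun i _ => ?_
  rw [eN_nlog, (hν i).lintegral_comp (f := fun m => eN (φ i (Z ω) m))
    (measurable_eN.comp (hφ' i _)).aemeasurable]
  calc _ ≤ ∫⁻ _, 1 ∂ν := lintegral_mono fun _ => eN_le_one _
    _ = 1 := by simp

end Freeze

/-! ### Laplace functional of a Poisson process -/

lemma eN_nsmul (c : ℝ≥0∞) (n : ℕ) : eN (n * c) = eN c ^ n := by
  induction n with
  | zero => simp
  | succ n ih => rw [Nat.cast_succ, add_mul, one_mul, eN_add, ih, pow_succ]

/-- The Poisson hypotheses only concern counts; this translates sums over the enumerated points into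
counts. -/
lemma tsum_indicator_eq_count {Ω : Type*} (X : ℕ → Ω → Plane) (B : Set Plane) (c : ℝ≥0∞) (ω : Ω) :
    ∑' i, B.indicator (fun _ => c) (X i ω) = (count X B ω : ℝ≥0∞) * c := by
  rw [count, ← ENNReal.tsum_set_const, tsum_subtype {i | X i ω ∈ B} fun _ => c]
  rfl

/-- This is the generating function `E[qⁿ] = exp (-r (1 - q))` at `q = eN c`, with `c = ∞`, that is
`q = 0`, included. -/
lemma lintegral_poissonMeasure_eN (r : NNReal) (c : ℝ≥0∞) :
    ∫⁻ n : ℕ, eN (n * c) ∂(poissonMeasure r) = eN (r * (1 - eN c)) := by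
  rw [poissonMeasure, lintegral_sum_measure]
  simp_rw [lintegral_smul_measure, lintegral_dirac, eN_nsmul]
  obtain ⟨q, hq0, hq⟩ : ∃ q : ℝ, 0 ≤ q ∧ eN c = ENNReal.ofReal q :=
    ⟨(eN c).toReal, ENNReal.toReal_nonneg, (ENNReal.ofReal_toReal (eN_ne_top c)).symm⟩
  have hq1 : q ≤ 1 := by
    have := eN_le_one c
    rwa [hq, ENNReal.ofReal_le_one] at this
  have h1 : (r : ℝ≥0∞) * (1 - eN c) = ENNReal.ofReal (r * (1 - q)) := by
    rw [hq, ← ENNReal.ofReal_one, ← ENNReal.ofReal_sub _ hq0, ENNReal.ofReal_mul r.coe_nonneg,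
      ENNReal.ofReal_coe_nnreal]
  rw [h1, eN_ofReal (mul_nonneg r.coe_nonneg (sub_nonneg.2 hq1)), hq]
  have h2 : HasSum (fun n : ℕ => Real.exp (-r) * ((r * q) ^ n / n.factorial))
      (Real.exp (-(r * (1 - q)))) := by
    have := (NormedSpace.expSeries_div_hasSum_exp (𝔸 := ℝ) ((r : ℝ) * q)).mul_left (Real.exp (-r))
    rw [← Real.exp_eq_exp_ℝ, ← Real.exp_add] at this
    rw [show -((r : ℝ) * (1 - q)) = -r + r * q by ring]
    exact this
  rw [← h2.tsum_eq, ENNReal.ofReal_tsum_of_nonneg (fun n => by positivity) h2.summable]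
  refine tsum_congr fun n => ?_
  rw [smul_eq_mul, ← ENNReal.ofReal_pow hq0, ← ENNReal.ofReal_mul (by positivity)]
  congr 1
  rw [mul_pow]; ring

namespace IsPoissonProcess

variable {Ω : Type*} [MeasurableSpace Ω] {μ : Measure Ω}
  {X : ℕ → Ω → Plane} {lam : ℝ}

lemma lintegral_eN_count (hX : IsPoissonProcess X lam μ) {B : Set Plane} (hB : MeasurableSet B)
    (hfin : volume B < ∞) (c : ℝ≥0∞) :
    ∫⁻ ω, eN ((count X B ω : ℝ≥0∞) * c) ∂μ
      = eN (ENNReal.ofReal lam * (volume B * (1 - eN c))) := by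
  rw [(hX.poisson B hB hfin).lintegral_comp (f := fun k : ℕ∞ => eN ((k : ℝ≥0∞) * c))
    (measurable_from_top.aemeasurable), lintegral_map measurable_from_top measurable_from_top]
  simp only [ENat.toENNReal_coe]
  rw [lintegral_poissonMeasure_eN, ENNReal.coe_mul, ENNReal.coe_toNNReal hfin.ne, mul_assoc]
  rfl

lemma lintegral_eN_sum_count (hX : IsPoissonProcess X lam μ) {n : ℕ} {B : Fin n → Set Plane}
    (hB : ∀ j, MeasurableSet (B j)) (hdisj : Pairwise (Function.onFun Disjoint B))
    (hfin : ∀ j, volume (B j) < ∞) (c : Fin n → ℝ≥0∞) :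
    ∫⁻ ω, eN (∑ j, (count X (B j) ω : ℝ≥0∞) * c j) ∂μ
      = eN (ENNReal.ofReal lam * ∑ j, volume (B j) * (1 - eN (c j))) := by
  simp_rw [Finset.mul_sum, eN_sum]
  -- Measurability of counts is not a hypothesis; it follows by writing a count as a sum of
  -- indicators of the measurable points.
  have hm : ∀ (B : Set Plane), MeasurableSet B → Measurable (count X B) := by
    intro B hB
    have : ∀ ω, (count X B ω : ℝ≥0∞) = ∑' i, B.indicator (fun _ => 1) (X i ω) := fun ω => by
      rw [tsum_indicator_eq_count, mul_one]
    have h1 : Measurable fun ω => (count X B ω : ℝ≥0∞) := by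
      simp_rw [this]
      exact Measurable.tsum fun i => (measurable_const.indicator hB).comp (hX.measurable i)
    refine measurable_to_countable' fun k => ?_
    have h2 : count X B ⁻¹' {k} = (fun ω => (count X B ω : ℝ≥0∞)) ⁻¹' {(k : ℝ≥0∞)} := by
      ext ω; simp
    rw [h2]
    exact h1 (measurableSet_singleton _)
  have hind := (hX.indep n B hB hdisj).comp (fun j (k : ℕ∞) => eN ((k : ℝ≥0∞) * c j))
    fun j => measurable_from_top
  refine (lintegral_prod_eq_prod_lintegral_of_indepFun Finset.univ _ hind
    fun j => (measurable_from_top (f := fun k : ℕ∞ => eN ((k : ℝ≥0∞) * c j))).comp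
      (hm _ (hB j))).trans ?_
  exact Finset.prod_congr rfl fun j _ => hX.lintegral_eN_count (hB j) (hfin j) (c j)

open scoped Classical in
-- The level sets of `w` are disjoint, so the total weight is a finite combination of independent
-- Poisson counts.
lemma lintegral_eN_simpleFunc (hX : IsPoissonProcess X lam μ) (w : SimpleFunc Plane ℝ≥0∞)
    (hw : ∀ c ≠ 0, volume (w ⁻¹' {c}) < ∞) :
    ∫⁻ ω, eN (∑' i, w (X i ω)) ∂μ = eN (ENNReal.ofReal lam * ∫⁻ x, (1 - eN (w x))) := by
  -- The value 0 is discarded: its level set may have infinite area, and it contributes nothing.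
  set F := w.range.filter (· ≠ 0) with hF
  let e := F.equivFin.symm
  have hsum : ∀ g : ℝ≥0∞ → ℝ≥0∞, ∑ j, g (e j) = ∑ c ∈ F, g c := fun g => by
    rw [e.sum_comp (fun c : F => g c), Finset.sum_coe_sort F g]
  have hrep : ∀ (g : ℝ≥0∞ → ℝ≥0∞), g 0 = 0 → ∀ x,
      g (w x) = ∑ j, (w ⁻¹' {(e j : ℝ≥0∞)}).indicator (fun _ => g (e j)) x := fun g hg x => by
    rw [hsum fun c => (w ⁻¹' {c}).indicator (fun _ => g c) x]
    by_cases h0 : w x = 0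
    · rw [h0, hg]
      refine (Finset.sum_eq_zero fun c hc => ?_).symm
      refine Set.indicator_of_notMem (fun h => (Finset.mem_filter.1 hc).2 ?_) _
      rw [← h0]; exact h.symm
    · rw [Finset.sum_eq_single (w x)]
      · simp
      · intro c _ hc
        exact Set.indicator_of_notMem (fun h => hc h.symm) _
      · intro h
        exact absurd (Finset.mem_filter.2 ⟨SimpleFunc.mem_range_self w x, h0⟩) h
  have hB : ∀ c, MeasurableSet (w ⁻¹' {c}) := fun c => w.measurableSet_fiber c
  have key := hX.lintegral_eN_sum_count (B := fun j => w ⁻¹' {(e j : ℝ≥0∞)}) (fun j => hB _)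
    (fun i j hij => by
      refine Disjoint.preimage _ (Set.disjoint_singleton.2 fun h => hij ?_)
      exact e.injective (Subtype.ext h))
    (fun j => hw _ (Finset.mem_filter.1 (e j).2).2) (fun j => (e j : ℝ≥0∞))
  have h1 : ∀ ω, ∑' i, w (X i ω)
      = ∑ j, (count X (w ⁻¹' {(e j : ℝ≥0∞)}) ω : ℝ≥0∞) * (e j : ℝ≥0∞) := fun ω => by
    simp_rw [← tsum_indicator_eq_count]
    rw [← Summable.tsum_finsetSum fun _ _ => ENNReal.summable]
    exact tsum_congr fun i => hrep id rfl _
  have h2 : ∫⁻ x, (1 - eN (w x)) = ∑ j, volume (w ⁻¹' {(e j : ℝ≥0∞)}) * (1 - eN (e j)) := by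
    rw [lintegral_congr (hrep (fun c => 1 - eN c) (by simp)),
      lintegral_finsetSum _ fun j _ => measurable_const.indicator (hB _)]
    refine Finset.sum_congr rfl fun j _ => ?_
    rw [lintegral_indicator_const (hB _), mul_comm]
  simp_rw [h1]
  rw [key, h2]

variable [IsProbabilityMeasure μ]

/-- The Laplace functional of a Poisson process. -/
lemma lintegral_eN (hX : IsPoissonProcess X lam μ) {w : Plane → ℝ≥0∞} (hw : Measurable w) :
    ∫⁻ ω, eN (∑' i, w (X i ω)) ∂μ = eN (ENNReal.ofReal lam * ∫⁻ x, (1 - eN (w x))) := by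
  -- Cutting off outside a ball gives the nonzero level sets finite area, while the approximation
  -- stays increasing with limit `w`.
  let v : ℕ → SimpleFunc Plane ℝ≥0∞ := fun n =>
    (SimpleFunc.eapprox w n).restrict (Metric.closedBall 0 n)
  have hv : ∀ n x, v n x
      = (Metric.closedBall (0 : Plane) n).indicator (SimpleFunc.eapprox w n) x := fun n x => by
    rw [SimpleFunc.restrict_apply _ Metric.isClosed_closedBall.measurableSet]
  have hmono : ∀ x, Monotone fun n => v n x := fun x m n hmn => by
    simp only [hv]
    refine (Set.indicator_le_indicator_of_subset (Metric.closedBall_subset_closedBall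
      (Nat.cast_le.2 hmn)) (fun _ => zero_le) x).trans ?_
    exact Set.indicator_le_indicator (SimpleFunc.monotone_eapprox w hmn x)
  have hlim : ∀ x, Tendsto (fun n => v n x) atTop (𝓝 (w x)) := fun x => by
    have h := tendsto_atTop_iSup (fun m n hmn => SimpleFunc.monotone_eapprox w hmn x :
      Monotone fun n => SimpleFunc.eapprox w n x)
    rw [SimpleFunc.iSup_eapprox_apply hw] at h
    refine h.congr' ?_
    obtain ⟨N, hN⟩ := exists_nat_ge ‖x‖
    filter_upwards [eventually_ge_atTop N] with n hn
    rw [hv, Set.indicator_of_mem]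
    simpa using hN.trans (Nat.cast_le.2 hn)
  have hfin : ∀ n, ∀ c ≠ 0, volume (v n ⁻¹' {c}) < ∞ := fun n c hc => by
    refine (measure_mono fun x hx => ?_).trans_lt
      (measure_closedBall_lt_top (x := (0 : Plane)) (r := n))
    by_contra hx'
    have : v n x = 0 := by rw [hv, Set.indicator_of_notMem hx']
    exact hc (hx.symm.trans this)
  have hL : Tendsto (fun n => ∫⁻ ω, eN (∑' i, v n (X i ω)) ∂μ) atTop
      (𝓝 (∫⁻ ω, eN (∑' i, w (X i ω)) ∂μ)) := by
    refine tendsto_lintegral_of_dominated_convergence (fun _ => 1)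
      (fun n => measurable_eN.comp (Measurable.tsum fun i => (v n).measurable.comp
        (hX.measurable i))) (fun n => ae_of_all _ fun ω => eN_le_one _) (by simp)
      (ae_of_all _ fun ω => (continuous_eN.tendsto _).comp ?_)
    -- Sums over points are integrals against counting measure, so monotone convergence applies for
    -- each `ω`.
    simp_rw [← lintegral_count]
    exact lintegral_tendsto_of_tendsto_of_monotone (fun n => measurable_from_top.aemeasurable)
      (ae_of_all _ fun i => hmono _) (ae_of_all _ fun i => hlim _)
  refine tendsto_nhds_unique hL ?_
  simp_rw [fun n => hX.lintegral_eN_simpleFunc (v n) (hfin n)]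
  have h3 : Tendsto (fun n => ∫⁻ x, (1 - eN (v n x))) atTop (𝓝 (∫⁻ x, (1 - eN (w x)))) := by
    refine lintegral_tendsto_of_tendsto_of_monotone
      (fun n => (measurable_const.sub (measurable_eN.comp (v n).measurable)).aemeasurable)
      (ae_of_all _ fun x m n hmn => tsub_le_tsub_left (eN_antitone (hmono x hmn)) _)
      (ae_of_all _ fun x => ENNReal.Tendsto.sub tendsto_const_nhds
        ((continuous_eN.tendsto _).comp (hlim x)) (Or.inl ENNReal.one_ne_top))
  exact (continuous_eN.tendsto _).comp (ENNReal.Tendsto.const_mul h3 (Or.inr ENNReal.ofReal_ne_top))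

/-- The Laplace functional of a Poisson process independent of `Z`. -/
lemma lintegral_mul_eN (hX : IsPoissonProcess X lam μ) {ζ : Type*} [MeasurableSpace ζ]
    {Z : Ω → ζ} (hZ : Measurable Z) (h : IndepFun (fun ω i => X i ω) Z μ) {K : ζ → ℝ≥0∞}
    (hK : Measurable K) {w : ζ → Plane → ℝ≥0∞} (hw : Measurable (Function.uncurry w)) :
    ∫⁻ ω, K (Z ω) * eN (∑' i, w (Z ω) (X i ω)) ∂μ
      = ∫⁻ ω, K (Z ω) * eN (ENNReal.ofReal lam * ∫⁻ x, (1 - eN (w (Z ω) x))) ∂μ := by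
  rw [lintegral_indepFun (F := fun z v => K z * eN (∑' i, w z (v i)))
    (measurable_pi_lambda _ hX.measurable) hZ h (by
      refine (hK.comp measurable_fst).mul (measurable_eN.comp (Measurable.tsum fun i => ?_))
      exact hw.comp (measurable_fst.prodMk ((measurable_pi_apply i).comp measurable_snd)))]
  refine lintegral_congr fun ω => ?_
  have hm : Measurable (w (Z ω)) := hw.comp measurable_prodMk_left
  rw [lintegral_const_mul (f := fun ω' => eN (∑' i, w (Z ω) (X i ω'))) _
    (measurable_eN.comp (Measurable.tsum fun i => hm.comp (hX.measurable i))),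
    hX.lintegral_eN hm]

end IsPoissonProcess

/-! ### The line-of-sight probability -/

namespace Params

variable (p : Params)

lemma measurable_elevation : Measurable p.elevation := by
  unfold elevation
  exact Measurable.ite measurableSet_Iic measurable_const (by fun_prop)

@[fun_prop]
lemma measurable_Pl : Measurable p.Pl := by
  have := p.measurable_elevation
  unfold Pl
  fun_prop

@[fun_prop]
lemma measurable_Pn : Measurable p.Pn := measurable_const.sub p.measurable_Pl

lemma Pl_nonneg (r : ℝ) : 0 ≤ p.Pl r := by
  have := p.c1_nonneg
  unfold Pl
  positivity

lemma Pl_le_one (r : ℝ) : p.Pl r ≤ 1 := by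
  have := p.c1_nonneg
  unfold Pl
  rw [div_le_one (by positivity)]
  have : 0 ≤ p.c1 * Real.exp (-p.c2 * (180 / Real.pi * p.elevation r - p.c1)) := by positivity
  linarith

lemma Pn_nonneg (r : ℝ) : 0 ≤ p.Pn r := sub_nonneg.2 (p.Pl_le_one r)

/-- Probability that the link to a UAV at Euclidean distance `r` is LoS (`true`) or NLoS. -/
def linkProb (b : Bool) (r : ℝ) : ℝ≥0∞ := ENNReal.ofReal (if b = true then p.Pl r else p.Pn r)

@[fun_prop]
lemma measurable_linkProb (b : Bool) : Measurable (p.linkProb b) := by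
  cases b
  · exact ENNReal.measurable_ofReal.comp p.measurable_Pn
  · exact ENNReal.measurable_ofReal.comp p.measurable_Pl

lemma linkProb_add (r : ℝ) : p.linkProb true r + p.linkProb false r = 1 := by
  simp only [linkProb, if_true, Bool.false_eq_true, if_false]
  rw [← ENNReal.ofReal_add (p.Pl_nonneg r) (p.Pn_nonneg r), Pn]
  simp

/-- Euclidean distance of a user at `u` to a UAV above `x`. -/
def slant (u x : Plane) : ℝ := √(dist x u ^ 2 + p.h ^ 2)

@[fun_prop]
lemma measurable_slant : Measurable fun z : Plane × Plane => p.slant z.1 z.2 := by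
  unfold slant
  fun_prop

end Params

/-! ### σ-algebras generated by subfamilies of the sources. -/

namespace Network

variable {Ω : Type*} (N : Network Ω) {S : Set (Fin 8)}

/-- The σ-algebra generated by some of the sources. -/
abbrev sourceSup (S : Set (Fin 8)) : MeasurableSpace Ω := ⨆ j ∈ S, N.sources j

lemma sources_le_sourceSup {j : Fin 8}
    (hj : j ∈ S) : N.sources j ≤ N.sourceSup S :=
  le_iSup₂ (f := fun j (_ : j ∈ S) => N.sources j) j hj

lemma measurable_user' (h : 0 ∈ S) :
    Measurable[N.sourceSup S] N.user :=
  (comap_measurable N.user).mono (N.sources_le_sourceSup h) le_rfl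

lemma measurable_clusterAvail' (h : 1 ∈ S) :
    Measurable[N.sourceSup S] N.clusterAvail :=
  (comap_measurable N.clusterAvail).mono (N.sources_le_sourceSup h) le_rfl

lemma measurable_uav' (h : 2 ∈ S) :
    Measurable[N.sourceSup S] fun ω i => N.uav i ω :=
  (comap_measurable fun ω i => N.uav i ω).mono (N.sources_le_sourceSup h) le_rfl

lemma measurable_avail' (h : 3 ∈ S) :
    Measurable[N.sourceSup S] fun ω i => N.avail i ω :=
  (comap_measurable fun ω i => N.avail i ω).mono (N.sources_le_sourceSup h) le_rfl

lemma measurable_gainL' (h : 4 ∈ S) :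
    Measurable[N.sourceSup S] fun ω i => N.gainL i ω :=
  (comap_measurable fun ω i => N.gainL i ω).mono (N.sources_le_sourceSup h) le_rfl

lemma measurable_gainN' (h : 5 ∈ S) :
    Measurable[N.sourceSup S] fun ω i => N.gainN i ω :=
  (comap_measurable fun ω i => N.gainN i ω).mono (N.sources_le_sourceSup h) le_rfl

lemma measurable_tbs' (h : 6 ∈ S) :
    Measurable[N.sourceSup S] fun ω i => N.tbs i ω :=
  (comap_measurable fun ω i => N.tbs i ω).mono (N.sources_le_sourceSup h) le_rfl

lemma measurable_gainT' (h : 7 ∈ S) :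
    Measurable[N.sourceSup S] fun ω i => N.gainT i ω :=
  (comap_measurable fun ω i => N.gainT i ω).mono (N.sources_le_sourceSup h) le_rfl

end Network

/-! ### Averaging over the link states. -/

section Model

variable {Ω : Type*} [mΩ : MeasurableSpace Ω] {μ : Measure Ω} {p : Params} {N : Network Ω}

lemma sum_mul_eN_le_one (r : ℝ) (x y : ℝ≥0∞) :
    p.linkProb true r * eN x + p.linkProb false r * eN y ≤ 1 := by
  calc _ ≤ p.linkProb true r * 1 + p.linkProb false r * 1 := by
        gcongr <;> exact eN_le_one _
    _ = 1 := by rw [mul_one, mul_one, p.linkProb_add]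

namespace IsModel

lemma sources_le (hN : IsModel p N μ) (j : Fin 8) : N.sources j ≤ mΩ := by
  fin_cases j
  · exact hN.measurable_user.comap_le
  · exact hN.measurable_clusterAvail.comap_le
  · exact (measurable_pi_lambda _ hN.uav_law.measurable).comap_le
  · exact (measurable_pi_lambda _ hN.measurable_avail).comap_le
  · exact (measurable_pi_lambda _ hN.measurable_gainL).comap_le
  · exact (measurable_pi_lambda _ hN.measurable_gainN).comap_le
  · exact (measurable_pi_lambda _ hN.tbs_law.measurable).comap_le
  · exact (measurable_pi_lambda _ hN.measurable_gainT).comap_le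

lemma sourceSup_le (hN : IsModel p N μ) (S : Set (Fin 8)) : N.sourceSup S ≤ mΩ :=
  iSup₂_le fun j _ => hN.sources_le j

/-- This is what allows one source to be integrated out while any collection of the others is
frozen. -/
lemma indep_sourceSup (hN : IsModel p N μ) {S : Set (Fin 8)} {j : Fin 8} (hj : j ∉ S) :
    Indep (N.sources j) (N.sourceSup S) μ := by
  have h := indep_iSup_of_disjoint hN.sources_le hN.indep
    (S := {j}) (T := S) (Set.disjoint_singleton_left.2 hj)
  simpa using h

/-- The link states given the sources, tested against functions of the sources. -/
lemma lintegral_indicator_los (hN : IsModel p N μ) {H : Ω → ℝ≥0∞}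
    (hH : Measurable[⨆ j, N.sources j] H) (S : Finset ℕ) (e : ℕ → Bool) :
    ∫⁻ ω in {ω | ∀ i ∈ S, N.los i ω = e i}, H ω ∂μ
      = ∫⁻ ω, H ω * ∏ i ∈ S, p.linkProb (e i) (N.distU p ω i) ∂μ := by
  have hG : (⨆ j, N.sources j) ≤ mΩ := iSup_le hN.sources_le
  have hd : ∀ i, Measurable fun ω => N.distU p ω i := fun i => by
    have h1 := hN.measurable_user
    have h2 := hN.uav_law.measurable i
    unfold Network.distU
    fun_prop
  have hq : Measurable fun ω => ∏ i ∈ S, p.linkProb (e i) (N.distU p ω i) :=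
    Finset.measurable_prod _ fun i _ => (p.measurable_linkProb _).comp (hd i)
  have hE : MeasurableSet {ω | ∀ i ∈ S, N.los i ω = e i} := by
    simp only [Set.ofPred_forall]
    exact Finset.measurableSet_biInter _ fun i _ => hN.measurable_los i (measurableSet_singleton _)
  -- The law of the link states says exactly that these two measures agree on the σ-algebra of the
  -- sources; equality of the trimmed measures passes to integrals of source-measurable functions.
  have hmeas : (μ.restrict {ω | ∀ i ∈ S, N.los i ω = e i}).trim hG
      = (μ.withDensity fun ω => ∏ i ∈ S, p.linkProb (e i) (N.distU p ω i)).trim hG := by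
    refine @Measure.ext _ (⨆ j, N.sources j) _ _ fun B hB => ?_
    rw [trim_measurableSet_eq hG hB, trim_measurableSet_eq hG hB,
      Measure.restrict_apply (hG _ hB), withDensity_apply _ (hG _ hB)]
    exact hN.los_law B hB S e
  rw [← lintegral_trim hG hH, hmeas, lintegral_trim hG hH,
    lintegral_withDensity_eq_lintegral_mul _ hq (hH.mono hG le_rfl)]
  exact lintegral_congr fun ω => mul_comm _ _

variable [IsProbabilityMeasure μ]

lemma lintegral_los (hN : IsModel p N μ) {K : Ω → ℝ≥0∞} (hK : Measurable[⨆ j, N.sources j] K)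
    (hK1 : ∀ ω, K ω ≤ 1) {φ : ℕ → Bool → Ω → ℝ≥0∞}
    (hφ : ∀ i b, Measurable[⨆ j, N.sources j] (φ i b)) :
    ∫⁻ ω, K ω * eN (∑' i, φ i (N.los i ω) ω) ∂μ
      = ∫⁻ ω, K ω * eN (∑' i, nlog (p.linkProb true (N.distU p ω i) * eN (φ i true ω)
          + p.linkProb false (N.distU p ω i) * eN (φ i false ω))) ∂μ := by
  have hG : (⨆ j, N.sources j) ≤ mΩ := iSup_le hN.sources_le
  have hK' : Measurable K := hK.mono hG le_rfl
  have hφ' : ∀ i b, Measurable (φ i b) := fun i b => (hφ i b).mono hG le_rfl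
  have hd : ∀ i, Measurable fun ω => N.distU p ω i := fun i => by
    have h1 := hN.measurable_user
    have h2 := hN.uav_law.measurable i
    unfold Network.distU
    fun_prop
  have hlim : ∀ w : ℕ → Ω → ℝ≥0∞, (∀ i, Measurable (w i)) →
      Tendsto (fun n => ∫⁻ ω, K ω * eN (∑ i ∈ Finset.range n, w i ω) ∂μ) atTop
        (𝓝 (∫⁻ ω, K ω * eN (∑' i, w i ω) ∂μ)) := fun w hw => by
    refine tendsto_lintegral_of_dominated_convergence (fun _ => 1) (fun n => by fun_prop)
      (fun n => ae_of_all _ fun ω => ?_) (by simp) (ae_of_all _ fun ω =>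
        ENNReal.Tendsto.const_mul (tendsto_eN_sum _)
          (Or.inr ((hK1 ω).trans_lt ENNReal.one_lt_top).ne))
    calc K ω * eN _ ≤ 1 * 1 := mul_le_mul' (hK1 ω) (eN_le_one _)
      _ = 1 := one_mul 1
  have hw1 : ∀ i, Measurable fun ω => φ i (N.los i ω) ω := fun i =>
    (measurable_from_prod_countable_right (f := fun z : Bool × Ω => φ i z.1 z.2)
      fun b => hφ' i b).comp ((hN.measurable_los i).prodMk measurable_id)
  refine tendsto_nhds_unique (hlim _ hw1) ?_
  have hw2 : ∀ i, Measurable fun ω => nlog (p.linkProb true (N.distU p ω i) * eN (φ i true ω)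
      + p.linkProb false (N.distU p ω i) * eN (φ i false ω)) := fun i => by
    have h1 := hφ' i true
    have h2 := hφ' i false
    have h3 := (p.measurable_linkProb true).comp (hd i)
    have h4 := (p.measurable_linkProb false).comp (hd i)
    exact measurable_nlog.comp ((h3.mul (measurable_eN.comp h1)).add
      (h4.mul (measurable_eN.comp h2)))
  convert hlim _ hw2 using 2 with n
  -- Link patterns of the first `n` UAVs form a finite type, whereas the model tests sequences; the
  -- extension beyond `n` is arbitrary.
  have hext : ∀ (e : Fin n → Bool), ∃ e' : ℕ → Bool, ∀ i : Fin n, e' i = e i := fun e =>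
    ⟨fun i => if h : i < n then e ⟨i, h⟩ else false, fun i => by simp⟩
  choose E hE using hext
  have hmE : ∀ e, MeasurableSet {ω | ∀ i ∈ Finset.range n, N.los i ω = E e i} := fun e => by
    simp only [Set.ofPred_forall]
    exact Finset.measurableSet_biInter _ fun i _ => hN.measurable_los i (measurableSet_singleton _)
  -- A product of `n` two-term sums is expanded into a sum over the `2 ^ n` link patterns; `hL`
  -- below splits the left side over the same patterns.
  have hR : ∀ ω, K ω * eN (∑ i ∈ Finset.range n,
      nlog (p.linkProb true (N.distU p ω i) * eN (φ i true ω)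
          + p.linkProb false (N.distU p ω i) * eN (φ i false ω)))
      = ∑ e : Fin n → Bool, (K ω * ∏ i : Fin n, eN (φ i (E e i) ω)) *
        ∏ i ∈ Finset.range n, p.linkProb (E e i) (N.distU p ω i) := fun ω => by
    rw [eN_sum, Finset.prod_congr rfl fun i _ => eN_nlog (sum_mul_eN_le_one _ _ _),
      Finset.prod_range]
    have := Finset.prod_univ_sum (fun _ : Fin n => (Finset.univ : Finset Bool))
      (fun i b => p.linkProb b (N.distU p ω i) * eN (φ i b ω))
    simp only [Fintype.sum_bool] at this
    rw [this, Finset.mul_sum]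
    refine Finset.sum_congr (by ext e; simp) fun e _ => ?_
    rw [Finset.prod_range, mul_assoc, ← Finset.prod_mul_distrib]
    congr 1
    refine Finset.prod_congr rfl fun i _ => ?_
    rw [hE, mul_comm]
  have hL : ∀ ω, K ω * eN (∑ i ∈ Finset.range n, φ i (N.los i ω) ω)
      = ∑ e : Fin n → Bool, {ω | ∀ i ∈ Finset.range n, N.los i ω = E e i}.indicator
        (fun ω => K ω * ∏ i : Fin n, eN (φ i (E e i) ω)) ω := fun ω => by
    rw [Finset.sum_eq_single fun i : Fin n => N.los i ω]
    · rw [Set.indicator_of_mem, eN_sum, Finset.prod_range]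
      · simp_rw [hE]
      · intro i hi
        exact (hE (fun i : Fin n => N.los i ω) ⟨i, Finset.mem_range.1 hi⟩).symm
    · intro e _ he
      refine Set.indicator_of_notMem (fun h => he ?_) _
      ext i
      rw [← hE e i]
      exact (h i (Finset.mem_range.2 i.2)).symm
    · simp
  have hH : ∀ e, Measurable[⨆ j, N.sources j] fun ω => K ω * ∏ i : Fin n, eN (φ i (E e i) ω) :=
    fun e => hK.mul (Finset.measurable_prod _ fun i _ => measurable_eN.comp (hφ _ _))
  simp_rw [hR, hL]
  have hq : ∀ e : Fin n → Bool,
      Measurable fun ω => ∏ i ∈ Finset.range n, p.linkProb (E e i) (N.distU p ω i) := fun e =>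
    Finset.measurable_prod _ fun i _ => (p.measurable_linkProb _).comp (hd i)
  have hHq : ∀ e : Fin n → Bool, Measurable fun ω => (K ω * ∏ i : Fin n, eN (φ i (E e i) ω)) *
      ∏ i ∈ Finset.range n, p.linkProb (E e i) (N.distU p ω i) := fun e =>
    ((hH e).mono hG le_rfl).mul (hq e)
  rw [lintegral_finsetSum _ fun e _ => ((hH e).mono hG le_rfl).indicator (hmE e),
    lintegral_finsetSum _ fun e _ => hHq e]
  refine Finset.sum_congr rfl fun e _ => ?_
  rw [lintegral_indicator (hmE e), hN.lintegral_indicator_los (hH e)]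

end IsModel

end Model

/-! ### The Laplace functional of the network -/

/-- `1 - E` for the averaged weight `E` of a thinned station with a random link state. -/
lemma one_sub_thinned {a a' q q' e e' : ℝ≥0∞} (ha : a + a' = 1) (hq : q + q' = 1) (he : e ≤ 1)
    (he' : e' ≤ 1) :
    1 - (a * (q * e + q' * e') + a') = a * q * (1 - e) + a * q' * (1 - e') := by
  have h1 : a * (q * e + q' * e') + a' ≤ 1 := by
    calc _ ≤ a * (q * 1 + q' * 1) + a' := by gcongr
      _ = 1 := by rw [mul_one, mul_one, hq, mul_one, ha]
  refine ENNReal.sub_eq_of_eq_add (h1.trans_lt ENNReal.one_lt_top).ne ?_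
  calc (1 : ℝ≥0∞) = a * (q * 1 + q' * 1) + a' := by rw [mul_one, mul_one, hq, mul_one, ha]
    _ = a * (q * (1 - e + e) + q' * (1 - e' + e')) + a' := by
        rw [tsub_add_cancel_of_le he, tsub_add_cancel_of_le he']
    _ = _ := by ring

lemma lintegral_eN_le_one {β : Type*} [MeasurableSpace β] (ν : Measure β) [IsProbabilityMeasure ν]
    (f : β → ℝ≥0∞) : ∫⁻ m, eN (f m) ∂ν ≤ 1 := by
  calc _ ≤ ∫⁻ _, 1 ∂ν := lintegral_mono fun _ => eN_le_one _
    _ = 1 := by simp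

/-- Law of the availability of a UAV. -/
def Params.availLaw (p : Params) : Measure Bool :=
  ENNReal.ofReal p.Pa • Measure.dirac true + ENNReal.ofReal (1 - p.Pa) • Measure.dirac false

lemma Params.ofReal_Pa_add (p : Params) : ENNReal.ofReal p.Pa + ENNReal.ofReal (1 - p.Pa) = 1 := by
  rw [← ENNReal.ofReal_add p.Pa_nonneg (sub_nonneg.2 p.Pa_le_one)]
  simp

instance (p : Params) : IsProbabilityMeasure p.availLaw :=
  ⟨by simp [Params.availLaw, p.ofReal_Pa_add]⟩

/-- Exponent of the Laplace functional of the UAVs. -/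
def Params.uavExponent (p : Params) (wL wN : Plane × Plane → ℝ → ℝ≥0∞) (u : Plane) : ℝ≥0∞ :=
  ∫⁻ x, (ENNReal.ofReal (p.lamAvail * p.Pl (p.slant u x))
      * (1 - ∫⁻ g, eN (wL (u, x) g) ∂(gammaMeasure p.mL p.mL))
    + ENNReal.ofReal (p.lamAvail * p.Pn (p.slant u x))
      * (1 - ∫⁻ g, eN (wN (u, x) g) ∂(gammaMeasure p.mN p.mN)))

/-- Exponent of the Laplace functional of the TBSs. -/
def Params.tbsExponent (p : Params) (wT : Plane × Plane → ℝ → ℝ≥0∞) (u : Plane) : ℝ≥0∞ :=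
  ENNReal.ofReal p.lamT * ∫⁻ y, (1 - ∫⁻ g, eN (wT (u, y) g) ∂(expMeasure 1))

/-! ### Successive averaging over the marks of a single UAV. -/

section Averages

variable (p : Params) (wL wN : Plane × Plane → ℝ → ℝ≥0∞)

/-- Weight of a UAV after averaging over its link state. -/
def avgLos (z : Plane × Plane) (a : Bool) (gl gn : ℝ) : ℝ≥0∞ :=
  nlog (p.linkProb true (p.slant z.1 z.2) * eN (if a = true then wL z gl else 0)
    + p.linkProb false (p.slant z.1 z.2) * eN (if a = true then wN z gn else 0))

/-- The marks are removed from the inside out: link state, NLoS gain, LoS gain, availability. Each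
stage keeps as arguments exactly the marks not yet averaged. -/
def avgGainN (z : Plane × Plane) (a : Bool) (gl : ℝ) : ℝ≥0∞ :=
  nlog (∫⁻ gn, eN (avgLos p wL wN z a gl gn) ∂(gammaMeasure p.mN p.mN))

def avgGainL (z : Plane × Plane) (a : Bool) : ℝ≥0∞ :=
  nlog (∫⁻ gl, eN (avgGainN p wL wN z a gl) ∂(gammaMeasure p.mL p.mL))

def avgAvail (z : Plane × Plane) : ℝ≥0∞ :=
  nlog (∫⁻ a, eN (avgGainL p wL wN z a) ∂p.availLaw)

instance : IsProbabilityMeasure (gammaMeasure p.mL p.mL) :=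
  isProbabilityMeasure_gammaMeasure p.mL_pos p.mL_pos

instance : IsProbabilityMeasure (gammaMeasure p.mN p.mN) :=
  isProbabilityMeasure_gammaMeasure p.mN_pos p.mN_pos

instance : IsProbabilityMeasure (expMeasure 1) := isProbabilityMeasure_expMeasure one_pos

variable {wL wN}

lemma measurable_avgLos (hL : Measurable (Function.uncurry wL))
    (hN : Measurable (Function.uncurry wN)) :
    Measurable fun y : (((Plane × Plane) × Bool) × ℝ) × ℝ =>
      avgLos p wL wN y.1.1.1 y.1.1.2 y.1.2 y.2 := by
  have h1 : Measurable fun y : (((Plane × Plane) × Bool) × ℝ) × ℝ =>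
      if y.1.1.2 = true then wL y.1.1.1 y.1.2 else 0 :=
    Measurable.ite (measurableSet_eq_fun (by fun_prop) measurable_const)
      (hL.comp (by fun_prop : Measurable fun y : (((Plane × Plane) × Bool) × ℝ) × ℝ =>
        (y.1.1.1, y.1.2))) measurable_const
  have h2 : Measurable fun y : (((Plane × Plane) × Bool) × ℝ) × ℝ =>
      if y.1.1.2 = true then wN y.1.1.1 y.2 else 0 :=
    Measurable.ite (measurableSet_eq_fun (by fun_prop) measurable_const)
      (hN.comp (by fun_prop : Measurable fun y : (((Plane × Plane) × Bool) × ℝ) × ℝ =>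
        (y.1.1.1, y.2))) measurable_const
  have h3 : Measurable fun y : (((Plane × Plane) × Bool) × ℝ) × ℝ => p.slant y.1.1.1.1 y.1.1.1.2 :=
    p.measurable_slant.comp (by fun_prop : Measurable
      fun y : (((Plane × Plane) × Bool) × ℝ) × ℝ => y.1.1.1)
  unfold avgLos
  fun_prop

lemma measurable_avgGainN (hL : Measurable (Function.uncurry wL))
    (hN : Measurable (Function.uncurry wN)) :
    Measurable fun y : ((Plane × Plane) × Bool) × ℝ => avgGainN p wL wN y.1.1 y.1.2 y.2 :=
  measurable_nlog.comp ((measurable_eN.comp (measurable_avgLos p hL hN)).lintegral_prod_right'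
    (ν := gammaMeasure p.mN p.mN))

lemma measurable_avgGainL (hL : Measurable (Function.uncurry wL))
    (hN : Measurable (Function.uncurry wN)) :
    Measurable fun y : (Plane × Plane) × Bool => avgGainL p wL wN y.1 y.2 :=
  measurable_nlog.comp ((measurable_eN.comp (measurable_avgGainN p hL hN)).lintegral_prod_right'
    (ν := gammaMeasure p.mL p.mL))

lemma measurable_avgAvail (hL : Measurable (Function.uncurry wL))
    (hN : Measurable (Function.uncurry wN)) :
    Measurable (avgAvail p wL wN) :=
  measurable_nlog.comp ((measurable_eN.comp (measurable_avgGainL p hL hN)).lintegral_prod_right'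
    (ν := p.availLaw))

/-- Given availability and link state only one gain matters, and an unavailable UAV has weight 0.
The nested averages therefore collapse to a mixture, and one minus the mixture is linear. This is
thinning and colouring: the UAVs split into LoS and NLoS processes of densities `lamAvail * Pl` and
`lamAvail * Pn`. -/
lemma one_sub_eN_avgAvail (hL : Measurable (Function.uncurry wL))
    (hN : Measurable (Function.uncurry wN))
    (z : Plane × Plane) :
    ENNReal.ofReal p.lamU * (1 - eN (avgAvail p wL wN z))
      = ENNReal.ofReal (p.lamAvail * p.Pl (p.slant z.1 z.2))
          * (1 - ∫⁻ g, eN (wL z g) ∂(gammaMeasure p.mL p.mL))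
        + ENNReal.ofReal (p.lamAvail * p.Pn (p.slant z.1 z.2))
          * (1 - ∫⁻ g, eN (wN z g) ∂(gammaMeasure p.mN p.mN)) := by
  have hLz : Measurable (wL z) := hL.comp measurable_prodMk_left
  have hNz : Measurable (wN z) := hN.comp measurable_prodMk_left
  have h1 : ∀ gl gn, eN (avgLos p wL wN z true gl gn)
      = p.linkProb true (p.slant z.1 z.2) * eN (wL z gl)
        + p.linkProb false (p.slant z.1 z.2) * eN (wN z gn) := fun gl gn => by
    rw [avgLos, eN_nlog (sum_mul_eN_le_one _ _ _)]; simp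
  have h1' : ∀ gl gn, eN (avgLos p wL wN z false gl gn) = 1 := fun gl gn => by
    rw [avgLos, eN_nlog (sum_mul_eN_le_one _ _ _)]
    simp [p.linkProb_add]
  have h2 : ∀ gl, eN (avgGainN p wL wN z true gl)
      = p.linkProb true (p.slant z.1 z.2) * eN (wL z gl) + p.linkProb false (p.slant z.1 z.2)
        * ∫⁻ g, eN (wN z g) ∂(gammaMeasure p.mN p.mN) := fun gl => by
    rw [avgGainN, eN_nlog (lintegral_eN_le_one _ _)]
    simp_rw [h1]
    rw [lintegral_add_left measurable_const, lintegral_const, measure_univ, mul_one,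
      lintegral_const_mul _ (by fun_prop)]
  have h2' : ∀ gl, eN (avgGainN p wL wN z false gl) = 1 := fun gl => by
    rw [avgGainN, eN_nlog (lintegral_eN_le_one _ _)]
    simp_rw [h1']
    simp
  have h3 : eN (avgGainL p wL wN z true)
      = p.linkProb true (p.slant z.1 z.2) * (∫⁻ g, eN (wL z g) ∂(gammaMeasure p.mL p.mL))
        + p.linkProb false (p.slant z.1 z.2) * ∫⁻ g, eN (wN z g) ∂(gammaMeasure p.mN p.mN) := by
    rw [avgGainL, eN_nlog (lintegral_eN_le_one _ _)]
    simp_rw [h2]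
    rw [lintegral_add_right _ measurable_const, lintegral_const, measure_univ, mul_one,
      lintegral_const_mul _ (by fun_prop)]
  have h3' : eN (avgGainL p wL wN z false) = 1 := by
    rw [avgGainL, eN_nlog (lintegral_eN_le_one _ _)]
    simp_rw [h2']
    simp
  rw [avgAvail, eN_nlog (lintegral_eN_le_one _ _), Params.availLaw, lintegral_add_measure,
    lintegral_smul_measure, lintegral_smul_measure, lintegral_dirac, lintegral_dirac, h3, h3',
    smul_eq_mul, smul_eq_mul, mul_one,
    one_sub_thinned p.ofReal_Pa_add (p.linkProb_add _) (lintegral_eN_le_one _ _)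
      (lintegral_eN_le_one _ _)]
  have hlam : 0 ≤ p.lamAvail := mul_nonneg p.Pa_nonneg p.lamU_pos.le
  rw [ENNReal.ofReal_mul hlam, ENNReal.ofReal_mul hlam, Params.lamAvail,
    ENNReal.ofReal_mul p.Pa_nonneg]
  simp only [Params.linkProb, if_true, Bool.false_eq_true, if_false]
  ring

end Averages

section Model

variable {Ω : Type*} [mΩ : MeasurableSpace Ω] {μ : Measure Ω}
  {p : Params} {N : Network Ω}

/-- Weight of UAV `i`. -/
def Network.uavWeight (N : Network Ω) (wL wN : Plane × Plane → ℝ → ℝ≥0∞) (ω : Ω) (i : ℕ) : ℝ≥0∞ :=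
  if N.avail i ω = true then
    if N.los i ω = true then wL (N.user ω, N.uav i ω) (N.gainL i ω)
    else wN (N.user ω, N.uav i ω) (N.gainN i ω)
  else 0

/-- Weight of TBS `k`. -/
def Network.tbsWeight (N : Network Ω) (wT : Plane × Plane → ℝ → ℝ≥0∞) (ω : Ω) (k : ℕ) : ℝ≥0∞ :=
  wT (N.user ω, N.tbs k ω) (N.gainT k ω)

namespace IsModel

lemma hasLaw_avail [IsProbabilityMeasure μ] (hN : IsModel p N μ) (i : ℕ) :
    HasLaw (N.avail i) p.availLaw μ where
  aemeasurable := (hN.measurable_avail i).aemeasurable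
  map_eq := by
    have h1 : μ (N.avail i ⁻¹' {true}) = ENNReal.ofReal p.Pa := hN.avail_law i
    have h2 : μ (N.avail i ⁻¹' {false}) = ENNReal.ofReal (1 - p.Pa) := by
      have : N.avail i ⁻¹' {false} = (N.avail i ⁻¹' {true})ᶜ := by ext ω; simp
      rw [this, prob_compl_eq_one_sub (hN.measurable_avail i (measurableSet_singleton _)), h1,
        ENNReal.ofReal_sub _ p.Pa_nonneg, ENNReal.ofReal_one]
    refine Measure.ext_of_singleton fun b => ?_
    rw [Measure.map_apply (hN.measurable_avail i) (measurableSet_singleton _)]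
    cases b
    · rw [h2]; simp [Params.availLaw]
    · rw [h1]; simp [Params.availLaw]

end IsModel

end Model

/-! ### Averaging relative to an independent σ-algebra. -/

section SigmaAlgebra

variable {Ω β γ : Type*}

lemma measurable_tsum_ennreal {m : MeasurableSpace Ω} {f : ℕ → Ω → ℝ≥0∞}
    (hf : ∀ i, Measurable (f i)) : Measurable fun ω => ∑' i, f i ω := Measurable.tsum hf

lemma measurable_seq [MeasurableSpace γ] {m : MeasurableSpace Ω} {P : ℕ → Ω → γ}
    (hP : ∀ i, Measurable (P i)) : Measurable fun ω i => P i ω := measurable_pi_lambda _ hP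

variable [MeasurableSpace β] [MeasurableSpace γ] {m mΩ : MeasurableSpace Ω}
  {μ : Measure Ω} [IsProbabilityMeasure μ]

/-- Marks independent of a σ-algebra may be averaged out. -/
lemma lintegral_marks_of_indep (hm : m ≤ mΩ) {M : ℕ → Ω → β} (hM : ∀ i, Measurable (M i))
    (h : Indep (MeasurableSpace.comap (fun ω i => M i ω) inferInstance) m μ) (hi : iIndepFun M μ)
    {ν : Measure β} (hν : ∀ i, HasLaw (M i) ν μ) {K : Ω → ℝ≥0∞} (hK : Measurable[m] K)
    {P : ℕ → Ω → γ} (hP : ∀ i, Measurable[m] (P i)) {φ : γ → β → ℝ≥0∞}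
    (hφ : Measurable (Function.uncurry φ)) :
    ∫⁻ ω, K ω * eN (∑' i, φ (P i ω) (M i ω)) ∂μ
      = ∫⁻ ω, K ω * eN (∑' i, nlog (∫⁻ g, eN (φ (P i ω) g) ∂ν)) ∂μ := by
  have hZ : Measurable[m] fun ω => (K ω, fun i => P i ω) := hK.prodMk (measurable_seq hP)
  refine lintegral_marks (Z := fun ω => (K ω, fun i => P i ω)) (K := Prod.fst)
    (φ := fun i z g => φ (z.2 i) g) hM (hZ.mono hm le_rfl) ?_ hi hν measurable_fst fun i => ?_
  · exact indep_of_indep_of_le_right h hZ.comap_le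
  · exact hφ.comp (by fun_prop : Measurable fun y : (ℝ≥0∞ × (ℕ → γ)) × β => (y.1.2 i, y.2))

lemma IsPoissonProcess.lintegral_of_indep (hm : m ≤ mΩ) {X : ℕ → Ω → Plane} {lam : ℝ}
    (hX : IsPoissonProcess X lam μ)
    (h : Indep (MeasurableSpace.comap (fun ω i => X i ω) inferInstance) m μ)
    {K : Ω → ℝ≥0∞} (hK : Measurable[m] K) {U : Ω → γ} (hU : Measurable[m] U)
    {w : γ → Plane → ℝ≥0∞} (hw : Measurable (Function.uncurry w)) :
    ∫⁻ ω, K ω * eN (∑' i, w (U ω) (X i ω)) ∂μ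
      = ∫⁻ ω, K ω * eN (ENNReal.ofReal lam * ∫⁻ x, (1 - eN (w (U ω) x))) ∂μ := by
  have hZ : Measurable[m] fun ω => (K ω, U ω) := hK.prodMk hU
  refine hX.lintegral_mul_eN (Z := fun ω => (K ω, U ω)) (K := Prod.fst) (w := fun z x => w z.2 x)
    (hZ.mono hm le_rfl) ?_ measurable_fst ?_
  · exact indep_of_indep_of_le_right h hZ.comap_le
  · exact hw.comp ((measurable_snd.comp measurable_fst).prodMk measurable_snd)

end SigmaAlgebra

section Model

variable {Ω : Type*} [mΩ : MeasurableSpace Ω] {μ : Measure Ω} [IsProbabilityMeasure μ]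
  {p : Params} {N : Network Ω}

namespace IsModel

/-- Averaging over the link states. -/
lemma lintegral_weights_los (hN : IsModel p N μ) {κ : Plane × Bool → ℝ≥0∞} (hκ : Measurable κ)
    (hκ1 : ∀ z, κ z ≤ 1) {wL wN wT : Plane × Plane → ℝ → ℝ≥0∞}
    (hL : Measurable (Function.uncurry wL)) (hN' : Measurable (Function.uncurry wN))
    (hT : Measurable (Function.uncurry wT)) :
    ∫⁻ ω, κ (N.user ω, N.clusterAvail ω)
        * eN (∑' i, N.uavWeight wL wN ω i + ∑' k, N.tbsWeight wT ω k) ∂μ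
      = ∫⁻ ω, κ (N.user ω, N.clusterAvail ω) * eN (∑' k, N.tbsWeight wT ω k)
        * eN (∑' i, avgLos p wL wN (N.user ω, N.uav i ω) (N.avail i ω) (N.gainL i ω)
            (N.gainN i ω)) ∂μ := by
  have hall : N.sourceSup Set.univ = ⨆ j, N.sources j := by simp [Network.sourceSup]
  have hu : Measurable[⨆ j, N.sources j] N.user := hall ▸ N.measurable_user' (Set.mem_univ 0)
  have hc : Measurable[⨆ j, N.sources j] N.clusterAvail :=
    hall ▸ N.measurable_clusterAvail' (Set.mem_univ 1)
  have hx : Measurable[⨆ j, N.sources j] fun ω i => N.uav i ω :=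
    hall ▸ N.measurable_uav' (Set.mem_univ 2)
  have ha : Measurable[⨆ j, N.sources j] fun ω i => N.avail i ω :=
    hall ▸ N.measurable_avail' (Set.mem_univ 3)
  have hgl : Measurable[⨆ j, N.sources j] fun ω i => N.gainL i ω :=
    hall ▸ N.measurable_gainL' (Set.mem_univ 4)
  have hgn : Measurable[⨆ j, N.sources j] fun ω i => N.gainN i ω :=
    hall ▸ N.measurable_gainN' (Set.mem_univ 5)
  have hy : Measurable[⨆ j, N.sources j] fun ω k => N.tbs k ω :=
    hall ▸ N.measurable_tbs' (Set.mem_univ 6)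
  have hgt : Measurable[⨆ j, N.sources j] fun ω k => N.gainT k ω :=
    hall ▸ N.measurable_gainT' (Set.mem_univ 7)
  have ev : ∀ {β : Type} [MeasurableSpace β] {f : ℕ → Ω → β},
      Measurable[⨆ j, N.sources j] (fun ω i => f i ω) → ∀ i,
      Measurable[⨆ j, N.sources j] (f i) := fun h i => (measurable_pi_apply i).comp h
  have key := hN.lintegral_los
    (K := fun ω => κ (N.user ω, N.clusterAvail ω) * eN (∑' k, N.tbsWeight wT ω k))
    (φ := fun i b ω => if N.avail i ω = true then
      if b = true then wL (N.user ω, N.uav i ω) (N.gainL i ω)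
      else wN (N.user ω, N.uav i ω) (N.gainN i ω) else 0)
    ((hκ.comp (hu.prodMk hc)).mul (measurable_eN.comp (measurable_tsum_ennreal fun k =>
      hT.comp ((hu.prodMk (ev hy k)).prodMk (ev hgt k)))))
    (fun ω => (mul_le_mul' (hκ1 _) (eN_le_one _)).trans (one_mul 1).le)
    (fun i b => by
      refine Measurable.ite (ev ha i (measurableSet_singleton true)) ?_ measurable_const
      cases b
      · exact hN'.comp ((hu.prodMk (ev hx i)).prodMk (ev hgn i))
      · exact hL.comp ((hu.prodMk (ev hx i)).prodMk (ev hgl i)))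
  refine Eq.trans (lintegral_congr fun ω => ?_) (key.trans (lintegral_congr fun ω => ?_))
  · rw [eN_add, mul_assoc, mul_comm (eN (∑' i, _))]
    rfl
  · simp [avgLos, Network.distU, Params.slant, dist_comm]

/-- The Laplace functional of the network seen by the typical user. -/
theorem lintegral_weights (hN : IsModel p N μ) {κ : Plane × Bool → ℝ≥0∞} (hκ : Measurable κ)
    (hκ1 : ∀ z, κ z ≤ 1) {wL wN wT : Plane × Plane → ℝ → ℝ≥0∞}
    (hL : Measurable (Function.uncurry wL)) (hN' : Measurable (Function.uncurry wN))
    (hT : Measurable (Function.uncurry wT)) :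
    ∫⁻ ω, κ (N.user ω, N.clusterAvail ω)
        * eN (∑' i, N.uavWeight wL wN ω i + ∑' k, N.tbsWeight wT ω k) ∂μ
      = ∫⁻ ω, κ (N.user ω, N.clusterAvail ω)
        * eN (p.uavExponent wL wN (N.user ω) + p.tbsExponent wT (N.user ω)) ∂μ := by
  have mLos := measurable_avgLos p hL hN'
  have mGN := measurable_avgGainN p hL hN'
  have mGL := measurable_avgGainL p hL hN'
  have mA := measurable_avgAvail p hL hN'
  let T : Plane × Plane → ℝ≥0∞ := fun z => nlog (∫⁻ g, eN (wT z g) ∂(expMeasure 1))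
  have mT : Measurable T := measurable_nlog.comp (measurable_eN.comp hT).lintegral_prod_right'
  have hTexp : Measurable fun u => p.tbsExponent wT u := by
    have h : Measurable fun z => 1 - ∫⁻ g, eN (wT z g) ∂(expMeasure 1) :=
      measurable_const.sub (measurable_eN.comp hT).lintegral_prod_right'
    exact measurable_const.mul h.lintegral_prod_right'
  -- Measurability is recorded relative to every subfamily containing the sources used, because each
  -- averaging step below freezes a different subfamily.
  have mκ : ∀ S : Set (Fin 8), 0 ∈ S → 1 ∈ S →
      Measurable[N.sourceSup S] fun ω => κ (N.user ω, N.clusterAvail ω) := fun S h0 h1 =>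
    hκ.comp ((N.measurable_user' h0).prodMk (N.measurable_clusterAvail' h1))
  have mX : ∀ S : Set (Fin 8), 0 ∈ S → 2 ∈ S → ∀ i,
      Measurable[N.sourceSup S] fun ω => (N.user ω, N.uav i ω) := fun S h0 h2 i =>
    (N.measurable_user' h0).prodMk ((measurable_pi_apply i).comp (N.measurable_uav' h2))
  have mY : ∀ S : Set (Fin 8), 0 ∈ S → 6 ∈ S → ∀ i,
      Measurable[N.sourceSup S] fun ω => (N.user ω, N.tbs i ω) := fun S h0 h2 i =>
    (N.measurable_user' h0).prodMk ((measurable_pi_apply i).comp (N.measurable_tbs' h2))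
  have mXA : ∀ S : Set (Fin 8), 0 ∈ S → 2 ∈ S → 3 ∈ S → ∀ i,
      Measurable[N.sourceSup S] fun ω => ((N.user ω, N.uav i ω), N.avail i ω) :=
    fun S h0 h2 h3 i =>
    (mX S h0 h2 i).prodMk ((measurable_pi_apply i).comp (N.measurable_avail' h3))
  have mXAL : ∀ S : Set (Fin 8), 0 ∈ S → 2 ∈ S → 3 ∈ S → 4 ∈ S → ∀ i,
      Measurable[N.sourceSup S] fun ω => (((N.user ω, N.uav i ω), N.avail i ω), N.gainL i ω) :=
    fun S h0 h2 h3 h4 i =>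
    (mXA S h0 h2 h3 i).prodMk ((measurable_pi_apply i).comp (N.measurable_gainL' h4))
  have mXALN : ∀ S : Set (Fin 8), 0 ∈ S → 2 ∈ S → 3 ∈ S → 4 ∈ S → 5 ∈ S → ∀ i,
      Measurable[N.sourceSup S] fun ω =>
        ((((N.user ω, N.uav i ω), N.avail i ω), N.gainL i ω), N.gainN i ω) :=
    fun S h0 h2 h3 h4 h5 i =>
    (mXAL S h0 h2 h3 h4 i).prodMk ((measurable_pi_apply i).comp (N.measurable_gainN' h5))
  -- the fading gains of the TBSs
  have s1 := lintegral_marks_of_indep (hN.sourceSup_le {7}ᶜ) hN.measurable_gainT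
    (hN.indep_sourceSup (j := 7) (by simp)) hN.gainT_indep hN.gainT_law
    ((mκ {7}ᶜ (by simp) (by simp)).mul (measurable_eN.comp (measurable_tsum_ennreal fun i =>
      mLos.comp (mXALN _ (by simp) (by simp) (by simp) (by simp) (by simp) i))))
    (mY _ (by simp) (by simp)) hT
  -- the positions of the TBSs
  have s2 := hN.tbs_law.lintegral_of_indep (hN.sourceSup_le {6, 7}ᶜ)
    (hN.indep_sourceSup (j := 6) (by simp))
    ((mκ {6, 7}ᶜ (by simp) (by simp)).mul (measurable_eN.comp (measurable_tsum_ennreal fun i =>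
      mLos.comp (mXALN _ (by simp) (by simp) (by simp) (by simp) (by simp) i))))
    (N.measurable_user' (by simp)) (w := fun u y => T (u, y)) mT
  have mK : ∀ S : Set (Fin 8), 0 ∈ S → 1 ∈ S → Measurable[N.sourceSup S] fun ω =>
      κ (N.user ω, N.clusterAvail ω) * eN (p.tbsExponent wT (N.user ω)) := fun S h0 h1 =>
    (mκ S h0 h1).mul (measurable_eN.comp (hTexp.comp (N.measurable_user' h0)))
  -- the fading gains of the UAVs
  have s3 := lintegral_marks_of_indep (hN.sourceSup_le {5}ᶜ) hN.measurable_gainN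
    (hN.indep_sourceSup (j := 5) (by simp)) hN.gainN_indep hN.gainN_law
    (mK {5}ᶜ (by simp) (by simp))
    (mXAL _ (by simp) (by simp) (by simp) (by simp))
    (φ := fun z g => avgLos p wL wN z.1.1 z.1.2 z.2 g) mLos
  have s4 := lintegral_marks_of_indep (hN.sourceSup_le {4}ᶜ) hN.measurable_gainL
    (hN.indep_sourceSup (j := 4) (by simp)) hN.gainL_indep hN.gainL_law
    (mK {4}ᶜ (by simp) (by simp))
    (mXA _ (by simp) (by simp) (by simp))
    (φ := fun z g => avgGainN p wL wN z.1 z.2 g) mGN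
  have s5 := lintegral_marks_of_indep (hN.sourceSup_le {3}ᶜ) hN.measurable_avail
    (hN.indep_sourceSup (j := 3) (by simp)) hN.avail_indep hN.hasLaw_avail
    (mK {3}ᶜ (by simp) (by simp)) (mX _ (by simp) (by simp))
    (φ := fun z g => avgGainL p wL wN z g) mGL
  have s6 := hN.uav_law.lintegral_of_indep (hN.sourceSup_le {2}ᶜ)
    (hN.indep_sourceSup (j := 2) (by simp)) (mK {2}ᶜ (by simp) (by simp))
    (N.measurable_user' (by simp)) (w := fun u x => avgAvail p wL wN (u, x)) mA
  have e1 : ∀ u, ENNReal.ofReal p.lamT * ∫⁻ y, (1 - eN (T (u, y))) = p.tbsExponent wT u := by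
    intro u
    simp only [T, eN_nlog (lintegral_eN_le_one _ _)]
    rfl
  have e2 : ∀ u, ENNReal.ofReal p.lamU * ∫⁻ x, (1 - eN (avgAvail p wL wN (u, x)))
      = p.uavExponent wL wN u := by
    intro u
    rw [← lintegral_const_mul' _ _ ENNReal.ofReal_ne_top]
    exact lintegral_congr fun x => one_sub_eN_avgAvail p hL hN' (u, x)
  rw [hN.lintegral_weights_los hκ hκ1 hL hN' hT]
  refine Eq.trans (lintegral_congr fun ω => mul_right_comm _ _ _) (s1.trans (s2.trans ?_))
  simp only [e1]
  refine Eq.trans (lintegral_congr fun ω => mul_right_comm _ _ _) (s3.trans (s4.trans (s5.trans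
    (s6.trans (lintegral_congr fun ω => ?_)))))
  rw [e2, mul_assoc, ← eN_add, add_comm (p.tbsExponent _ _)]

end IsModel

end Model

/-! ### Polar coordinates and Gamma fading -/

/-- Off the origin the plane is the product of circle and half line; the circle has length `2π` and
the radial density is `z`. -/
lemma lintegral_norm_plane {F : ℝ → ℝ≥0∞} (hF : Measurable F) :
    ∫⁻ x : Plane, F ‖x‖ = ∫⁻ z in Set.Ioi 0, ENNReal.ofReal (2 * Real.pi * z) * F z := by
  have hdim : Module.finrank ℝ Plane = 2 := by simp [Plane]
  have hmp := (volume : Measure Plane).measurePreserving_homeomorphUnitSphereProd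
  have hsph : (volume : Measure Plane).toSphere Set.univ = ENNReal.ofReal (2 * Real.pi) := by
    rw [Measure.toSphere_apply_univ, hdim, EuclideanSpace.volume_ball_fin_two]
    rw [ENNReal.ofReal_one, one_pow, one_mul, ENNReal.ofReal_mul zero_le_two]
    congr 1
    simp
  calc ∫⁻ x : Plane, F ‖x‖
      = ∫⁻ x in {(0 : Plane)}ᶜ, F ‖x‖ := by rw [restrict_compl_singleton]
    _ = ∫⁻ x : ({(0 : Plane)}ᶜ : Set Plane), F ‖x.1‖ ∂(volume.comap Subtype.val) :=
        (lintegral_subtype_comap (measurableSet_singleton _).compl fun x => F ‖x‖).symm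
    _ = ∫⁻ x, F x.2 ∂(volume : Measure Plane).toSphere.prod
          (.volumeIoiPow (Module.finrank ℝ Plane - 1)) := by
        have := hmp.lintegral_comp (f := fun x => F x.2)
          (hF.comp (measurable_subtype_coe.comp measurable_snd))
        simpa using this
    _ = ∫⁻ r : Set.Ioi (0 : ℝ), ENNReal.ofReal (2 * Real.pi) * F r ∂(.volumeIoiPow 1) := by
        have hF2 : Measurable fun x : Metric.sphere (0 : Plane) 1 × Set.Ioi (0 : ℝ) => F x.2 :=
          hF.comp (measurable_subtype_coe.comp measurable_snd)
        rw [hdim, lintegral_prod_symm _ hF2.aemeasurable]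
        refine lintegral_congr fun r => ?_
        change ∫⁻ _, F r ∂_ = _
        rw [lintegral_const, hsph, mul_comm]
    _ = ∫⁻ r : Set.Ioi (0 : ℝ), ENNReal.ofReal (2 * Real.pi * r) * F r
          ∂(.comap Subtype.val volume) := by
        rw [Measure.volumeIoiPow, lintegral_withDensity_eq_lintegral_mul _ (by fun_prop)
          (by fun_prop)]
        refine lintegral_congr fun r => ?_
        simp only [Pi.mul_apply, pow_one]
        rw [ENNReal.ofReal_mul (p := 2 * Real.pi) (by positivity)]
        ring
    _ = _ := lintegral_subtype_comap measurableSet_Ioi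
          fun z => ENNReal.ofReal (2 * Real.pi * z) * F z

/-- Translation invariance of area: this is why exponents depending only on distances to the user do
not depend on where the user is. -/
lemma lintegral_dist_plane {F : ℝ → ℝ≥0∞} (hF : Measurable F) (u : Plane) :
    ∫⁻ x : Plane, F (dist x u) = ∫⁻ z in Set.Ioi 0, ENNReal.ofReal (2 * Real.pi * z) * F z := by
  rw [← lintegral_norm_plane hF]
  simp_rw [dist_eq_norm]
  exact lintegral_sub_right_eq_self (fun x : Plane => F ‖x‖) u

/-- The Laplace transform of a Gamma distribution of unit mean. -/
lemma lintegral_eN_gamma {m s c : ℝ} (hm : 0 < m) (hs : 0 ≤ s) (hc : 0 ≤ c) :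
    ∫⁻ g, eN (ENNReal.ofReal s * ENNReal.ofReal (c * g)) ∂(gammaMeasure m m)
      = ENNReal.ofReal ((m / (m + s * c)) ^ m) := by
  have hsc : 0 ≤ s * c := mul_nonneg hs hc
  have hr : 0 < m + s * c := by linarith
  have hmeas : Measurable (gammaPDF m m) := (measurable_gammaPDFReal m m).ennreal_ofReal
  rw [gammaMeasure, lintegral_withDensity_eq_lintegral_mul _ hmeas (by fun_prop)]
  -- Exponential tilting: the Gamma density of rate `m` times `exp (-s c g)` is a constant times the
  -- Gamma density of rate `m + s c`.
  calc _ = ∫⁻ g, ENNReal.ofReal ((m / (m + s * c)) ^ m) * gammaPDF m (m + s * c) g := by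
        refine lintegral_congr fun g => ?_
        simp only [Pi.mul_apply]
        rcases lt_or_ge g 0 with hg | hg
        · simp [gammaPDF_of_neg hg]
        · rw [← ENNReal.ofReal_mul hs, eN_ofReal (by positivity), gammaPDF_of_nonneg hg,
            gammaPDF_of_nonneg hg, ← ENNReal.ofReal_mul' (Real.exp_pos _).le,
            ← ENNReal.ofReal_mul (by positivity)]
          congr 1
          rw [Real.div_rpow hm.le hr.le, mul_assoc, ← Real.exp_add]
          have h1 : (m + s * c) ^ m ≠ 0 := (Real.rpow_pos_of_pos hr m).ne'
          rw [show -(m * g) + -(s * (c * g)) = -((m + s * c) * g) by ring]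
          field_simp
    _ = _ := by
        have h := (measurable_gammaPDFReal m (m + s * c)).ennreal_ofReal
        rw [lintegral_const_mul (f := gammaPDF m (m + s * c)) _ h,
          lintegral_gammaPDF_eq_one hm hr, mul_one]

/-! ### Average powers, densities and fading of the kinds of stations -/

namespace Params

variable (p : Params)

/-- Average power received from a station of the given kind at horizontal distance `d`. -/
def power : Kind → ℝ → ℝ
  | .cluster, _ => 0
  | .los, d => p.etaL * p.rhoU * √(d ^ 2 + p.h ^ 2) ^ (-p.alphaL)
  | .nlos, d => p.etaN * p.rhoU * √(d ^ 2 + p.h ^ 2) ^ (-p.alphaN)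
  | .tbs, d => p.rhoT * d ^ (-p.alphaT)

/-- Density of the candidates of the given kind at horizontal distance `d`. -/
def density : Kind → ℝ → ℝ≥0∞
  | .cluster, _ => 0
  | .los, d => ENNReal.ofReal (p.lamAvail * p.Pl (√(d ^ 2 + p.h ^ 2)))
  | .nlos, d => ENNReal.ofReal (p.lamAvail * p.Pn (√(d ^ 2 + p.h ^ 2)))
  | .tbs, _ => ENNReal.ofReal p.lamT

/-- Fading law of the stations of the given kind. -/
def fading : Kind → Measure ℝ
  | .cluster => expMeasure 1
  | .los => gammaMeasure p.mL p.mL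
  | .nlos => gammaMeasure p.mN p.mN
  | .tbs => expMeasure 1

instance (k : Kind) : IsProbabilityMeasure (p.fading k) := by
  cases k <;> simp only [fading] <;> infer_instance

/-- Shape parameter of the fading. -/
def shape : Kind → ℝ
  | .cluster => 1
  | .los => p.mL
  | .nlos => p.mN
  | .tbs => 1

lemma shape_pos (k : Kind) : 0 < p.shape k := by
  cases k <;> simp [shape, p.mL_pos, p.mN_pos]

/-- The exponential law is by definition the Gamma law of shape 1, so Rayleigh fading needs no
separate Laplace transform. -/
lemma fading_eq (k : Kind) : p.fading k = gammaMeasure (p.shape k) (p.shape k) := by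
  cases k <;> rfl

lemma power_nonneg (k : Kind) {d : ℝ} (hd : 0 ≤ d) : 0 ≤ p.power k d := by
  have h1 := p.etaL_pos
  have h2 := p.etaN_pos
  have h3 := p.rhoU_pos
  have h4 := p.rhoT_pos
  cases k <;> simp only [power] <;> positivity

@[fun_prop]
lemma measurable_power (k : Kind) : Measurable (p.power k) := by
  cases k <;> unfold power <;> fun_prop

@[fun_prop]
lemma measurable_density (k : Kind) : Measurable (p.density k) := by
  cases k <;> unfold density <;> fun_prop

/-- One minus the Laplace transform of the power received at horizontal distance `d`. -/
def loss (k : Kind) (s d : ℝ) : ℝ≥0∞ :=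
  ENNReal.ofReal (1 - (p.shape k / (p.shape k + s * p.power k d)) ^ p.shape k)

@[fun_prop]
lemma measurable_loss (k : Kind) (s : ℝ) : Measurable (p.loss k s) := by
  unfold loss
  fun_prop

lemma one_sub_lintegral_fading (k : Kind) {s d : ℝ} (hs : 0 ≤ s) (hd : 0 ≤ d) :
    1 - ∫⁻ g, eN (ENNReal.ofReal s * ENNReal.ofReal (p.power k d * g)) ∂(p.fading k)
      = p.loss k s d := by
  have h0 := p.shape_pos k
  have h1 : 0 ≤ s * p.power k d := mul_nonneg hs (p.power_nonneg k hd)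
  rw [fading_eq, lintegral_eN_gamma h0 hs (p.power_nonneg k hd), loss,
    ENNReal.ofReal_sub _ (by positivity), ENNReal.ofReal_one]

lemma loss_zero (k : Kind) (d : ℝ) : p.loss k 0 d = 0 := by
  simp [loss, (p.shape_pos k).ne']

/-- Sum over the kinds of candidates. -/
def kindSum (f : Kind → ℝ≥0∞) : ℝ≥0∞ := f .los + f .nlos + f .tbs

/-- Total exponent of the Laplace functional. -/
lemma exponent_eq {w : Kind → Plane × Plane → ℝ → ℝ≥0∞}
    (hw : ∀ k, Measurable (Function.uncurry (w k))) (u : Plane) :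
    p.uavExponent (w .los) (w .nlos) u + p.tbsExponent (w .tbs) u
      = kindSum fun k => ∫⁻ x, p.density k (dist x u)
          * (1 - ∫⁻ g, eN (w k (u, x) g) ∂(p.fading k)) := by
  have hm : ∀ k, Measurable fun x => 1 - ∫⁻ g, eN (w k (u, x) g) ∂(p.fading k) := fun k =>
    measurable_const.sub ((measurable_eN.comp (hw k)).lintegral_prod_right'.comp
      measurable_prodMk_left)
  have hd : Measurable fun x => p.density .los (dist x u)
      * (1 - ∫⁻ g, eN (w .los (u, x) g) ∂(p.fading .los)) :=
    (by fun_prop : Measurable fun x : Plane => p.density .los (dist x u)).mul (hm .los)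
  rw [uavExponent, tbsExponent, kindSum, ← lintegral_add_left hd]
  congr 1
  exact (lintegral_const_mul _ (hm .tbs)).symm

end Params

/-! ### Isolating a single strong station -/

section Isolate

open scoped Classical in
/-- Total weight `θ` for each strong index in `A`, `∞` for the other strong indices and `f j` for
the weak ones. -/
def isolateWeight {ι : Type*} (near inA : ι → Prop) (f : ι → ℝ≥0∞) (θ : ℝ≥0∞) (j : ι) : ℝ≥0∞ :=
  if near j then (if inA j then θ else ∞) else f j

lemma expNat_mul_eN (n : ℕ) : ENNReal.ofReal (Real.exp n) * eN n = 1 := by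
  have : (n : ℝ≥0∞) = ENNReal.ofReal n := by simp
  rw [this, eN_ofReal (Nat.cast_nonneg n), ← ENNReal.ofReal_mul (Real.exp_pos _).le,
    ← Real.exp_add]
  simp

lemma tendsto_eN_nat : Tendsto (fun n : ℕ => eN n) atTop (𝓝 0) := by
  have h := (continuous_eN.tendsto ∞).comp ENNReal.tendsto_nat_nhds_top
  rwa [eN_top] at h

variable {ι : Type*} (near inA : ι → Prop) (f : ι → ℝ≥0∞)

/-- Domination for the limit below. A strong index makes the total at least `n`, which compensates
`exp n`; without strong indices the two totals coincide. -/
lemma isolate_le (n : ℕ) : ENNReal.ofReal (Real.exp n) *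
    (eN (∑' j, isolateWeight near inA f n j) - eN (∑' j, isolateWeight near inA f ∞ j)) ≤ 1 := by
  by_cases h : ∃ j, near j
  · obtain ⟨j, hj⟩ := h
    have h1 : (n : ℝ≥0∞) ≤ ∑' j, isolateWeight near inA f n j := by
      refine le_trans ?_ (ENNReal.le_tsum j)
      rw [isolateWeight, if_pos hj]
      split_ifs <;> simp
    calc _ ≤ ENNReal.ofReal (Real.exp n) * eN n := by
          gcongr
          exact tsub_le_self.trans (eN_antitone h1)
      _ = 1 := expNat_mul_eN n
  · push Not at h
    simp [isolateWeight, h]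

open scoped Classical in
-- With no strong index the difference is 0. A strong index outside `A` makes both totals infinite.
-- A unique strong index in `A` contributes exactly `n`, which cancels `exp n`. Two strong indices
-- contribute at least `2n`, and what remains is at most `exp (-n)`.
lemma tendsto_isolate : Tendsto (fun n : ℕ => ENNReal.ofReal (Real.exp n) *
    (eN (∑' j, isolateWeight near inA f n j) - eN (∑' j, isolateWeight near inA f ∞ j))) atTop
    (𝓝 (if ∃ j, near j ∧ inA j ∧ ∀ j', near j' → j' = j then
      eN (∑' j, if near j then 0 else f j) else 0)) := by
  by_cases h0 : ∃ j, near j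
  swap
  · push Not at h0
    simp [isolateWeight, h0]
  by_cases hA : ∃ j, near j ∧ ¬ inA j
  · obtain ⟨j, hj, hjA⟩ := hA
    have htop : ∀ θ, ∑' j, isolateWeight near inA f θ j = ∞ := fun θ => by
      refine top_le_iff.1 (le_trans ?_ (ENNReal.le_tsum j))
      rw [isolateWeight, if_pos hj, if_neg hjA]
    rw [if_neg]
    · simp [htop]
    · rintro ⟨i, _, hiA, hu⟩
      exact hjA (hu j hj ▸ hiA)
  push Not at hA
  obtain ⟨j, hj⟩ := h0
  have htop : ∑' j, isolateWeight near inA f ∞ j = ∞ := by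
    refine top_le_iff.1 (le_trans ?_ (ENNReal.le_tsum j))
    rw [isolateWeight, if_pos hj, if_pos (hA j hj)]
  simp only [htop, eN_top, tsub_zero]
  by_cases hu : ∀ j', near j' → j' = j
  · rw [if_pos ⟨j, hj, hA j hj, hu⟩]
    refine tendsto_const_nhds.congr fun n => ?_
    have h1 : ∀ i, isolateWeight near inA f n i
        = (if i = j then (n : ℝ≥0∞) else 0) + if near i then 0 else f i := fun i => by
      by_cases hi : near i
      · obtain rfl := hu i hi
        simp [isolateWeight, hi, hA]
      · have : i ≠ j := fun h => hi (h ▸ hj)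
        simp [isolateWeight, hi, this]
    simp_rw [h1]
    rw [ENNReal.tsum_add, tsum_ite_eq, eN_add, ← mul_assoc, expNat_mul_eN, one_mul]
  · rw [if_neg]
    · push Not at hu
      obtain ⟨i, hi, hij⟩ := hu
      refine tendsto_of_tendsto_of_tendsto_of_le_of_le tendsto_const_nhds tendsto_eN_nat
        (fun n => zero_le) fun n => ?_
      have h1 : (n : ℝ≥0∞) + n ≤ ∑' j, isolateWeight near inA f n j := by
        refine le_trans ?_ (ENNReal.sum_le_tsum {i, j})
        rw [Finset.sum_pair hij, isolateWeight, isolateWeight, if_pos hi, if_pos (hA i hi),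
          if_pos hj, if_pos (hA j hj)]
      calc _ ≤ ENNReal.ofReal (Real.exp n) * eN (n + n) := by
            gcongr
            exact eN_antitone h1
        _ = eN n := by rw [eN_add, ← mul_assoc, expNat_mul_eN, one_mul]
    · rintro ⟨i, _, _, hi⟩
      exact hu fun j' hj' => (hi j' hj').trans (hi j hj).symm

end Isolate

/-! ### Weights depending on the average power -/

namespace Params

variable (p : Params)

open scoped Classical in
/-- Weight of a station whose average power is strong, i.e. lies in `T`, or weak. -/
def levelWeight (A : Set (Kind × Plane × Plane)) (T : Set ℝ) (s : ℝ) (θ : ℝ≥0∞) (k : Kind)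
    (z : Plane × Plane) (g : ℝ) : ℝ≥0∞ :=
  if p.power k (dist z.2 z.1) ∈ T then (if (k, z.2, z.1) ∈ A then θ else ∞)
  else ENNReal.ofReal s * ENNReal.ofReal (p.power k (dist z.2 z.1) * g)

open scoped Classical in
/-- Exponent due to the weak stations. -/
def farExponent (s : ℝ) (T : Set ℝ) : ℝ≥0∞ :=
  kindSum fun k => ∫⁻ z in Set.Ioi 0, ENNReal.ofReal (2 * Real.pi * z) *
    (p.density k z * if p.power k z ∈ T then 0 else p.loss k s z)

open scoped Classical in
/-- Exponent due to the strong stations. -/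
def nearExponent (A : Set (Kind × Plane × Plane)) (T : Set ℝ) (θ : ℝ≥0∞) (u : Plane) : ℝ≥0∞ :=
  kindSum fun k => ∫⁻ x, p.density k (dist x u) *
    if p.power k (dist x u) ∈ T then (if (k, x, u) ∈ A then 1 - eN θ else 1) else 0

lemma farExponent_zero (T : Set ℝ) : p.farExponent 0 T = 0 := by
  simp [farExponent, kindSum, loss_zero]

variable {A : Set (Kind × Plane × Plane)} {T : Set ℝ}

lemma measurableSet_section (hA : MeasurableSet A) (k : Kind) :
    MeasurableSet {z : Plane × Plane | (k, z.2, z.1) ∈ A} :=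
  (by fun_prop : Measurable fun z : Plane × Plane => (k, z.2, z.1)) hA

lemma measurable_levelWeight (hA : MeasurableSet A) (hT : MeasurableSet T) (s : ℝ) (θ : ℝ≥0∞)
    (k : Kind) : Measurable (Function.uncurry (p.levelWeight A T s θ k)) := by
  have h1 : Measurable fun y : (Plane × Plane) × ℝ => p.power k (dist y.1.2 y.1.1) := by fun_prop
  unfold levelWeight Function.uncurry
  refine Measurable.ite (h1 hT) (Measurable.ite (measurable_fst (measurableSet_section hA k))
    measurable_const measurable_const) (by fun_prop)

open scoped Classical in
-- The weight of a strong station is a constant, `θ` or `∞`, whatever its gain, so its loss is `1 -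
-- eN θ` or 1. The weak part depends on the position only through the distance, so in polar
-- coordinates it is free of `u`, `A` and `θ`.
lemma exponent_levelWeight (hA : MeasurableSet A) (hT : MeasurableSet T) {s : ℝ} (hs : 0 ≤ s)
    (θ : ℝ≥0∞) (u : Plane) :
    p.uavExponent (p.levelWeight A T s θ .los) (p.levelWeight A T s θ .nlos) u
        + p.tbsExponent (p.levelWeight A T s θ .tbs) u
      = p.nearExponent A T θ u + p.farExponent s T := by
  rw [p.exponent_eq fun k => p.measurable_levelWeight hA hT s θ k]
  have key : ∀ k, (∫⁻ x, p.density k (dist x u)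
          * (1 - ∫⁻ g, eN (p.levelWeight A T s θ k (u, x) g) ∂(p.fading k)))
      = (∫⁻ x, p.density k (dist x u) *
          if p.power k (dist x u) ∈ T then (if (k, x, u) ∈ A then 1 - eN θ else 1) else 0)
        + ∫⁻ z in Set.Ioi 0, ENNReal.ofReal (2 * Real.pi * z) *
          (p.density k z * if p.power k z ∈ T then 0 else p.loss k s z) := fun k => by
    have hF : Measurable fun d => p.density k d * if p.power k d ∈ T then 0 else p.loss k s d :=
      (p.measurable_density k).mul (Measurable.ite (p.measurable_power k hT) measurable_const
        (p.measurable_loss k s))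
    rw [← lintegral_dist_plane hF u, ← lintegral_add_right _
      (by exact hF.comp (by fun_prop : Measurable fun x : Plane => dist x u))]
    refine lintegral_congr fun x => ?_
    rw [← mul_add]
    congr 1
    by_cases h : p.power k (dist x u) ∈ T
    · by_cases hxA : (k, x, u) ∈ A <;> simp [levelWeight, h, hxA]
    · simp only [levelWeight, h, if_false, zero_add]
      exact p.one_sub_lintegral_fading k hs dist_nonneg
  simp only [kindSum, nearExponent, farExponent, key]
  ring

end Params

/-! ### The candidates -/

namespace Network

variable {Ω : Type*} (N : Network Ω) (ω : Ω)

/-- The index `inl i` stands for UAV `i`, the index `inr k` for TBS `k`. -/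
def Cand : ℕ ⊕ ℕ → Prop
  | .inl i => N.avail i ω = true
  | .inr _ => True

def kindOf : ℕ ⊕ ℕ → Kind
  | .inl i => if N.los i ω = true then .los else .nlos
  | .inr _ => .tbs

def posOf : ℕ ⊕ ℕ → Plane
  | .inl i => N.uav i ω
  | .inr k => N.tbs k ω

def gainOf : ℕ ⊕ ℕ → ℝ
  | .inl i => if N.los i ω = true then N.gainL i ω else N.gainN i ω
  | .inr k => N.gainT k ω

/-- Average power of a candidate. -/
def powerOf (p : Params) (j : ℕ ⊕ ℕ) : ℝ := p.power (N.kindOf ω j) (dist (N.posOf ω j) (N.user ω))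

/-- What is given about a candidate if it serves. -/
def infoOf (j : ℕ ⊕ ℕ) : Kind × Plane × Plane := (N.kindOf ω j, N.posOf ω j, N.user ω)

open scoped Classical in
lemma tsum_weights (w : Kind → Plane × Plane → ℝ → ℝ≥0∞) :
    ∑' i, N.uavWeight (w .los) (w .nlos) ω i + ∑' k, N.tbsWeight (w .tbs) ω k
      = ∑' j, if N.Cand ω j then w (N.kindOf ω j) (N.user ω, N.posOf ω j) (N.gainOf ω j)
          else 0 := by
  rw [Summable.tsum_sum ENNReal.summable ENNReal.summable]
  congr 1
  · refine tsum_congr fun i => ?_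
    by_cases h : N.los i ω = true <;> simp [uavWeight, Cand, kindOf, posOf, gainOf, h]
  · refine tsum_congr fun k => ?_
    simp [tbsWeight, Cand, kindOf, posOf, gainOf]

/-- Exactly one candidate has its average power in `T`, and the information on it is in `A`. -/
def Isolated (p : Params) (A : Set (Kind × Plane × Plane)) (T : Set ℝ) : Prop :=
  ∃ j, (N.Cand ω j ∧ N.powerOf ω p j ∈ T) ∧ N.infoOf ω j ∈ A ∧
    ∀ j', (N.Cand ω j' ∧ N.powerOf ω p j' ∈ T) → j' = j

open scoped Classical in
/-- Interference due to the candidates with average power outside `T`. -/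
def farInterference (p : Params) (s : ℝ) (T : Set ℝ) : ℝ≥0∞ :=
  ∑' j, if N.Cand ω j ∧ N.powerOf ω p j ∉ T then
    ENNReal.ofReal s * ENNReal.ofReal (N.powerOf ω p j * N.gainOf ω j) else 0

/-- Total weight of the candidates. -/
def levelTotal (p : Params) (A : Set (Kind × Plane × Plane)) (T : Set ℝ)
    (s : ℝ) (θ : ℝ≥0∞) : ℝ≥0∞ :=
  ∑' i, N.uavWeight (p.levelWeight A T s θ .los) (p.levelWeight A T s θ .nlos) ω i
    + ∑' k, N.tbsWeight (p.levelWeight A T s θ .tbs) ω k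

open scoped Classical in
lemma levelTotal_eq (p : Params) (A : Set (Kind × Plane × Plane)) (T : Set ℝ) (s : ℝ) (θ : ℝ≥0∞) :
    N.levelTotal ω p A T s θ = ∑' j, isolateWeight
      (fun j => N.Cand ω j ∧ N.powerOf ω p j ∈ T) (fun j => N.infoOf ω j ∈ A)
      (fun j => if N.Cand ω j ∧ N.powerOf ω p j ∉ T then
        ENNReal.ofReal s * ENNReal.ofReal (N.powerOf ω p j * N.gainOf ω j) else 0) θ j := by
  rw [levelTotal, N.tsum_weights ω (p.levelWeight A T s θ)]
  refine tsum_congr fun j => ?_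
  by_cases hc : N.Cand ω j <;> by_cases h : N.powerOf ω p j ∈ T
  · have h' := h
    rw [powerOf] at h'
    simp only [isolateWeight, hc, h, Params.levelWeight, h', if_true, true_and]
    rfl
  · have h' := h
    rw [powerOf] at h'
    simp only [isolateWeight, hc, h, Params.levelWeight, h', if_true, if_false, and_false,
      not_false_eq_true, and_self]
    rfl
  · simp [isolateWeight, hc]
  · simp [isolateWeight, hc]

end Network

section Model

variable {Ω : Type*} [mΩ : MeasurableSpace Ω] {μ : Measure Ω}
  {p : Params} {N : Network Ω}

namespace IsModel

variable {A : Set (Kind × Plane × Plane)} {T : Set ℝ}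

lemma measurable_uavWeight (hN : IsModel p N μ) {wL wN : Plane × Plane → ℝ → ℝ≥0∞}
    (hL : Measurable (Function.uncurry wL)) (hN' : Measurable (Function.uncurry wN)) (i : ℕ) :
    Measurable fun ω => N.uavWeight wL wN ω i := by
  have hz := hN.measurable_user.prodMk (hN.uav_law.measurable i)
  exact Measurable.ite (hN.measurable_avail i (measurableSet_singleton true))
    (Measurable.ite (hN.measurable_los i (measurableSet_singleton true))
      (hL.comp (hz.prodMk (hN.measurable_gainL i))) (hN'.comp (hz.prodMk (hN.measurable_gainN i))))
    measurable_const

lemma measurable_tbsWeight (hN : IsModel p N μ) {wT : Plane × Plane → ℝ → ℝ≥0∞}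
    (hT : Measurable (Function.uncurry wT)) (k : ℕ) :
    Measurable fun ω => N.tbsWeight wT ω k :=
  hT.comp ((hN.measurable_user.prodMk (hN.tbs_law.measurable k)).prodMk (hN.measurable_gainT k))

lemma measurable_levelTotal (hN : IsModel p N μ) (hA : MeasurableSet A) (hT : MeasurableSet T)
    (s : ℝ) (θ : ℝ≥0∞) : Measurable fun ω => N.levelTotal ω p A T s θ := by
  have h := p.measurable_levelWeight hA hT s θ
  exact (measurable_tsum_ennreal fun i => hN.measurable_uavWeight (h .los) (h .nlos) i).add
    (measurable_tsum_ennreal fun k => hN.measurable_tbsWeight (h .tbs) k)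

variable [IsProbabilityMeasure μ]

lemma lintegral_levelTotal (hN : IsModel p N μ) (hA : MeasurableSet A) (hT : MeasurableSet T)
    {κ : Plane × Bool → ℝ≥0∞} (hκ : Measurable κ) (hκ1 : ∀ z, κ z ≤ 1) {s : ℝ} (hs : 0 ≤ s)
    (θ : ℝ≥0∞) :
    ∫⁻ ω, κ (N.user ω, N.clusterAvail ω) * eN (N.levelTotal ω p A T s θ) ∂μ
      = eN (p.farExponent s T) * ∫⁻ ω, κ (N.user ω, N.clusterAvail ω)
        * eN (p.nearExponent A T θ (N.user ω)) ∂μ := by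
  have h := p.measurable_levelWeight hA hT s θ
  rw [← lintegral_const_mul' _ _ (eN_ne_top _)]
  refine (hN.lintegral_weights hκ hκ1 (h .los) (h .nlos) (h .tbs)).trans
    (lintegral_congr fun ω => ?_)
  rw [p.exponent_levelWeight hA hT hs, eN_add]
  ring

/-- The strong part of the exponent does not involve `s`. Comparing with `s = 0` therefore isolates
the weak factor, and the probability of isolation never has to be computed. -/
lemma lintegral_levelTotal_zero (hN : IsModel p N μ) (hA : MeasurableSet A) (hT : MeasurableSet T)
    {κ : Plane × Bool → ℝ≥0∞} (hκ : Measurable κ) (hκ1 : ∀ z, κ z ≤ 1) {s : ℝ} (hs : 0 ≤ s)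
    (θ : ℝ≥0∞) :
    ∫⁻ ω, κ (N.user ω, N.clusterAvail ω) * eN (N.levelTotal ω p A T s θ) ∂μ
      = eN (p.farExponent s T) * ∫⁻ ω, κ (N.user ω, N.clusterAvail ω)
        * eN (N.levelTotal ω p A T 0 θ) ∂μ := by
  rw [hN.lintegral_levelTotal hA hT hκ hκ1 hs, hN.lintegral_levelTotal hA hT hκ hκ1 le_rfl,
    p.farExponent_zero, eN_zero, one_mul]

open scoped Classical in
/-- Limit of the weights isolating a strong candidate, integrated. -/
lemma tendsto_lintegral_isolate (hN : IsModel p N μ) (hA : MeasurableSet A) (hT : MeasurableSet T)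
    {κ : Plane × Bool → ℝ≥0∞} (hκ : Measurable κ) (hκ1 : ∀ z, κ z ≤ 1) (s : ℝ) :
    Tendsto (fun n : ℕ => ENNReal.ofReal (Real.exp n) *
      (∫⁻ ω, κ (N.user ω, N.clusterAvail ω) * eN (N.levelTotal ω p A T s n) ∂μ
        - ∫⁻ ω, κ (N.user ω, N.clusterAvail ω) * eN (N.levelTotal ω p A T s ∞) ∂μ)) atTop
      (𝓝 (∫⁻ ω, κ (N.user ω, N.clusterAvail ω) *
        (if N.Isolated ω p A T then eN (N.farInterference ω p s T) else 0) ∂μ)) := by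
  have hm := fun θ => hN.measurable_levelTotal hA hT s θ
  have hκm : Measurable fun ω => κ (N.user ω, N.clusterAvail ω) :=
    hκ.comp (hN.measurable_user.prodMk hN.measurable_clusterAvail)
  have hle : ∀ θ ω, κ (N.user ω, N.clusterAvail ω) * eN (N.levelTotal ω p A T s θ) ≤ 1 :=
    fun θ ω => (mul_le_mul' (hκ1 _) (eN_le_one _)).trans (one_mul 1).le
  have h1 : ∀ n : ℕ, ENNReal.ofReal (Real.exp n) *
      (∫⁻ ω, κ (N.user ω, N.clusterAvail ω) * eN (N.levelTotal ω p A T s n) ∂μ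
        - ∫⁻ ω, κ (N.user ω, N.clusterAvail ω) * eN (N.levelTotal ω p A T s ∞) ∂μ)
      = ∫⁻ ω, κ (N.user ω, N.clusterAvail ω) * (ENNReal.ofReal (Real.exp n) *
        (eN (N.levelTotal ω p A T s n) - eN (N.levelTotal ω p A T s ∞))) ∂μ := fun n => by
    rw [← lintegral_sub (f := fun ω => κ (N.user ω, N.clusterAvail ω)
      * eN (N.levelTotal ω p A T s n)) (g := fun ω => κ (N.user ω, N.clusterAvail ω)
      * eN (N.levelTotal ω p A T s ∞)) (hκm.mul (measurable_eN.comp (hm ∞))),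
      ← lintegral_const_mul' _ _ ENNReal.ofReal_ne_top]
    · refine lintegral_congr fun ω => ?_
      rw [← ENNReal.mul_sub]
      · ring
      · exact fun _ _ => ((hκ1 _).trans_lt ENNReal.one_lt_top).ne
    · refine ((lintegral_mono (hle ∞)).trans_lt ?_).ne
      simp
    · refine ae_of_all _ fun ω => ?_
      dsimp only
      gcongr
      apply eN_antitone
      simp only [N.levelTotal_eq]
      refine ENNReal.tsum_le_tsum fun j => ?_
      unfold isolateWeight
      split_ifs <;> simp
  simp_rw [h1]
  refine tendsto_lintegral_of_dominated_convergence (fun _ => 1)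
    (fun n => hκm.mul (((measurable_eN.comp (hm n)).sub (measurable_eN.comp (hm ∞))).const_mul _))
    (fun n => ae_of_all _ fun ω => ?_) (by simp) (ae_of_all _ fun ω => ?_)
  · simp only [N.levelTotal_eq]
    exact (mul_le_mul' (hκ1 _) (isolate_le _ _ _ n)).trans (one_mul 1).le
  · refine ENNReal.Tendsto.const_mul ?_ (Or.inr ((hκ1 _).trans_lt ENNReal.one_lt_top).ne)
    have hfar : N.farInterference ω p s T = ∑' j, if N.Cand ω j ∧ N.powerOf ω p j ∈ T then 0 else
        if N.Cand ω j ∧ N.powerOf ω p j ∉ T then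
          ENNReal.ofReal s * ENNReal.ofReal (N.powerOf ω p j * N.gainOf ω j) else 0 := by
      refine tsum_congr fun j => ?_
      by_cases h : N.Cand ω j ∧ N.powerOf ω p j ∈ T <;> simp [h]
    simp only [N.levelTotal_eq]
    rw [hfar]
    convert tendsto_isolate (fun j => N.Cand ω j ∧ N.powerOf ω p j ∈ T)
      (fun j => N.infoOf ω j ∈ A) _
    exact Iff.rfl

open scoped Classical in
/-- Given an isolated strong candidate, the far interference has the Laplace transform
`exp (-farExponent)`. -/
theorem lintegral_isolated (hN : IsModel p N μ) (hA : MeasurableSet A) (hT : MeasurableSet T)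
    {κ : Plane × Bool → ℝ≥0∞} (hκ : Measurable κ) (hκ1 : ∀ z, κ z ≤ 1) {s : ℝ} (hs : 0 ≤ s) :
    ∫⁻ ω, κ (N.user ω, N.clusterAvail ω) *
        (if N.Isolated ω p A T then eN (N.farInterference ω p s T) else 0) ∂μ
      = eN (p.farExponent s T) * ∫⁻ ω, κ (N.user ω, N.clusterAvail ω) *
        (if N.Isolated ω p A T then 1 else 0) ∂μ := by
  -- At `s = 0` the weak interference vanishes, so the same limit yields the isolation event itself.
  have h0 := ENNReal.Tendsto.const_mul (a := eN (p.farExponent s T))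
    (hN.tendsto_lintegral_isolate hA hT hκ hκ1 0) (Or.inr (eN_ne_top _))
  have hfar : ∀ ω, N.farInterference ω p 0 T = 0 := fun ω => by simp [Network.farInterference]
  simp only [hfar, eN_zero] at h0
  refine tendsto_nhds_unique (hN.tendsto_lintegral_isolate hA hT hκ hκ1 s) (h0.congr fun n => ?_)
  rw [hN.lintegral_levelTotal_zero hA hT hκ hκ1 hs n,
    hN.lintegral_levelTotal_zero hA hT hκ hκ1 hs ∞, ← ENNReal.mul_sub fun _ _ => eN_ne_top _]
  ring

end IsModel

end Model

/-! ### Finiteness, atomlessness and infinite total mass of the power intensity. -/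

/-! ### The intensity of average powers -/

namespace Params

variable (p : Params)

/-- Intensity of the horizontal distances of the candidates of a kind. -/
def radial (k : Kind) : Measure ℝ :=
  (volume.restrict (Set.Ioi 0)).withDensity fun z =>
    ENNReal.ofReal (2 * Real.pi * z) * p.density k z

/-- Intensity of the average powers of the candidates. -/
def powerMeasure : Measure ℝ :=
  (p.radial .los).map (p.power .los) + (p.radial .nlos).map (p.power .nlos)
    + (p.radial .tbs).map (p.power .tbs)

lemma lintegral_radial (k : Kind) {F : ℝ → ℝ≥0∞} (hF : Measurable F) :
    ∫⁻ z, F z ∂(p.radial k)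
      = ∫⁻ z in Set.Ioi 0, ENNReal.ofReal (2 * Real.pi * z) * (p.density k z * F z) := by
  rw [radial, lintegral_withDensity_eq_lintegral_mul _ (by fun_prop) hF]
  exact lintegral_congr fun z => mul_assoc _ _ _

lemma lintegral_powerMeasure {F : ℝ → ℝ≥0∞} (hF : Measurable F) :
    ∫⁻ v, F v ∂p.powerMeasure = kindSum fun k => ∫⁻ z, F (p.power k z) ∂(p.radial k) := by
  rw [powerMeasure, lintegral_add_measure, lintegral_add_measure,
    lintegral_map hF (p.measurable_power _), lintegral_map hF (p.measurable_power _),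
    lintegral_map hF (p.measurable_power _)]
  rfl

lemma powerMeasure_apply {B : Set ℝ} (hB : MeasurableSet B) :
    p.powerMeasure B = kindSum fun k => p.radial k (p.power k ⁻¹' B) := by
  simp only [powerMeasure, Measure.add_apply, Measure.map_apply (p.measurable_power _) hB, kindSum]

lemma density_le (k : Kind) : ∃ C : ℝ≥0∞, C ≠ ∞ ∧ ∀ z, p.density k z ≤ C := by
  have hlam : 0 ≤ p.lamAvail := mul_nonneg p.Pa_nonneg p.lamU_pos.le
  cases k
  · exact ⟨0, ENNReal.zero_ne_top, fun z => le_rfl⟩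
  · exact ⟨_, ENNReal.ofReal_ne_top, fun z => ENNReal.ofReal_le_ofReal
      (mul_le_of_le_one_right hlam (p.Pl_le_one _))⟩
  · exact ⟨_, ENNReal.ofReal_ne_top, fun z => ENNReal.ofReal_le_ofReal
      (mul_le_of_le_one_right hlam (sub_le_self _ (p.Pl_nonneg _)))⟩
  · exact ⟨_, ENNReal.ofReal_ne_top, fun z => le_rfl⟩

lemma tendsto_power (k : Kind) : Tendsto (p.power k) atTop (𝓝 0) := by
  have h1 : Tendsto (fun d : ℝ => √(d ^ 2 + p.h ^ 2)) atTop atTop :=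
    Real.tendsto_sqrt_atTop.comp (tendsto_atTop_add_const_right _ _ (tendsto_pow_atTop two_ne_zero))
  cases k
  · exact tendsto_const_nhds
  · have h := ((tendsto_rpow_neg_atTop p.alphaL_pos).comp h1).const_mul (p.etaL * p.rhoU)
    rwa [mul_zero] at h
  · have h := ((tendsto_rpow_neg_atTop p.alphaN_pos).comp h1).const_mul (p.etaN * p.rhoU)
    rwa [mul_zero] at h
  · have h := (tendsto_rpow_neg_atTop p.alphaT_pos).const_mul p.rhoT
    rwa [mul_zero] at h

lemma radial_Iic_lt_top (k : Kind) (R : ℝ) : p.radial k (Set.Iic R) < ∞ := by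
  obtain ⟨C, hC, hCz⟩ := p.density_le k
  rw [radial, withDensity_apply _ measurableSet_Iic, Measure.restrict_restrict measurableSet_Iic]
  calc _ ≤ ∫⁻ _ in Set.Iic R ∩ Set.Ioi 0, ENNReal.ofReal (2 * Real.pi * R) * C := by
        refine setLIntegral_mono measurable_const fun z hz => ?_
        have hz1 : z ≤ R := hz.1
        gcongr
        exact hCz z
    _ = ENNReal.ofReal (2 * Real.pi * R) * C * volume (Set.Ioc 0 R) := by
        rw [lintegral_const, Measure.restrict_apply MeasurableSet.univ, Set.univ_inter,
          Set.inter_comm, Set.Ioi_inter_Iic]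
    _ < ∞ := by
        rw [Real.volume_Ioc]
        exact ENNReal.mul_lt_top (ENNReal.mul_lt_top ENNReal.ofReal_lt_top hC.lt_top)
          ENNReal.ofReal_lt_top

/-- Powers tend to 0 with distance, so stations above a positive level lie in a bounded region,
where the mean number is finite. -/
lemma powerMeasure_Ici_lt_top {t : ℝ} (ht : 0 < t) : p.powerMeasure (Set.Ici t) < ∞ := by
  have h : ∀ k, p.radial k (p.power k ⁻¹' Set.Ici t) < ∞ := fun k => by
    obtain ⟨R, hR⟩ := eventually_atTop.1 ((p.tendsto_power k).eventually (gt_mem_nhds ht))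
    refine (measure_mono fun z hz => ?_).trans_lt (p.radial_Iic_lt_top k R)
    by_contra hzR
    exact absurd (hR z (not_le.1 hzR).le) (not_lt.2 hz)
  rw [p.powerMeasure_apply measurableSet_Ici]
  exact ENNReal.add_lt_top.2 ⟨ENNReal.add_lt_top.2 ⟨h _, h _⟩, h _⟩

lemma strictAntiOn_power {k : Kind} (hk : k ≠ .cluster) :
    StrictAntiOn (p.power k) (Set.Ioi 0) := by
  have hs : ∀ a c : ℝ, 0 < a → 0 < c →
      StrictAntiOn (fun d : ℝ => c * √(d ^ 2 + p.h ^ 2) ^ (-a)) (Set.Ioi 0) := by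
    intro a c ha hc x hx y hy hxy
    have hx : 0 < x := hx
    have h1 : 0 < √(x ^ 2 + p.h ^ 2) := by positivity
    have h2 : √(x ^ 2 + p.h ^ 2) < √(y ^ 2 + p.h ^ 2) := by
      refine Real.sqrt_lt_sqrt (by positivity) ?_
      gcongr
    exact mul_lt_mul_of_pos_left (Real.rpow_lt_rpow_of_neg h1 h2 (neg_neg_of_pos ha)) hc
  cases k
  · exact absurd rfl hk
  · exact hs _ _ p.alphaL_pos (mul_pos p.etaL_pos p.rhoU_pos)
  · exact hs _ _ p.alphaN_pos (mul_pos p.etaN_pos p.rhoU_pos)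
  · intro x hx y hy hxy
    exact mul_lt_mul_of_pos_left
      (Real.rpow_lt_rpow_of_neg hx hxy (neg_neg_of_pos p.alphaT_pos)) p.rhoT_pos

/-- Each power is strictly decreasing in the distance, so a given value is attained at one radius at
most. -/
lemma powerMeasure_singleton (t : ℝ) : p.powerMeasure {t} = 0 := by
  have h : ∀ k, k ≠ .cluster → p.radial k (p.power k ⁻¹' {t}) = 0 := fun k hk => by
    have hm : MeasurableSet (p.power k ⁻¹' {t}) := p.measurable_power k (measurableSet_singleton t)
    rw [radial, withDensity_apply _ hm]
    refine setLIntegral_measure_zero _ _ ?_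
    rw [Measure.restrict_apply hm]
    refine Set.Subsingleton.measure_zero (fun x hx y hy => ?_) _
    exact (p.strictAntiOn_power hk).injOn hx.2 hy.2 (hx.1.trans hy.1.symm)
  rw [p.powerMeasure_apply (measurableSet_singleton t)]
  simp [kindSum, h]

/-- The TBSs alone suffice: they have constant positive density over the whole plane, and this holds
even if no UAV is ever available. -/
lemma powerMeasure_Ioi_zero : p.powerMeasure (Set.Ioi 0) = ∞ := by
  have h : p.radial .tbs (p.power .tbs ⁻¹' Set.Ioi 0) = ∞ := by
    have hm : MeasurableSet (p.power .tbs ⁻¹' Set.Ioi 0) := p.measurable_power _ measurableSet_Ioi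
    rw [radial, withDensity_apply _ hm, Measure.restrict_restrict hm, ← top_le_iff]
    calc ∞ = ∫⁻ _ in Set.Ioi (1 : ℝ), ENNReal.ofReal (2 * Real.pi * 1) * ENNReal.ofReal p.lamT := by
          rw [lintegral_const, Measure.restrict_apply MeasurableSet.univ, Set.univ_inter,
            Real.volume_Ioi, ENNReal.mul_top]
          have := p.lamT_pos
          have := Real.pi_pos
          simp only [ne_eq, mul_eq_zero, ENNReal.ofReal_eq_zero, not_or, not_le]
          constructor <;> positivity
      _ ≤ ∫⁻ z in Set.Ioi (1 : ℝ), ENNReal.ofReal (2 * Real.pi * z) * p.density .tbs z := by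
          refine setLIntegral_mono (by fun_prop) fun z hz => ?_
          have hz1 : 1 ≤ z := le_of_lt hz
          simp only [density]
          gcongr
      _ ≤ _ := by
          refine lintegral_mono_set fun z hz => ?_
          have hz0 : 0 < z := zero_lt_one.trans hz
          exact ⟨mul_pos p.rhoT_pos (Real.rpow_pos_of_pos hz0 _), hz0⟩
  rw [p.powerMeasure_apply measurableSet_Ioi, kindSum, h, add_top]

/-- Every positive value is attained by the intensity of the powers above a level. -/
lemma exists_level {c : ℝ} (hc : 0 < c) :
    ∃ t : ℝ, 0 < t ∧ p.powerMeasure (Set.Ici t) = ENNReal.ofReal c := by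
  set m := p.powerMeasure
  -- The level sought is the largest one above which the intensity is still at least `c`.
  set S := {t : ℝ | 0 < t ∧ ENNReal.ofReal c ≤ m (Set.Ici t)} with hS
  have hne : S.Nonempty := by
    have h1 : Tendsto (fun n : ℕ => m (Set.Ici (1 / ((n : ℝ) + 1)))) atTop (𝓝 ∞) := by
      have : Set.Ioi (0 : ℝ) = ⋃ n : ℕ, Set.Ici (1 / ((n : ℝ) + 1)) := by
        ext x
        simp only [Set.mem_Ioi, Set.mem_iUnion, Set.mem_Ici]
        exact ⟨fun hx => (exists_nat_one_div_lt hx).imp fun _ h => h.le,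
          fun ⟨n, hn⟩ => (by positivity : (0 : ℝ) < 1 / ((n : ℝ) + 1)).trans_le hn⟩
      rw [← p.powerMeasure_Ioi_zero, this]
      refine tendsto_measure_iUnion_atTop fun a b hab => Set.Ici_subset_Ici.2 ?_
      exact Nat.one_div_le_one_div hab
    obtain ⟨n, hn⟩ := (h1.eventually (lt_mem_nhds ENNReal.ofReal_lt_top)).exists
    exact ⟨_, by positivity, hn.le⟩
  have hbdd : BddAbove S := by
    have h1 : Tendsto (fun n : ℕ => m (Set.Ici ((n : ℝ) + 1))) atTop (𝓝 0) := by
      have : (⋂ n : ℕ, Set.Ici ((n : ℝ) + 1)) = ∅ := by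
        refine Set.eq_empty_of_forall_notMem fun x hx => ?_
        obtain ⟨n, hn⟩ := exists_nat_gt x
        have := Set.mem_iInter.1 hx n
        simp only [Set.mem_Ici] at this
        linarith
      rw [← measure_empty (μ := m), ← this]
      refine tendsto_measure_iInter_atTop (fun n => measurableSet_Ici.nullMeasurableSet)
        (fun a b hab => Set.Ici_subset_Ici.2 (by gcongr))
        ⟨0, (p.powerMeasure_Ici_lt_top (by positivity)).ne⟩
    obtain ⟨n, hn⟩ := (h1.eventually (gt_mem_nhds (ENNReal.ofReal_pos.2 hc))).exists
    refine ⟨n + 1, fun t ht => ?_⟩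
    by_contra h
    exact absurd ((measure_mono (Set.Ici_subset_Ici.2 (not_le.1 h).le)).trans_lt hn)
      (not_lt.2 ht.2)
  obtain ⟨t0, ht0⟩ := hne
  have ht0' : t0 ≤ sSup S := le_csSup hbdd ht0
  have hpos : 0 < sSup S := ht0.1.trans_le ht0'
  refine ⟨sSup S, hpos, le_antisymm ?_ ?_⟩
  -- Without an atom at the supremum, the closed half line may be replaced by an increasing union of
  -- half lines starting beyond it, each of intensity below `c`.
  · have h1 : m (Set.Ici (sSup S)) = m (Set.Ioi (sSup S)) := by
      refine le_antisymm ?_ (measure_mono Set.Ioi_subset_Ici_self)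
      rw [← Set.Ioi_insert]
      refine (measure_union_le {sSup S} _).trans ?_
      rw [p.powerMeasure_singleton, zero_add]
    have h2 : Set.Ioi (sSup S) = ⋃ n : ℕ, Set.Ici (sSup S + 1 / ((n : ℝ) + 1)) := by
      ext x
      simp only [Set.mem_Ioi, Set.mem_iUnion, Set.mem_Ici]
      constructor
      · intro hx
        obtain ⟨n, hn⟩ := exists_nat_one_div_lt (sub_pos.2 hx)
        exact ⟨n, by linarith⟩
      · rintro ⟨n, hn⟩
        have : (0 : ℝ) < 1 / ((n : ℝ) + 1) := by positivity
        linarith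
    rw [h1, h2]
    have h3 := tendsto_measure_iUnion_atTop (μ := m)
      (s := fun n : ℕ => Set.Ici (sSup S + 1 / ((n : ℝ) + 1))) fun a b hab =>
        Set.Ici_subset_Ici.2 (add_le_add_right (Nat.one_div_le_one_div hab) _)
    refine le_of_tendsto' h3 fun n => ?_
    by_contra h
    have hp : (0 : ℝ) < 1 / ((n : ℝ) + 1) := by positivity
    have := le_csSup hbdd (show sSup S + 1 / ((n : ℝ) + 1) ∈ S from
      ⟨by positivity, (not_le.1 h).le⟩)
    linarith
  -- Conversely, levels of `S` increasing to the supremum give continuity from above, finite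
  -- intensities being available.
  · obtain ⟨u, hu_mono, hu_lim, huS⟩ := exists_seq_tendsto_sSup ⟨t0, ht0⟩ hbdd
    have h2 : Set.Ici (sSup S) = ⋂ n : ℕ, Set.Ici (u n) := by
      ext x
      simp only [Set.mem_iInter, Set.mem_Ici]
      exact ⟨fun hx n => (le_csSup hbdd (huS n)).trans hx, fun hx => le_of_tendsto' hu_lim hx⟩
    rw [h2]
    refine ge_of_tendsto' (tendsto_measure_iInter_atTop (μ := m)
      (fun n => measurableSet_Ici.nullMeasurableSet)
      (fun a b hab => Set.Ici_subset_Ici.2 (hu_mono hab))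
      ⟨0, (p.powerMeasure_Ici_lt_top (huS 0).1).ne⟩) fun n => (huS n).2

end Params

/-! ### Almost surely there is a strongest candidate -/

instance : Countable Kind :=
  Function.Injective.countable (f := fun k : Kind =>
    match k with
    | .cluster => 0
    | .los => 1
    | .nlos => 2
    | .tbs => 3) (by rintro (_ | _ | _ | _) (_ | _ | _ | _) <;> simp)

instance : DiscreteMeasurableSpace Kind := ⟨fun _ => trivial⟩

namespace Params

variable (p : Params)

/-- Average power as a function of the kind and the positions of station and user. -/
def infoPower (x : Kind × Plane × Plane) : ℝ := p.power x.1 (dist x.2.1 x.2.2)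

lemma measurable_infoPower : Measurable p.infoPower :=
  measurable_from_prod_countable_right fun k =>
    (p.measurable_power k).comp (by fun_prop : Measurable fun z : Plane × Plane => dist z.1 z.2)

/-- A condition on the power alone can be transported to the power axis, where the position of the
user disappears. -/
lemma nearExponent_infoPower {V T : Set ℝ} (hV : MeasurableSet V) (hT : MeasurableSet T)
    (hVT : V ⊆ T) (θ : ℝ≥0∞) (u : Plane) :
    p.nearExponent (p.infoPower ⁻¹' V) T θ u
      = p.powerMeasure (T \ V) + (1 - eN θ) * p.powerMeasure V := by
  classical
  let F : ℝ → ℝ≥0∞ := fun v => (T \ V).indicator 1 v + V.indicator (fun _ => 1 - eN θ) v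
  have hF : Measurable F := (measurable_one.indicator (hT.diff hV)).add
    (measurable_const.indicator hV)
  have h : p.nearExponent (p.infoPower ⁻¹' V) T θ u = ∫⁻ v, F v ∂p.powerMeasure := by
    rw [p.lintegral_powerMeasure hF, nearExponent]
    congr 1
    ext k
    have hG : Measurable fun d => p.density k d * F (p.power k d) :=
      (p.measurable_density k).mul (hF.comp (p.measurable_power k))
    rw [p.lintegral_radial k (F := fun d => F (p.power k d)) (hF.comp (p.measurable_power k)),
      ← lintegral_dist_plane hG u]
    refine lintegral_congr fun x => ?_
    congr 1
    by_cases h1 : p.power k (dist x u) ∈ V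
    · simp [F, infoPower, h1, hVT h1]
    · by_cases h2 : p.power k (dist x u) ∈ T <;> simp [F, infoPower, h1, h2]
  rw [h, lintegral_add_left (measurable_one.indicator (hT.diff hV)),
    lintegral_indicator_one (hT.diff hV), lintegral_indicator_const hV]

end Params

/-- The difference on the right is `exp (-(b + a)) * (exp (ε a) - 1)` with `ε = exp (-n)`, and `exp
x ≥ 1 + x` bounds it below; the factor `ε` cancels `exp n`. The left side is the probability that
independent Poisson variables of means `a` and `b` equal 1 and 0. -/
lemma mul_exp_le_expNat_mul_sub {a b : ℝ} (n : ℕ) :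
    a * Real.exp (-(b + a))
      ≤ Real.exp n * (Real.exp (-(b + (1 - Real.exp (-n)) * a)) - Real.exp (-(b + a))) := by
  have h1 : Real.exp (-(b + (1 - Real.exp (-n)) * a))
      = Real.exp (-(b + a)) * Real.exp (Real.exp (-n) * a) := by
    rw [← Real.exp_add]; congr 1; ring
  have h2 : 1 + Real.exp (-n) * a ≤ Real.exp (Real.exp (-n) * a) := by
    have := Real.add_one_le_exp (Real.exp (-n) * a)
    linarith
  have h3 : Real.exp (n : ℝ) * Real.exp (-n) = 1 := by rw [← Real.exp_add]; simp
  have h4 := Real.exp_pos (-(b + a))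
  have h5 := Real.exp_pos (n : ℝ)
  rw [h1]
  calc a * Real.exp (-(b + a))
      = Real.exp n * (Real.exp (-(b + a)) * (1 + Real.exp (-n) * a) - Real.exp (-(b + a))) := by
        linear_combination (-a * Real.exp (-(b + a))) * h3
    _ ≤ _ := by gcongr

lemma mul_eN_le_expNat_mul_sub {a b : ℝ≥0∞} (ha : a ≠ ∞) (hb : b ≠ ∞) (n : ℕ) :
    a * eN (b + a) ≤ ENNReal.ofReal (Real.exp n) *
      (eN (b + (1 - eN n) * a) - eN (b + (1 - eN ∞) * a)) := by
  obtain ⟨x, hx, rfl⟩ : ∃ x : ℝ, 0 ≤ x ∧ a = ENNReal.ofReal x :=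
    ⟨a.toReal, ENNReal.toReal_nonneg, (ENNReal.ofReal_toReal ha).symm⟩
  obtain ⟨y, hy, rfl⟩ : ∃ y : ℝ, 0 ≤ y ∧ b = ENNReal.ofReal y :=
    ⟨b.toReal, ENNReal.toReal_nonneg, (ENNReal.ofReal_toReal hb).symm⟩
  have hn : eN n = ENNReal.ofReal (Real.exp (-n)) := by
    rw [← eN_ofReal (Nat.cast_nonneg n), ENNReal.ofReal_natCast]
  have he : 0 ≤ 1 - Real.exp (-(n : ℝ)) := by
    rw [sub_nonneg, Real.exp_le_one_iff]
    simp
  have h1 : (1 : ℝ≥0∞) - ENNReal.ofReal (Real.exp (-n)) = ENNReal.ofReal (1 - Real.exp (-n)) := by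
    rw [ENNReal.ofReal_sub _ (Real.exp_pos _).le, ENNReal.ofReal_one]
  rw [eN_top, tsub_zero, one_mul, hn, h1, ← ENNReal.ofReal_mul he, ← ENNReal.ofReal_add hy hx,
    ← ENNReal.ofReal_add hy (by positivity), eN_ofReal (by positivity), eN_ofReal (by positivity),
    ← ENNReal.ofReal_sub _ (Real.exp_pos _).le, ← ENNReal.ofReal_mul hx,
    ← ENNReal.ofReal_mul (Real.exp_pos _).le]
  exact ENNReal.ofReal_le_ofReal (mul_exp_le_expNat_mul_sub n)

/-! ### Probability that the strongest candidate is isolated. -/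

section Model

variable {Ω : Type*} [mΩ : MeasurableSpace Ω] {μ : Measure Ω} {p : Params} {N : Network Ω}

namespace IsModel

lemma measurableSet_cand (hN : IsModel p N μ) (j : ℕ ⊕ ℕ) : MeasurableSet {ω | N.Cand ω j} := by
  rcases j with i | k
  · exact hN.measurable_avail i (measurableSet_singleton true)
  · exact MeasurableSet.univ

lemma measurable_infoOf (hN : IsModel p N μ) (j : ℕ ⊕ ℕ) : Measurable fun ω => N.infoOf ω j := by
  rcases j with i | k
  · have hk : Measurable fun ω => N.kindOf ω (.inl i) :=
      Measurable.ite (hN.measurable_los i (measurableSet_singleton true)) measurable_const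
        measurable_const
    exact hk.prodMk ((hN.uav_law.measurable i).prodMk hN.measurable_user)
  · exact measurable_const.prodMk ((hN.tbs_law.measurable k).prodMk hN.measurable_user)

lemma measurable_powerOf (hN : IsModel p N μ) (j : ℕ ⊕ ℕ) : Measurable fun ω => N.powerOf ω p j :=
  p.measurable_infoPower.comp (hN.measurable_infoOf j)

lemma measurableSet_isolated (hN : IsModel p N μ) {A : Set (Kind × Plane × Plane)} {T : Set ℝ}
    (hA : MeasurableSet A) (hT : MeasurableSet T) : MeasurableSet {ω | N.Isolated ω p A T} := by
  have h1 : ∀ j, MeasurableSet {ω | N.Cand ω j ∧ N.powerOf ω p j ∈ T} := fun j =>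
    (hN.measurableSet_cand j).inter (hN.measurable_powerOf j hT)
  have h2 : {ω | N.Isolated ω p A T} = ⋃ j, ({ω | N.Cand ω j ∧ N.powerOf ω p j ∈ T} ∩
      ({ω | N.infoOf ω j ∈ A} ∩ ⋂ j', ({ω | N.Cand ω j' ∧ N.powerOf ω p j' ∈ T}ᶜ
        ∪ {_ω : Ω | j' = j}))) := by
    ext ω
    simp only [Network.Isolated, Set.mem_ofPred_eq, Set.mem_iUnion, Set.mem_inter_iff,
      Set.mem_iInter, Set.mem_union, Set.mem_compl_iff, imp_iff_not_or]
  rw [h2]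
  exact MeasurableSet.iUnion fun j => (h1 j).inter ((hN.measurable_infoOf j hA).inter
    (MeasurableSet.iInter fun j' => (h1 j').compl.union (MeasurableSet.const _)))

variable [IsProbabilityMeasure μ]

/-- Lower bound for the probability that exactly one candidate is strong. -/
lemma le_measure_isolated (hN : IsModel p N μ) {V : Set ℝ} {t : ℝ} (ht : 0 < t)
    (hV : MeasurableSet V) (hVT : V ⊆ Set.Ici t) :
    p.powerMeasure V * eN (p.powerMeasure (Set.Ici t)) * μ {ω | N.clusterAvail ω = false}
      ≤ μ ({ω | N.clusterAvail ω = false} ∩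
        {ω | N.Isolated ω p (p.infoPower ⁻¹' V) (Set.Ici t)}) := by
  classical
  have hA := p.measurable_infoPower hV
  let κ : Plane × Bool → ℝ≥0∞ := fun z => if z.2 = false then 1 else 0
  have hκ : Measurable κ := Measurable.ite (measurable_snd (measurableSet_singleton false))
    measurable_const measurable_const
  have hκ1 : ∀ z, κ z ≤ 1 := fun z => by simp only [κ]; split_ifs <;> simp
  have hC : MeasurableSet {ω | N.clusterAvail ω = false} :=
    hN.measurable_clusterAvail (measurableSet_singleton false)
  have hlim := hN.tendsto_lintegral_isolate hA measurableSet_Ici hκ hκ1 0 (T := Set.Ici t)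
  have hint : ∫⁻ ω, κ (N.user ω, N.clusterAvail ω) *
        (if N.Isolated ω p (p.infoPower ⁻¹' V) (Set.Ici t)
          then eN (N.farInterference ω p 0 (Set.Ici t)) else 0) ∂μ
      = μ ({ω | N.clusterAvail ω = false} ∩
        {ω | N.Isolated ω p (p.infoPower ⁻¹' V) (Set.Ici t)}) := by
    rw [← lintegral_indicator_one (hC.inter (hN.measurableSet_isolated hA measurableSet_Ici))]
    refine lintegral_congr fun ω => ?_
    have h0 : N.farInterference ω p 0 (Set.Ici t) = 0 := by simp [Network.farInterference]
    by_cases h1 : N.clusterAvail ω = false <;>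
      by_cases h2 : N.Isolated ω p (p.infoPower ⁻¹' V) (Set.Ici t) <;>
      simp [κ, h0, h1, h2, Set.indicator]
  have hκint : ∫⁻ ω, κ (N.user ω, N.clusterAvail ω) ∂μ = μ {ω | N.clusterAvail ω = false} := by
    rw [← lintegral_indicator_one hC]
    exact lintegral_congr fun ω => by by_cases h : N.clusterAvail ω = false <;> simp [κ, h]
  have htop : p.powerMeasure (Set.Ici t) ≠ ∞ := (p.powerMeasure_Ici_lt_top ht).ne
  have hval : ∀ θ, ∫⁻ ω, κ (N.user ω, N.clusterAvail ω)
        * eN (N.levelTotal ω p (p.infoPower ⁻¹' V) (Set.Ici t) 0 θ) ∂μ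
      = eN (p.powerMeasure (Set.Ici t \ V) + (1 - eN θ) * p.powerMeasure V)
        * μ {ω | N.clusterAvail ω = false} := fun θ => by
    rw [hN.lintegral_levelTotal hA measurableSet_Ici hκ hκ1 le_rfl, p.farExponent_zero, eN_zero,
      one_mul]
    simp_rw [p.nearExponent_infoPower hV measurableSet_Ici hVT]
    rw [lintegral_mul_const' _ _ (eN_ne_top _), hκint, mul_comm]
  rw [hint] at hlim
  refine ge_of_tendsto' hlim fun n => ?_
  rw [hval, hval, ← ENNReal.sub_mul fun _ _ => measure_ne_top _ _, ← mul_assoc]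
  gcongr ?_ * _
  have hsum : p.powerMeasure (Set.Ici t \ V) + p.powerMeasure V = p.powerMeasure (Set.Ici t) := by
    have h := measure_sdiff_add_inter (μ := p.powerMeasure) (Set.Ici t) hV
    rwa [Set.inter_eq_right.2 hVT] at h
  rw [← hsum]
  refine mul_eN_le_expNat_mul_sub ?_ ?_ n
  · exact ((measure_mono hVT).trans_lt htop.lt_top).ne
  · exact ((measure_mono Set.sdiff_subset).trans_lt htop.lt_top).ne

/-- A Riemann sum of `exp (-x)` up to boundary terms: the geometric series equals `δ exp (-2δ) / (1
- exp (-δ))`, and `1 - exp (-δ) ≤ δ`. -/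
lemma tsum_ofReal_exp_ge {δ : ℝ} (hδ : 0 < δ) :
    ENNReal.ofReal (Real.exp (-(2 * δ)))
      ≤ ∑' j : ℕ, ENNReal.ofReal δ * ENNReal.ofReal (Real.exp (-(((j : ℝ) + 2) * δ))) := by
  have hr1 : Real.exp (-δ) < 1 := by simpa using hδ
  have h1 : ∀ j : ℕ, ENNReal.ofReal δ * ENNReal.ofReal (Real.exp (-(((j : ℝ) + 2) * δ)))
      = ENNReal.ofReal (δ * Real.exp (-(2 * δ)) * Real.exp (-δ) ^ j) := fun j => by
    rw [← ENNReal.ofReal_mul hδ.le, mul_assoc, ← Real.exp_nat_mul, ← Real.exp_add]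
    congr 3
    ring
  have h2 := (hasSum_geometric_of_lt_one (Real.exp_pos (-δ)).le hr1).mul_left
    (δ * Real.exp (-(2 * δ)))
  simp_rw [h1]
  rw [← ENNReal.ofReal_tsum_of_nonneg (fun j => by positivity) h2.summable, h2.tsum_eq]
  refine ENNReal.ofReal_le_ofReal ?_
  have h3 : 0 < 1 - Real.exp (-δ) := sub_pos.2 hr1
  have h4 : 1 - Real.exp (-δ) ≤ δ := by
    have := Real.add_one_le_exp (-δ)
    linarith
  rw [← div_eq_mul_inv, le_div_iff₀ h3, mul_comm δ]
  gcongr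

/-- The event that there is a strongest candidate, well above the others, has full probability. -/
theorem ae_strongest (hN : IsModel p N μ) :
    ∀ᵐ ω ∂μ, N.clusterAvail ω = false → ∃ t, 0 < t ∧ ∃ j, N.Cand ω j ∧ t < N.powerOf ω p j ∧
      ∀ j', N.Cand ω j' → t ≤ N.powerOf ω p j' → j' = j := by
  set C := {ω | N.clusterAvail ω = false} with hC
  set B := {ω | ¬ (N.clusterAvail ω = false → ∃ t, 0 < t ∧ ∃ j, N.Cand ω j ∧
    t < N.powerOf ω p j ∧ ∀ j', N.Cand ω j' → t ≤ N.powerOf ω p j' → j' = j)} with hB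
  have hCm : MeasurableSet C := hN.measurable_clusterAvail (measurableSet_singleton false)
  change μ B = 0
  have key : ∀ δ : ℝ, 0 < δ → μ B + ENNReal.ofReal (Real.exp (-(2 * δ))) * μ C ≤ μ C := by
    intro δ hδ
    -- Level `t j` leaves intensity `(j + 1) δ` above it, so the cell between `t (j + 1)` and `t j`
    -- carries intensity at least `δ` and everything from `t (j + 1)` on carries `(j + 2) δ`.
    have hlev : ∀ j : ℕ, ∃ t : ℝ, 0 < t ∧
        p.powerMeasure (Set.Ici t) = ENNReal.ofReal (((j : ℝ) + 1) * δ) := fun j =>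
      p.exists_level (by positivity)
    choose t ht0 ht using hlev
    have hanti : ∀ i j : ℕ, i ≤ j → t j ≤ t i := fun i j hij => by
      rcases hij.eq_or_lt with rfl | hij
      · exact le_rfl
      by_contra h
      have h1 := measure_mono (μ := p.powerMeasure) (Set.Ici_subset_Ici.2 (not_le.1 h).le)
      rw [ht, ht, ENNReal.ofReal_le_ofReal_iff (by positivity)] at h1
      have h2 : (i : ℝ) + 1 ≤ j := by exact_mod_cast hij
      nlinarith
    let V : ℕ → Set ℝ := fun j => Set.Ioo (t (j + 1)) (t j)
    have hVT : ∀ j, V j ⊆ Set.Ici (t (j + 1)) := fun j v hv => hv.1.le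
    have hVm : ∀ j, ENNReal.ofReal δ ≤ p.powerMeasure (V j) := fun j => by
      have h1 : Set.Ici (t (j + 1)) ⊆ (V j ∪ {t (j + 1)}) ∪ Set.Ici (t j) := fun v hv => by
        rcases lt_or_ge v (t j) with h | h
        · rcases (show t (j + 1) ≤ v from hv).eq_or_lt with h' | h'
          · exact Or.inl (Or.inr h'.symm)
          · exact Or.inl (Or.inl ⟨h', h⟩)
        · exact Or.inr h
      have h2 : ENNReal.ofReal δ + ENNReal.ofReal (((j : ℝ) + 1) * δ)
          ≤ p.powerMeasure (V j) + ENNReal.ofReal (((j : ℝ) + 1) * δ) := by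
        calc _ = p.powerMeasure (Set.Ici (t (j + 1))) := by
              rw [ht, ← ENNReal.ofReal_add hδ.le (by positivity)]
              congr 1
              push_cast
              ring
          _ ≤ _ := (measure_mono h1).trans ((measure_union_le _ _).trans
              (add_le_add_left (measure_union_le _ _) _))
          _ = _ := by rw [p.powerMeasure_singleton, add_zero, ht]
      exact (ENNReal.add_le_add_iff_right ENNReal.ofReal_ne_top).1 h2
    -- On `E j` the strongest candidate lies in cell `j` and is the only one above the lower end of
    -- the cell. Such events are disjoint and avoid `B`.
    let E : ℕ → Set Ω := fun j =>
      C ∩ {ω | N.Isolated ω p (p.infoPower ⁻¹' V j) (Set.Ici (t (j + 1)))}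
    have hE : ∀ j, MeasurableSet (E j) := fun j => hCm.inter
      (hN.measurableSet_isolated (p.measurable_infoPower measurableSet_Ioo) measurableSet_Ici)
    have hEle : ∀ j : ℕ, ENNReal.ofReal δ * ENNReal.ofReal (Real.exp (-(((j : ℝ) + 2) * δ))) * μ C
        ≤ μ (E j) := fun j => by
      refine le_trans ?_ (hN.le_measure_isolated (ht0 (j + 1)) measurableSet_Ioo (hVT j))
      have hj : ((j + 1 : ℕ) : ℝ) + 1 = (j : ℝ) + 2 := by push_cast; ring
      rw [ht, hj, eN_ofReal (by positivity)]
      gcongr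
      exact hVm j
    have hdisj : Pairwise (Function.onFun Disjoint E) := by
      have : ∀ i j, i < j → Disjoint (E i) (E j) := fun i j hij => by
        refine Set.disjoint_left.2 fun ω hi hj => ?_
        obtain ⟨a, ⟨ha, _⟩, haV, _⟩ := hi.2
        obtain ⟨b, _, hbV, hb⟩ := hj.2
        have haV : N.powerOf ω p a ∈ V i := haV
        have hbV : N.powerOf ω p b ∈ V j := hbV
        have h1 : t (j + 1) ≤ t (i + 1) := hanti _ _ (by omega)
        obtain rfl := hb a ⟨ha, h1.trans haV.1.le⟩
        have h2 : t j ≤ t (i + 1) := hanti _ _ hij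
        linarith [haV.1, hbV.2]
      intro i j hij
      rcases hij.lt_or_gt with h | h
      · exact this i j h
      · exact (this j i h).symm
    have hBE : Disjoint B (⋃ j, E j) := by
      refine Set.disjoint_right.2 fun ω hω hωB => ?_
      obtain ⟨j, hj⟩ := Set.mem_iUnion.1 hω
      obtain ⟨a, ⟨ha, _⟩, haV, hu⟩ := hj.2
      exact hωB fun _ => ⟨t (j + 1), ht0 _, a, ha, haV.1, fun b hb hbt => hu b ⟨hb, hbt⟩⟩
    calc μ B + ENNReal.ofReal (Real.exp (-(2 * δ))) * μ C
        ≤ μ B + ∑' j, μ (E j) := by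
          gcongr
          calc _ ≤ (∑' j : ℕ, ENNReal.ofReal δ
                * ENNReal.ofReal (Real.exp (-(((j : ℝ) + 2) * δ)))) * μ C := by
                gcongr
                exact tsum_ofReal_exp_ge hδ
            _ ≤ _ := by
                rw [← ENNReal.tsum_mul_right]
                exact ENNReal.tsum_le_tsum hEle
      -- Additivity needs measurability of the second set only, so nothing is required of `B`.
      _ = μ (B ∪ ⋃ j, E j) := by
          rw [measure_union hBE (MeasurableSet.iUnion hE), measure_iUnion hdisj hE]
      _ ≤ μ C := by
          refine measure_mono (Set.union_subset (fun ω hω => ?_) ?_)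
          · by_contra h
            exact hω fun h' => absurd h' h
          · exact Set.iUnion_subset fun j => Set.inter_subset_left
  have hlim : Tendsto (fun δ : ℝ => μ B + ENNReal.ofReal (Real.exp (-(2 * δ))) * μ C)
      (𝓝[>] 0) (𝓝 (μ B + 1 * μ C)) := by
    refine Tendsto.const_add _ (ENNReal.Tendsto.mul_const ?_ (Or.inr (measure_ne_top μ C)))
    have : Tendsto (fun δ : ℝ => ENNReal.ofReal (Real.exp (-(2 * δ)))) (𝓝 0) (𝓝 1) := by
      have h : Continuous fun δ : ℝ => ENNReal.ofReal (Real.exp (-(2 * δ))) :=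
        ENNReal.continuous_ofReal.comp (by fun_prop)
      simpa using h.tendsto 0
    exact this.mono_left nhdsWithin_le_nhds
  have hle := le_of_tendsto hlim (by
    filter_upwards [self_mem_nhdsWithin] with δ hδ using key δ hδ)
  rw [one_mul] at hle
  have h0 : μ B + μ C ≤ 0 + μ C := by simpa using hle
  exact le_antisymm ((ENNReal.add_le_add_iff_right (measure_ne_top μ C)).1 h0) zero_le

end IsModel

end Model

/-! ### The serving base station among the candidates -/

/-- The base station with a given index. -/
def toStation : ℕ ⊕ ℕ → Station
  | .inl i => .uav i
  | .inr k => .tbs k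

lemma toStation_injective : Function.Injective toStation := by
  rintro (i | i) (j | j) h <;> simp_all [toStation]

lemma toStation_ne_cluster (j : ℕ ⊕ ℕ) : toStation j ≠ .cluster := by
  cases j <;> simp [toStation]

namespace Network

variable {Ω : Type*} (N : Network Ω) (p : Params) (ω : Ω)

lemma isCandidate_toStation (j : ℕ ⊕ ℕ) : N.IsCandidate ω (toStation j) ↔ N.Cand ω j := by
  cases j <;> rfl

lemma avgPower_toStation (j : ℕ ⊕ ℕ) : N.avgPower p ω (toStation j) = N.powerOf ω p j := by
  rcases j with i | k
  · by_cases h : N.los i ω = true <;>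
      simp [avgPower, toStation, powerOf, kindOf, posOf, h, Params.power, distU]
  · rfl

variable {N p ω}

lemma IsCandidate.exists_toStation {b : Station} (hb : N.IsCandidate ω b) :
    ∃ j, b = toStation j := by
  rcases b with _ | i | k
  · exact hb.elim
  · exact ⟨.inl i, rfl⟩
  · exact ⟨.inr k, rfl⟩

lemma IsServing.unique {b b' : Station} (hb : N.IsServing p ω b) (hb' : N.IsServing p ω b') :
    b = b' := by
  rcases hb with ⟨h, rfl⟩ | ⟨h, hc, hmax⟩ <;> rcases hb' with ⟨h', rfl⟩ | ⟨h', hc', hmax'⟩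
  · rfl
  · simp [h] at h'
  · simp [h] at h'
  · by_contra hne
    exact lt_asymm (hmax _ hc' (Ne.symm hne)) (hmax' _ hc hne)

lemma IsServing.serving_eq {b : Station} (hb : N.IsServing p ω b) : N.serving p ω = b := by
  have h : ∃ b, N.IsServing p ω b := ⟨b, hb⟩
  rw [serving, dif_pos h]
  exact h.choose_spec.unique hb

/-- The dummy value of `serving` is the cluster UAV, so a value coming from a candidate is a genuine
server. -/
lemma serving_eq_toStation_iff {j : ℕ ⊕ ℕ} :
    N.serving p ω = toStation j ↔ N.IsServing p ω (toStation j) := by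
  refine ⟨fun h => ?_, fun h => h.serving_eq⟩
  by_cases hb : ∃ b, N.IsServing p ω b
  · rw [serving, dif_pos hb] at h
    exact h ▸ hb.choose_spec
  · rw [serving, dif_neg hb] at h
    exact absurd h.symm (toStation_ne_cluster j)

lemma isServing_toStation_iff {j : ℕ ⊕ ℕ} : N.IsServing p ω (toStation j) ↔
    N.clusterAvail ω = false ∧ N.Cand ω j ∧
      ∀ j', N.Cand ω j' → j' ≠ j → N.powerOf ω p j' < N.powerOf ω p j := by
  rw [IsServing, or_iff_right fun h => toStation_ne_cluster j h.2, isCandidate_toStation,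
    avgPower_toStation]
  refine and_congr_right fun _ => and_congr_right fun _ =>
    ⟨fun h j' hj' hne => ?_, fun h b hb hne => ?_⟩
  · rw [← N.avgPower_toStation]
    exact h _ ((N.isCandidate_toStation ω j').2 hj') (toStation_injective.ne hne)
  · obtain ⟨j', rfl⟩ := hb.exists_toStation
    rw [N.avgPower_toStation]
    exact h j' ((N.isCandidate_toStation ω j').1 hb) fun h => hne (h ▸ rfl)

lemma servingInfo_of_serving_eq_cluster (h : N.serving p ω = .cluster) :
    N.servingInfo p ω = (.cluster, 0, N.user ω) := by
  simp only [servingInfo, servingKind, servingPos, h]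

lemma servingInfo_of_serving_eq {j : ℕ ⊕ ℕ} (h : N.serving p ω = toStation j) :
    N.servingInfo p ω = N.infoOf ω j := by
  cases j <;> simp only [servingInfo, servingKind, servingPos, h, toStation, infoOf, kindOf, posOf]

lemma serving_eq_cluster_or : N.serving p ω = .cluster ∨ ∃ j, N.serving p ω = toStation j := by
  rcases h : N.serving p ω with _ | i | k
  · exact Or.inl rfl
  · exact Or.inr ⟨.inl i, rfl⟩
  · exact Or.inr ⟨.inr k, rfl⟩

open scoped Classical in
-- The LoS and NLoS sums run over complementary sets of UAVs, so they merge into one sum, and all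
-- candidates are indexed by `ℕ ⊕ ℕ`.
lemma mul_interference (s : ℝ) : ENNReal.ofReal s * N.interference p ω
    = ∑' j, if N.Cand ω j ∧ N.serving p ω ≠ toStation j then
        ENNReal.ofReal s * ENNReal.ofReal (N.powerOf ω p j * N.gainOf ω j) else 0 := by
  rw [Summable.tsum_sum ENNReal.summable ENNReal.summable, interference,
    ← ENNReal.tsum_add, mul_add, ← ENNReal.tsum_mul_left, ← ENNReal.tsum_mul_left]
  congr 1
  · refine tsum_congr fun i => ?_
    by_cases h1 : N.avail i ω = true <;> by_cases h2 : N.los i ω = true <;>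
      by_cases h3 : N.serving p ω = .uav i <;>
      simp [Cand, h1, h2, h3, toStation, powerOf, kindOf, posOf, gainOf, Params.power, distU] <;>
      ring_nf
  · refine tsum_congr fun k => ?_
    by_cases h3 : N.serving p ω = .tbs k <;>
      simp [Cand, h3, toStation, powerOf, kindOf, posOf, gainOf, Params.power, distT]
    ring_nf

lemma mul_interference_of_clusterAvail (h : N.clusterAvail ω = true) (s : ℝ) :
    ENNReal.ofReal s * N.interference p ω = N.farInterference ω p s ∅ := by
  have hs : N.serving p ω = .cluster := IsServing.serving_eq (Or.inl ⟨h, rfl⟩)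
  rw [mul_interference, farInterference]
  refine tsum_congr fun j => ?_
  have hj : N.serving p ω ≠ toStation j := hs ▸ (toStation_ne_cluster j).symm
  by_cases hc : N.Cand ω j
  · rw [if_pos ⟨hc, hj⟩, if_pos ⟨hc, Set.notMem_empty _⟩]
  · rw [if_neg fun h => hc h.1, if_neg fun h => hc h.1]

/-- The server is the only candidate with power in `T`, so removing the server and removing all
strong candidates are the same. -/
lemma mul_interference_of_serving_eq {j : ℕ ⊕ ℕ} {T : Set ℝ} (hj : N.serving p ω = toStation j)
    (hjT : N.powerOf ω p j ∈ T) (hu : ∀ j', N.Cand ω j' ∧ N.powerOf ω p j' ∈ T → j' = j) (s : ℝ) :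
    ENNReal.ofReal s * N.interference p ω = N.farInterference ω p s T := by
  rw [mul_interference, farInterference]
  refine tsum_congr fun i => ?_
  by_cases hc : N.Cand ω i
  · by_cases hi : N.powerOf ω p i ∈ T
    · simp [hu i ⟨hc, hi⟩, hjT, hj]
    · have h : N.serving p ω ≠ toStation i := fun h =>
        hi (toStation_injective (hj.symm.trans h) ▸ hjT)
      simp [hc, hi, h]
  · simp [hc]

lemma isServing_of_unique {j : ℕ ⊕ ℕ} {t : ℝ} (hcl : N.clusterAvail ω = false) (hj : N.Cand ω j)
    (hjt : t ≤ N.powerOf ω p j) (hu : ∀ j', N.Cand ω j' → t ≤ N.powerOf ω p j' → j' = j) :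
    N.IsServing p ω (toStation j) := by
  refine isServing_toStation_iff.2 ⟨hcl, hj, fun j' hj' hne => ?_⟩
  by_contra h
  exact hne (hu j' hj' (hjt.trans (not_lt.1 h)))

end Network

section Model

variable {Ω : Type*} [mΩ : MeasurableSpace Ω] {μ : Measure Ω} {p : Params} {N : Network Ω}

namespace IsModel

lemma measurableSet_isServing (hN : IsModel p N μ) (j : ℕ ⊕ ℕ) :
    MeasurableSet {ω | N.IsServing p ω (toStation j)} := by
  simp only [Network.isServing_toStation_iff]
  refine (hN.measurable_clusterAvail (measurableSet_singleton false)).inter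
    ((hN.measurableSet_cand j).inter ?_)
  have : {ω | ∀ j', N.Cand ω j' → j' ≠ j → N.powerOf ω p j' < N.powerOf ω p j}
      = ⋂ j', {ω | N.Cand ω j' → j' ≠ j → N.powerOf ω p j' < N.powerOf ω p j} := by
    ext ω
    simp
  change MeasurableSet {ω | ∀ j', N.Cand ω j' → j' ≠ j → N.powerOf ω p j' < N.powerOf ω p j}
  rw [this]
  refine MeasurableSet.iInter fun j' => ?_
  exact (hN.measurableSet_cand j').himp ((MeasurableSet.const (j' ≠ j)).himp
    (measurableSet_lt (hN.measurable_powerOf j') (hN.measurable_powerOf j)))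

/-- There are countably many possible servers, and off their events the information is that of the
cluster UAV, genuine or dummy. Measurability makes the conditioning σ-algebra a sub-σ-algebra,
without which the conditional expectation would be 0 by convention. -/
theorem measurable_servingInfo (hN : IsModel p N μ) : Measurable (N.servingInfo p) := by
  intro A hA
  have h : N.servingInfo p ⁻¹' A =
      (⋃ j, ({ω | N.IsServing p ω (toStation j)} ∩ {ω | N.infoOf ω j ∈ A})) ∪
      ((⋃ j, {ω | N.IsServing p ω (toStation j)})ᶜ
        ∩ {ω | (Kind.cluster, (0 : Plane), N.user ω) ∈ A}) := by
    ext ω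
    rcases N.serving_eq_cluster_or (p := p) (ω := ω) with h | ⟨j, h⟩
    · have h1 : ∀ j, ¬ N.IsServing p ω (toStation j) := fun j hj =>
        toStation_ne_cluster j (hj.serving_eq.symm.trans h)
      simp [h1, Network.servingInfo_of_serving_eq_cluster h]
    · have h1 : ∀ i, N.IsServing p ω (toStation i) ↔ i = j := fun i => by
        rw [← Network.serving_eq_toStation_iff, h, toStation_injective.eq_iff, eq_comm]
      simp [h1, Network.servingInfo_of_serving_eq h]
  rw [h]
  exact (MeasurableSet.iUnion fun j => (hN.measurableSet_isServing j).inter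
    (hN.measurable_infoOf j hA)).union ((MeasurableSet.iUnion fun j =>
      hN.measurableSet_isServing j).compl.inter
      ((measurable_const.prodMk (measurable_const.prodMk hN.measurable_user)) hA))

lemma measurable_gainOf (hN : IsModel p N μ) (j : ℕ ⊕ ℕ) : Measurable fun ω => N.gainOf ω j := by
  rcases j with i | k
  · exact Measurable.ite (hN.measurable_los i (measurableSet_singleton true))
      (hN.measurable_gainL i) (hN.measurable_gainN i)
  · exact hN.measurable_gainT k

lemma measurable_mul_interference (hN : IsModel p N μ) (s : ℝ) :
    Measurable fun ω => ENNReal.ofReal s * N.interference p ω := by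
  classical
  simp only [Network.mul_interference, ne_eq, Network.serving_eq_toStation_iff]
  refine Measurable.tsum fun j => Measurable.ite
    ((hN.measurableSet_cand j).inter (hN.measurableSet_isServing j).compl) ?_ measurable_const
  exact (((hN.measurable_powerOf j).mul (hN.measurable_gainOf j)).ennreal_ofReal).const_mul _

theorem ae_existsUnique_isServing [IsProbabilityMeasure μ] (hN : IsModel p N μ) :
    ∀ᵐ ω ∂μ, ∃! b : Station, N.IsServing p ω b := by
  filter_upwards [hN.ae_strongest] with ω hω
  have h : ∃ b, N.IsServing p ω b := by
    cases hcl : N.clusterAvail ω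
    · obtain ⟨t, _, j, hj, hjt, hu⟩ := hω hcl
      exact ⟨_, Network.isServing_of_unique hcl hj hjt.le hu⟩
    · exact ⟨.cluster, Or.inl ⟨hcl, rfl⟩⟩
  obtain ⟨b, hb⟩ := h
  exact ⟨b, hb, fun b' hb' => hb'.unique hb⟩

end IsModel

end Model

/-! ### Dependence of the far exponent on the level -/

namespace Params

variable (p : Params)

/-- Written as measures of sets, the exponents inherit monotonicity and continuity in the level from
continuity of measures. -/
lemma farExponent_eq (s : ℝ) {T : Set ℝ} (hT : MeasurableSet T) : p.farExponent s T
    = kindSum fun k => (p.radial k).withDensity (p.loss k s) (p.power k ⁻¹' Tᶜ) := by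
  classical
  rw [farExponent]
  congr 1
  ext k
  have hm : MeasurableSet (p.power k ⁻¹' Tᶜ) := p.measurable_power k hT.compl
  rw [withDensity_apply _ hm, ← lintegral_indicator hm,
    p.lintegral_radial k ((p.measurable_loss k s).indicator hm)]
  refine lintegral_congr fun z => ?_
  by_cases h : p.power k z ∈ T <;> simp [h]

/-- Raising the level only makes more stations weak. This monotonicity also supplies the
measurability of `condLaplace`. -/
lemma farExponent_Ici_mono (s : ℝ) : Monotone fun t => p.farExponent s (Set.Ici t) := by
  intro t t' h
  simp only [p.farExponent_eq s measurableSet_Ici, kindSum]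
  have hk : ∀ k, p.power k ⁻¹' (Set.Ici t)ᶜ ⊆ p.power k ⁻¹' (Set.Ici t')ᶜ := fun k =>
    Set.preimage_mono (Set.compl_subset_compl.2 (Set.Ici_subset_Ici.2 h))
  exact add_le_add (add_le_add (measure_mono (hk _)) (measure_mono (hk _))) (measure_mono (hk _))

/-- Left continuity. -/
lemma tendsto_farExponent_Ici (s : ℝ) {u : ℕ → ℝ} {t : ℝ} (hu : Monotone u)
    (hut : ∀ n, u n ≤ t) (hlim : Tendsto u atTop (𝓝 t)) :
    Tendsto (fun n => p.farExponent s (Set.Ici (u n))) atTop (𝓝 (p.farExponent s (Set.Ici t))) := by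
  simp only [p.farExponent_eq s measurableSet_Ici, kindSum]
  have hU : (Set.Ici t)ᶜ = ⋃ n, (Set.Ici (u n))ᶜ := by
    ext v
    simp only [Set.mem_compl_iff, Set.mem_Ici, not_le, Set.mem_iUnion]
    exact ⟨fun hv => (hlim.eventually (lt_mem_nhds hv)).exists, fun ⟨n, hn⟩ => hn.trans_le (hut n)⟩
  have hk : ∀ k, Tendsto (fun n => (p.radial k).withDensity (p.loss k s)
      (p.power k ⁻¹' (Set.Ici (u n))ᶜ)) atTop
      (𝓝 ((p.radial k).withDensity (p.loss k s) (p.power k ⁻¹' (Set.Ici t)ᶜ))) := fun k => by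
    rw [hU, Set.preimage_iUnion]
    exact tendsto_measure_iUnion_atTop fun m n hmn => Set.preimage_mono
      (Set.compl_subset_compl.2 (Set.Ici_subset_Ici.2 (hu hmn)))
  exact ((hk _).add (hk _)).add (hk _)

open scoped Classical in
/-- Conditional Laplace transform as a function of kind and position of the serving base station
and of the position of the user. -/
def condLaplace (s : ℝ) (x : Kind × Plane × Plane) : ℝ≥0∞ :=
  if x.1 = .cluster then eN (p.farExponent s ∅) else eN (p.farExponent s (Set.Ici (p.infoPower x)))

lemma measurable_condLaplace (s : ℝ) : Measurable (p.condLaplace s) := by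
  classical
  exact Measurable.ite (measurable_fst (measurableSet_singleton Kind.cluster)) measurable_const
    (measurable_eN.comp ((p.farExponent_Ici_mono s).measurable.comp p.measurable_infoPower))

lemma condLaplace_le_one (s : ℝ) (x : Kind × Plane × Plane) : p.condLaplace s x ≤ 1 := by
  unfold condLaplace
  split_ifs <;> exact eN_le_one _

lemma infoPower_nonneg (x : Kind × Plane × Plane) : 0 ≤ p.infoPower x :=
  p.power_nonneg _ dist_nonneg

end Params

/-! ### Approximating the power of the server by dyadic levels. -/

section Dyadic

/-- Dyadic approximation from below. -/
def dyadic (v : ℝ) (n : ℕ) : ℝ := (⌊v * 2 ^ n⌋₊ : ℝ) / 2 ^ n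

lemma dyadic_le {v : ℝ} (hv : 0 ≤ v) (n : ℕ) : dyadic v n ≤ v := by
  rw [dyadic, div_le_iff₀ (by positivity)]
  exact Nat.floor_le (by positivity)

lemma monotone_dyadic {v : ℝ} (hv : 0 ≤ v) : Monotone (dyadic v) := by
  refine monotone_nat_of_le_succ fun n => ?_
  rw [dyadic, dyadic, div_le_div_iff₀ (by positivity) (by positivity)]
  have h : 2 * ⌊v * 2 ^ n⌋₊ ≤ ⌊v * 2 ^ (n + 1)⌋₊ := by
    refine Nat.le_floor ?_
    push_cast
    rw [pow_succ]
    nlinarith [Nat.floor_le (show 0 ≤ v * 2 ^ n by positivity)]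
  have h' : 2 * (⌊v * 2 ^ n⌋₊ : ℝ) ≤ ⌊v * 2 ^ (n + 1)⌋₊ := by exact_mod_cast h
  calc _ = 2 * (⌊v * 2 ^ n⌋₊ : ℝ) * 2 ^ n := by rw [pow_succ]; ring
    _ ≤ _ := by gcongr

lemma tendsto_dyadic {v : ℝ} (hv : 0 ≤ v) : Tendsto (dyadic v) atTop (𝓝 v) :=
  (tendsto_nat_floor_mul_div_atTop hv).comp (tendsto_pow_atTop_atTop_of_one_lt one_lt_two)

lemma dyadic_eq {v : ℝ} {n k : ℕ} (h : v ∈ Set.Ico ((k : ℝ) / 2 ^ n) ((k + 1) / 2 ^ n)) :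
    dyadic v n = k / 2 ^ n := by
  have h2 : (0 : ℝ) < 2 ^ n := by positivity
  have h1 := (div_le_iff₀ h2).1 h.1
  rw [dyadic, (Nat.floor_eq_iff ((Nat.cast_nonneg k).trans h1)).2 ⟨h1, (lt_div_iff₀ h2).1 h.2⟩]

/-- Information on a station whose average power lies in a dyadic interval. -/
def Params.dyadicSlice (p : Params) (A : Set (Kind × Plane × Plane)) (n k : ℕ) :
    Set (Kind × Plane × Plane) :=
  A ∩ p.infoPower ⁻¹' Set.Ico ((k : ℝ) / 2 ^ n) ((k + 1) / 2 ^ n)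

end Dyadic

namespace Network

variable {Ω : Type*} {N : Network Ω} {p : Params} {ω : Ω}

/-- A candidate alone above a level beats all others, hence serves, and every interferer lies below
the level. -/
lemma Isolated.exists_serving {A : Set (Kind × Plane × Plane)} {t : ℝ}
    (h : N.Isolated ω p A (Set.Ici t)) (hcl : N.clusterAvail ω = false) :
    N.servingInfo p ω ∈ A ∧ (N.servingInfo p ω).1 ≠ .cluster ∧
      ∀ s, ENNReal.ofReal s * N.interference p ω = N.farInterference ω p s (Set.Ici t) := by
  obtain ⟨j, ⟨hj, hjt⟩, hjA, hu⟩ := h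
  have hs := (isServing_of_unique hcl hj hjt fun j' h1 h2 => hu j' ⟨h1, h2⟩).serving_eq
  rw [servingInfo_of_serving_eq hs]
  refine ⟨hjA, ?_, mul_interference_of_serving_eq hs hjt hu⟩
  rcases j with i | k
  · simp only [infoOf, kindOf]
    split_ifs <;> simp
  · simp [infoOf, kindOf]

end Network

section Model

variable {Ω : Type*} [mΩ : MeasurableSpace Ω] {μ : Measure Ω} {p : Params} {N : Network Ω}

namespace IsModel

variable {A : Set (Kind × Plane × Plane)} [IsProbabilityMeasure μ]

/-- The case that the cluster UAV serves. -/
lemma setLIntegral_clusterAvail (hN : IsModel p N μ) (hA : MeasurableSet A) {s : ℝ} (hs : 0 ≤ s) :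
    ∫⁻ ω in {ω | N.clusterAvail ω = true} ∩ N.servingInfo p ⁻¹' A,
        eN (ENNReal.ofReal s * N.interference p ω) ∂μ
      = ∫⁻ ω in {ω | N.clusterAvail ω = true} ∩ N.servingInfo p ⁻¹' A,
        p.condLaplace s (N.servingInfo p ω) ∂μ := by
  classical
  have hC : MeasurableSet {ω | N.clusterAvail ω = true} :=
    hN.measurable_clusterAvail (measurableSet_singleton true)
  have hE := hC.inter (hN.measurable_servingInfo hA)
  let κ : Plane × Bool → ℝ≥0∞ := fun z => if z.2 = true ∧ (Kind.cluster, (0 : Plane), z.1) ∈ A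
    then 1 else 0
  have hκ : Measurable κ := Measurable.ite ((measurable_snd (measurableSet_singleton true)).inter
    ((by fun_prop : Measurable fun z : Plane × Bool => (Kind.cluster, (0 : Plane), z.1)) hA))
    measurable_const measurable_const
  have hκ1 : ∀ z, κ z ≤ 1 := fun z => by simp only [κ]; split_ifs <;> simp
  -- With `T = ∅` every candidate is weak, so the total weight is `s` times the whole interference;
  -- the set `A` enters through `κ`, and the other parameters are irrelevant.
  have h := hN.lintegral_levelTotal MeasurableSet.univ MeasurableSet.empty hκ hκ1 hs 0
  have hn : ∀ u, p.nearExponent Set.univ ∅ 0 u = 0 := fun u => by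
    simp [Params.nearExponent, Params.kindSum]
  simp only [hn, eN_zero, mul_one] at h
  have hinfo : ∀ ω, N.clusterAvail ω = true →
      N.servingInfo p ω = (.cluster, 0, N.user ω) := fun ω hω =>
    Network.servingInfo_of_serving_eq_cluster (Network.IsServing.serving_eq (Or.inl ⟨hω, rfl⟩))
  have hκE : ∀ ω, κ (N.user ω, N.clusterAvail ω)
      = ({ω | N.clusterAvail ω = true} ∩ N.servingInfo p ⁻¹' A).indicator 1 ω := fun ω => by
    by_cases hω : N.clusterAvail ω = true
    · simp [κ, hω, Set.indicator, hinfo ω hω]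
    · simp [κ, hω, Set.indicator]
  rw [← lintegral_indicator hE, ← lintegral_indicator hE]
  have h1 : ∀ ω, ({ω | N.clusterAvail ω = true} ∩ N.servingInfo p ⁻¹' A).indicator
      (fun ω => eN (ENNReal.ofReal s * N.interference p ω)) ω
      = κ (N.user ω, N.clusterAvail ω) * eN (N.levelTotal ω p Set.univ ∅ s 0) := fun ω => by
    rw [hκE]
    by_cases hω : ω ∈ {ω | N.clusterAvail ω = true} ∩ N.servingInfo p ⁻¹' A
    · rw [Set.indicator_of_mem hω, Set.indicator_of_mem hω, Pi.one_apply, one_mul,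
        Network.mul_interference_of_clusterAvail hω.1, N.levelTotal_eq, Network.farInterference]
      simp [isolateWeight]
    · rw [Set.indicator_of_notMem hω, Set.indicator_of_notMem hω, zero_mul]
  simp_rw [h1]
  rw [h, ← lintegral_const_mul' _ _ (eN_ne_top _)]
  refine lintegral_congr fun ω => ?_
  rw [hκE]
  by_cases hω : ω ∈ {ω | N.clusterAvail ω = true} ∩ N.servingInfo p ⁻¹' A
  · rw [Set.indicator_of_mem hω, Set.indicator_of_mem hω, hinfo ω hω.1]
    simp [Params.condLaplace]
  · rw [Set.indicator_of_notMem hω, Set.indicator_of_notMem hω, mul_zero]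

/-- The case of an isolated strong candidate. -/
lemma setLIntegral_isolated (hN : IsModel p N μ) (hA : MeasurableSet A) {s : ℝ} (hs : 0 ≤ s)
    (t : ℝ) :
    ∫⁻ ω in {ω | N.clusterAvail ω = false} ∩ {ω | N.Isolated ω p A (Set.Ici t)},
        eN (ENNReal.ofReal s * N.interference p ω) ∂μ
      = ∫⁻ _ in {ω | N.clusterAvail ω = false} ∩ {ω | N.Isolated ω p A (Set.Ici t)},
        eN (p.farExponent s (Set.Ici t)) ∂μ := by
  classical
  have hC : MeasurableSet {ω | N.clusterAvail ω = false} :=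
    hN.measurable_clusterAvail (measurableSet_singleton false)
  have hE := hC.inter (hN.measurableSet_isolated hA (measurableSet_Ici (a := t)))
  let κ : Plane × Bool → ℝ≥0∞ := fun z => if z.2 = false then 1 else 0
  have hκ : Measurable κ := Measurable.ite (measurable_snd (measurableSet_singleton false))
    measurable_const measurable_const
  have hκ1 : ∀ z, κ z ≤ 1 := fun z => by simp only [κ]; split_ifs <;> simp
  have h := hN.lintegral_isolated hA (measurableSet_Ici (a := t)) hκ hκ1 hs
  rw [← lintegral_const_mul' _ _ (eN_ne_top _)] at h
  rw [← lintegral_indicator hE, ← lintegral_indicator hE]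
  convert h using 1
  · refine lintegral_congr fun ω => ?_
    by_cases hcl : N.clusterAvail ω = false <;> by_cases hi : N.Isolated ω p A (Set.Ici t)
    · simp [κ, Set.indicator, hcl, hi, (hi.exists_serving hcl).2.2 s]
    all_goals simp [κ, Set.indicator, hcl, hi]
  · refine lintegral_congr fun ω => ?_
    by_cases hcl : N.clusterAvail ω = false <;> by_cases hi : N.Isolated ω p A (Set.Ici t) <;>
      simp [κ, Set.indicator, hcl, hi]

/-- For fixed `n` the events for different `k` are disjoint, since each fixes the dyadic value of
the power of the server. On each of them the level is constant and the isolated case applies. -/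
lemma setLIntegral_dyadic (hN : IsModel p N μ) (hA : MeasurableSet A) {s : ℝ} (hs : 0 ≤ s)
    (n : ℕ) :
    ∫⁻ ω in ⋃ k : ℕ, {ω | N.clusterAvail ω = false} ∩
        {ω | N.Isolated ω p (p.dyadicSlice A n k) (Set.Ici (k / 2 ^ n))},
        eN (ENNReal.ofReal s * N.interference p ω) ∂μ
      = ∫⁻ ω in ⋃ k : ℕ, {ω | N.clusterAvail ω = false} ∩
        {ω | N.Isolated ω p (p.dyadicSlice A n k) (Set.Ici (k / 2 ^ n))},
        eN (p.farExponent s (Set.Ici (dyadic (p.infoPower (N.servingInfo p ω)) n))) ∂μ := by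
  have hC : MeasurableSet {ω | N.clusterAvail ω = false} :=
    hN.measurable_clusterAvail (measurableSet_singleton false)
  have hS : ∀ k, MeasurableSet (p.dyadicSlice A n k) := fun k =>
    hA.inter (p.measurable_infoPower measurableSet_Ico)
  have hD : ∀ k : ℕ, MeasurableSet ({ω | N.clusterAvail ω = false} ∩
      {ω | N.Isolated ω p (p.dyadicSlice A n k) (Set.Ici (k / 2 ^ n))}) := fun k =>
    hC.inter (hN.measurableSet_isolated (hS k) measurableSet_Ici)
  have hdy : ∀ (k : ℕ) ω, ω ∈ {ω | N.clusterAvail ω = false} ∩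
      {ω | N.Isolated ω p (p.dyadicSlice A n k) (Set.Ici (k / 2 ^ n))} →
      dyadic (p.infoPower (N.servingInfo p ω)) n = k / 2 ^ n := fun k ω hω =>
    dyadic_eq (hω.2.exists_serving hω.1).1.2
  have hdisj : Pairwise (Function.onFun Disjoint fun k : ℕ => {ω | N.clusterAvail ω = false} ∩
      {ω | N.Isolated ω p (p.dyadicSlice A n k) (Set.Ici (k / 2 ^ n))}) := fun k l hkl => by
    refine Set.disjoint_left.2 fun ω hk hl => hkl ?_
    have h := (hdy k ω hk).symm.trans (hdy l ω hl)
    have h2 : (2 : ℝ) ^ n ≠ 0 := by positivity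
    exact_mod_cast (div_left_inj' h2).1 h
  rw [lintegral_iUnion hD hdisj, lintegral_iUnion hD hdisj]
  refine tsum_congr fun k => ?_
  rw [hN.setLIntegral_isolated (hS k) hs]
  refine setLIntegral_congr_fun (hD k) fun ω hω => ?_
  simp only [hdy k ω hω]

end IsModel

end Model

/-- Integrals over events increasing up to null sets to an event. -/
lemma tendsto_setLIntegral_of_eventually_mem {Ω : Type*} [MeasurableSpace Ω] {μ : Measure Ω}
    [IsProbabilityMeasure μ] {D : ℕ → Set Ω} {E : Set Ω}
    (hD : ∀ n, MeasurableSet (D n)) (hE : MeasurableSet E) (hDE : ∀ n, D n ⊆ E)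
    (hev : ∀ᵐ ω ∂μ, ω ∈ E → ∀ᶠ n in atTop, ω ∈ D n) {F : ℕ → Ω → ℝ≥0∞} {G : Ω → ℝ≥0∞}
    (hF : ∀ n, Measurable (F n)) (hF1 : ∀ n ω, F n ω ≤ 1)
    (hlim : ∀ ω ∈ E, Tendsto (fun n => F n ω) atTop (𝓝 (G ω))) :
    Tendsto (fun n => ∫⁻ ω in D n, F n ω ∂μ) atTop (𝓝 (∫⁻ ω in E, G ω ∂μ)) := by
  simp_rw [← lintegral_indicator (hD _)]
  rw [← lintegral_indicator hE]
  refine tendsto_lintegral_of_dominated_convergence (fun _ => 1)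
    (fun n => (hF n).indicator (hD n)) (fun n => ae_of_all _ fun ω => ?_) (by simp) ?_
  · exact (Set.indicator_le_self _ _ ω).trans (hF1 n ω)
  · filter_upwards [hev] with ω hω
    by_cases h : ω ∈ E
    · rw [Set.indicator_of_mem h]
      refine (hlim ω h).congr' ?_
      filter_upwards [hω h] with n hn
      rw [Set.indicator_of_mem hn]
    · rw [Set.indicator_of_notMem h]
      refine tendsto_const_nhds.congr fun n => ?_
      rw [Set.indicator_of_notMem fun h' => h (hDE n h')]

section Model

variable {Ω : Type*} [mΩ : MeasurableSpace Ω] {μ : Measure Ω} {p : Params} {N : Network Ω}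

namespace IsModel

variable {A : Set (Kind × Plane × Plane)} [IsProbabilityMeasure μ]

/-- The case that the cluster UAV is not available. -/
lemma setLIntegral_not_clusterAvail (hN : IsModel p N μ) (hA : MeasurableSet A) {s : ℝ}
    (hs : 0 ≤ s) :
    ∫⁻ ω in {ω | N.clusterAvail ω = false} ∩ N.servingInfo p ⁻¹' A,
        eN (ENNReal.ofReal s * N.interference p ω) ∂μ
      = ∫⁻ ω in {ω | N.clusterAvail ω = false} ∩ N.servingInfo p ⁻¹' A,
        p.condLaplace s (N.servingInfo p ω) ∂μ := by
  have hC : MeasurableSet {ω | N.clusterAvail ω = false} :=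
    hN.measurable_clusterAvail (measurableSet_singleton false)
  have hinfo := hN.measurable_servingInfo
  -- Here the cluster kind can only be the dummy value; it is removed, at the cost of a null set.
  let A' := A ∩ {x | x.1 ≠ .cluster}
  have hA' : MeasurableSet A' :=
    hA.inter (measurable_fst (measurableSet_singleton Kind.cluster)).compl
  set D : ℕ → Set Ω := fun n => ⋃ k : ℕ, {ω | N.clusterAvail ω = false} ∩
        {ω | N.Isolated ω p (p.dyadicSlice A n k) (Set.Ici (k / 2 ^ n))} with hDdef
  set E : Set Ω := {ω | N.clusterAvail ω = false} ∩ N.servingInfo p ⁻¹' A' with hEdef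
  have hE : MeasurableSet E := hC.inter (hinfo hA')
  have hD : ∀ n, MeasurableSet (D n) := fun n => MeasurableSet.iUnion fun k =>
    hC.inter (hN.measurableSet_isolated (hA.inter (p.measurable_infoPower measurableSet_Ico))
      measurableSet_Ici)
  have hDE : ∀ n, D n ⊆ E := fun n => Set.iUnion_subset fun k ω hω =>
    ⟨hω.1, (hω.2.exists_serving hω.1).1.1, (hω.2.exists_serving hω.1).2.1⟩
  have hev' : ∀ᵐ ω ∂μ, ω ∈ {ω | N.clusterAvail ω = false} ∩ N.servingInfo p ⁻¹' A →
      ∀ᶠ n in atTop, ω ∈ D n := by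
    filter_upwards [hN.ae_strongest] with ω hω hωE
    obtain ⟨t, _, j, hj, hjt, hu⟩ := hω hωE.1
    have hsv := Network.servingInfo_of_serving_eq
      (Network.isServing_of_unique hωE.1 hj hjt.le hu).serving_eq
    have hjA : N.infoOf ω j ∈ A := hsv ▸ hωE.2
    have h0 : 0 ≤ N.powerOf ω p j := p.infoPower_nonneg (N.infoOf ω j)
    -- The server exceeds `t` strictly and all others stay below `t`, so every dyadic approximation
    -- above `t` separates it from them.
    filter_upwards [(tendsto_dyadic h0).eventually (lt_mem_nhds hjt)] with n hn
    have hle := dyadic_le h0 n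
    refine Set.mem_iUnion.2 ⟨⌊N.powerOf ω p j * 2 ^ n⌋₊, hωE.1, j, ⟨hj, hle⟩, ⟨hjA, hle, ?_⟩,
      fun j' hj' => hu j' hj'.1 (hn.le.trans hj'.2)⟩
    change N.powerOf ω p j < _
    rw [lt_div_iff₀ (by positivity)]
    exact Nat.lt_floor_add_one _
  have hev : ∀ᵐ ω ∂μ, ω ∈ E → ∀ᶠ n in atTop, ω ∈ D n := by
    filter_upwards [hev'] with ω hω hωE using hω ⟨hωE.1, hωE.2.1⟩
  have hEae : E =ᵐ[μ] ({ω | N.clusterAvail ω = false} ∩ N.servingInfo p ⁻¹' A : Set Ω) := by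
    have hsub : E ⊆ {ω | N.clusterAvail ω = false} ∩ N.servingInfo p ⁻¹' A :=
      fun ω hω => ⟨hω.1, hω.2.1⟩
    refine hsub.eventuallyLE.antisymm ?_
    filter_upwards [hev'] with ω hω hωE
    obtain ⟨n, hn⟩ := (hω hωE).exists
    exact hDE n hn
  rw [← setLIntegral_congr hEae, ← setLIntegral_congr hEae]
  have h1 := tendsto_setLIntegral_of_eventually_mem hD hE hDE hev
    (F := fun _ ω => eN (ENNReal.ofReal s * N.interference p ω))
    (fun _ => measurable_eN.comp (hN.measurable_mul_interference s)) (fun _ _ => eN_le_one _)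
    (fun _ _ => tendsto_const_nhds)
  have hdy : ∀ n, Measurable fun v => dyadic v n := fun n => by
    unfold dyadic
    fun_prop
  have h2 := tendsto_setLIntegral_of_eventually_mem hD hE hDE hev
    (F := fun n ω => eN (p.farExponent s (Set.Ici (dyadic (p.infoPower (N.servingInfo p ω)) n))))
    (G := fun ω => p.condLaplace s (N.servingInfo p ω))
    (fun n => measurable_eN.comp ((p.farExponent_Ici_mono s).measurable.comp
      ((hdy n).comp (p.measurable_infoPower.comp hinfo)))) (fun _ _ => eN_le_one _)
    (fun ω hω => by
      have h0 := p.infoPower_nonneg (N.servingInfo p ω)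
      rw [Params.condLaplace, if_neg hω.2.2]
      exact (continuous_eN.tendsto _).comp (p.tendsto_farExponent_Ici s (monotone_dyadic h0)
        (dyadic_le h0) (tendsto_dyadic h0)))
  -- The dyadic identities hold for every `n`; their two sides converge to the two integrals over
  -- the event.
  refine tendsto_nhds_unique h1 (h2.congr fun n => (hN.setLIntegral_dyadic hA hs n).symm)

/-- Conditional Laplace transform of the interference given the serving base station. -/
theorem setLIntegral_servingInfo (hN : IsModel p N μ) (hA : MeasurableSet A) {s : ℝ}
    (hs : 0 ≤ s) :
    ∫⁻ ω in N.servingInfo p ⁻¹' A, eN (ENNReal.ofReal s * N.interference p ω) ∂μ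
      = ∫⁻ ω in N.servingInfo p ⁻¹' A, p.condLaplace s (N.servingInfo p ω) ∂μ := by
  have hC : MeasurableSet {ω | N.clusterAvail ω = true} :=
    hN.measurable_clusterAvail (measurableSet_singleton true)
  have hc : {ω | N.clusterAvail ω = true}ᶜ = {ω | N.clusterAvail ω = false} := by
    ext ω
    simp
  rw [← lintegral_inter_add_sdiff _ _ hC, ← lintegral_inter_add_sdiff _ (N.servingInfo p ⁻¹' A) hC,
    Set.sdiff_eq, hc, Set.inter_comm, Set.inter_comm _ {ω | N.clusterAvail ω = false},
    hN.setLIntegral_clusterAvail hA hs, hN.setLIntegral_not_clusterAvail hA hs]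

end IsModel

end Model

/-! ### The exponents in terms of the distance of the serving base station -/

/-- The origin of all the distance formulas: a power-law comparison is solved for `D` by taking the
root of order `a'`. -/
lemma mul_rpow_neg_lt_iff {a a' c c' D r : ℝ} (ha' : 0 < a') (hc : 0 < c) (hc' : 0 < c')
    (hD : 0 < D) (hr : 0 < r) :
    c' * D ^ (-a') < c * r ^ (-a) ↔ (c' / c) ^ (1 / a') * r ^ (a / a') < D := by
  have h1 : (c' / c) ^ (1 / a') * r ^ (a / a') = (c' / c * r ^ a) ^ a'⁻¹ := by
    rw [Real.mul_rpow (by positivity) (by positivity), ← Real.rpow_mul hr.le, one_div,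
      div_eq_mul_inv a]
  have h2 : c' * D ^ (-a') < c * r ^ (-a) ↔ c' / c * r ^ a < D ^ a' := by
    have hDa := Real.rpow_pos_of_pos hD a'
    have hra := Real.rpow_pos_of_pos hr a
    rw [Real.rpow_neg hD.le, Real.rpow_neg hr.le, ← div_eq_mul_inv, ← div_eq_mul_inv,
      div_lt_div_iff₀ hDa hra, div_mul_eq_mul_div, div_lt_iff₀ hc, mul_comm c]
  rw [h1, h2, Real.rpow_inv_lt_iff_of_pos (by positivity) hD.le ha']

/-- Passage from Euclidean to horizontal distance. If `d ^ 2 < h ^ 2`, the left root is 0 by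
convention and both sides are true. -/
lemma sqrt_sub_lt_iff {d h z : ℝ} (hd : 0 ≤ d) (hz : 0 < z) :
    √(d ^ 2 - h ^ 2) < z ↔ d < √(z ^ 2 + h ^ 2) := by
  rw [Real.sqrt_lt' hz, Real.lt_sqrt hd, sub_lt_iff_lt_add]

namespace Params

variable (p : Params)

/-- Euclidean distance of a station of the given kind at horizontal distance `d`. -/
def range : Kind → ℝ → ℝ
  | .tbs, d => d
  | _, d => √(d ^ 2 + p.h ^ 2)

lemma h_lt_sqrt {z : ℝ} (hz : 0 < z) : p.h < √(z ^ 2 + p.h ^ 2) := by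
  rw [Real.lt_sqrt p.h_pos.le]
  have := pow_pos hz 2
  linarith

/-- Weaker UAVs are those beyond a horizontal distance. -/
lemma uav_lt_iff {a a' c c' r z : ℝ} (ha' : 0 < a') (hc : 0 < c) (hc' : 0 < c') (hr : 0 < r)
    (hz : 0 < z) :
    c' * √(z ^ 2 + p.h ^ 2) ^ (-a') < c * r ^ (-a) ↔
      √(max p.h ((c' / c) ^ (1 / a') * r ^ (a / a')) ^ 2 - p.h ^ 2) < z := by
  -- A UAV at positive horizontal distance is farther than `h`, so the maximum with `h` adds no
  -- constraint.
  have hD := p.h_lt_sqrt hz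
  rw [mul_rpow_neg_lt_iff ha' hc hc' (p.h_pos.trans hD) hr,
    sqrt_sub_lt_iff (p.h_pos.le.trans (le_max_left _ _)) hz, max_lt_iff, and_iff_right hD]

lemma uav_lt_iff_self {a c r z : ℝ} (ha : 0 < a) (hc : 0 < c) (hr : 0 < r) (hz : 0 < z) :
    c * √(z ^ 2 + p.h ^ 2) ^ (-a) < c * r ^ (-a) ↔ √(r ^ 2 - p.h ^ 2) < z := by
  have hD := p.h_lt_sqrt hz
  rw [mul_rpow_neg_lt_iff ha hc hc (p.h_pos.trans hD) hr, sqrt_sub_lt_iff hr.le hz,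
    div_self hc.ne', div_self ha.ne', Real.one_rpow, Real.rpow_one, one_mul]

lemma etaL_mul_rhoU_pos : 0 < p.etaL * p.rhoU := mul_pos p.etaL_pos p.rhoU_pos

lemma etaN_mul_rhoU_pos : 0 < p.etaN * p.rhoU := mul_pos p.etaN_pos p.rhoU_pos

lemma sqrt_add_pos (d : ℝ) : 0 < √(d ^ 2 + p.h ^ 2) := by
  have := p.h_pos
  positivity

/-- By the convention `0 ^ (-α) = 0`, a TBS located exactly at the user has power 0. -/
lemma pos_of_power_tbs_pos {d : ℝ} (hpos : 0 < p.power .tbs d) (hd : 0 ≤ d) : 0 < d := by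
  refine hd.lt_of_ne fun h => ?_
  rw [power, ← h, Real.zero_rpow (neg_ne_zero.2 p.alphaT_pos.ne'), mul_zero] at hpos
  exact lt_irrefl _ hpos

lemma power_los_lt_iff {k : Kind} {d z : ℝ} (hpos : 0 < p.power k d) (hd : 0 ≤ d) (hz : 0 < z) :
    p.power .los z < p.power k d ↔ p.lowerL k (p.range k d) < z := by
  have hL := p.etaL_mul_rhoU_pos
  have hN := p.etaN_mul_rhoU_pos
  rcases k with _ | _ | _ | _
  · exact absurd hpos (lt_irrefl _)
  · exact p.uav_lt_iff_self p.alphaL_pos hL (p.sqrt_add_pos d) hz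
  · have h := p.uav_lt_iff (a := p.alphaN) p.alphaL_pos hN hL (p.sqrt_add_pos d) hz
    rwa [mul_div_mul_right _ _ p.rhoU_pos.ne'] at h
  · have hd' := p.pos_of_power_tbs_pos hpos hd
    simp only [power, lowerL, dtl, range, mul_comm p.rhoU]
    exact p.uav_lt_iff p.alphaL_pos p.rhoT_pos hL hd' hz

lemma power_nlos_lt_iff {k : Kind} {d z : ℝ} (hpos : 0 < p.power k d) (hd : 0 ≤ d) (hz : 0 < z) :
    p.power .nlos z < p.power k d ↔ p.lowerN k (p.range k d) < z := by
  have hL := p.etaL_mul_rhoU_pos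
  have hN := p.etaN_mul_rhoU_pos
  rcases k with _ | _ | _ | _
  · exact absurd hpos (lt_irrefl _)
  · have h := p.uav_lt_iff (a := p.alphaL) p.alphaN_pos hL hN (p.sqrt_add_pos d) hz
    rwa [mul_div_mul_right _ _ p.rhoU_pos.ne', max_comm] at h
  · exact p.uav_lt_iff_self p.alphaN_pos hN (p.sqrt_add_pos d) hz
  · have hd' := p.pos_of_power_tbs_pos hpos hd
    simp only [power, lowerN, dtn, range, mul_comm p.rhoU]
    exact p.uav_lt_iff p.alphaN_pos p.rhoT_pos hN hd' hz

lemma power_tbs_lt_iff {k : Kind} {d z : ℝ} (hpos : 0 < p.power k d) (hd : 0 ≤ d) (hz : 0 < z) :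
    p.power .tbs z < p.power k d ↔ p.lowerT k (p.range k d) < z := by
  rcases k with _ | _ | _ | _
  · exact absurd hpos (lt_irrefl _)
  · simp only [power, lowerT, dlt, range, mul_comm p.rhoU]
    exact mul_rpow_neg_lt_iff p.alphaT_pos p.etaL_mul_rhoU_pos p.rhoT_pos hz (p.sqrt_add_pos d)
  · simp only [power, lowerT, dnt, range, mul_comm p.rhoU]
    exact mul_rpow_neg_lt_iff p.alphaT_pos p.etaN_mul_rhoU_pos p.rhoT_pos hz (p.sqrt_add_pos d)
  · have h := p.strictAntiOn_power (k := .tbs) (by simp)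
    exact h.lt_iff_gt hz (p.pos_of_power_tbs_pos hpos hd)

lemma sqrt_rpow (z a : ℝ) : √(z ^ 2 + p.h ^ 2) ^ (-a) = (z ^ 2 + p.h ^ 2) ^ (-a / 2) := by
  rw [Real.sqrt_eq_rpow, ← Real.rpow_mul (by positivity)]
  congr 1
  ring

lemma lamAvail_nonneg : 0 ≤ p.lamAvail := mul_nonneg p.Pa_nonneg p.lamU_pos.le

open scoped Classical in
/-- Restriction of an integral over `(0, ∞)` to the weak stations. -/
lemma lintegral_weak {T : Set ℝ} {pw : ℝ → ℝ} {c : ℝ≥0∞} {b : ℝ}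
    {f g dens : ℝ → ℝ≥0∞} (hc : c ≠ ∞) (hb : 0 ≤ b) (hT : ∀ z, 0 < z → (pw z ∉ T ↔ b < z))
    (hfg : ∀ z, 0 < z → ENNReal.ofReal (2 * Real.pi * z) * (dens z * f z) = c * g z) :
    ∫⁻ z in Set.Ioi 0, ENNReal.ofReal (2 * Real.pi * z) *
        (dens z * if pw z ∈ T then 0 else f z) = c * ∫⁻ z in Set.Ioi b, g z := by
  rw [← lintegral_const_mul' _ _ hc, ← lintegral_indicator measurableSet_Ioi,
    ← lintegral_indicator measurableSet_Ioi]
  refine lintegral_congr fun z => ?_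
  by_cases hz : 0 < z
  · rw [Set.indicator_of_mem (show z ∈ Set.Ioi 0 from hz)]
    by_cases h : b < z
    · rw [Set.indicator_of_mem (show z ∈ Set.Ioi b from h), if_neg ((hT z hz).2 h), hfg z hz]
    · rw [Set.indicator_of_notMem (show z ∉ Set.Ioi b from h),
        if_pos (not_not.1 fun h' => h ((hT z hz).1 h')), mul_zero, mul_zero]
  · rw [Set.indicator_of_notMem (show z ∉ Set.Ioi 0 from hz),
      Set.indicator_of_notMem (show z ∉ Set.Ioi b from fun h => hz (hb.trans_lt h))]

lemma loss_los (s : ℝ) {z : ℝ} (hz : 0 < z) :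
    ENNReal.ofReal (2 * Real.pi * z) * (p.density .los z * p.loss .los s z)
      = ENNReal.ofReal (2 * Real.pi * p.lamAvail) * ENNReal.ofReal
        ((1 - (p.mL / (p.mL + s * p.etaL * p.rhoU * (z ^ 2 + p.h ^ 2) ^ (-p.alphaL / 2))) ^ p.mL)
          * (z * p.Pl (√(z ^ 2 + p.h ^ 2)))) := by
  have h1 := p.lamAvail_nonneg
  have h2 := p.Pl_nonneg (√(z ^ 2 + p.h ^ 2))
  simp only [density, loss, shape, power]
  rw [← mul_assoc, ← ENNReal.ofReal_mul (by positivity), ← ENNReal.ofReal_mul (by positivity),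
    ← ENNReal.ofReal_mul (by positivity), sqrt_rpow]
  congr 1
  ring_nf

lemma loss_nlos (s : ℝ) {z : ℝ} (hz : 0 < z) :
    ENNReal.ofReal (2 * Real.pi * z) * (p.density .nlos z * p.loss .nlos s z)
      = ENNReal.ofReal (2 * Real.pi * p.lamAvail) * ENNReal.ofReal
        ((1 - (p.mN / (p.mN + s * p.etaN * p.rhoU * (z ^ 2 + p.h ^ 2) ^ (-p.alphaN / 2))) ^ p.mN)
          * (z * p.Pn (√(z ^ 2 + p.h ^ 2)))) := by
  have h1 := p.lamAvail_nonneg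
  have h2 := p.Pn_nonneg (√(z ^ 2 + p.h ^ 2))
  simp only [density, loss, shape, power]
  rw [← mul_assoc, ← ENNReal.ofReal_mul (by positivity), ← ENNReal.ofReal_mul (by positivity),
    ← ENNReal.ofReal_mul (by positivity), sqrt_rpow]
  congr 1
  ring_nf

lemma loss_tbs (s : ℝ) {z : ℝ} (hz : 0 < z) :
    ENNReal.ofReal (2 * Real.pi * z) * (p.density .tbs z * p.loss .tbs s z)
      = ENNReal.ofReal (2 * Real.pi * p.lamT) * ENNReal.ofReal
        ((1 - 1 / (1 + s * p.rhoT * z ^ (-p.alphaT))) * z) := by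
  have h1 := p.lamT_pos
  simp only [density, loss, shape, power, Real.rpow_one]
  rw [← mul_assoc, ← ENNReal.ofReal_mul (by positivity), ← ENNReal.ofReal_mul (by positivity),
    ← ENNReal.ofReal_mul (by positivity)]
  congr 1
  ring_nf

lemma ofReal_laplaceFormula (k : Kind) (s r : ℝ) : ENNReal.ofReal (p.laplaceFormula k s r)
    = eN (ENNReal.ofReal (2 * Real.pi * p.lamAvail) * p.integralL k s r
      + ENNReal.ofReal (2 * Real.pi * p.lamAvail) * p.integralN k s r
      + ENNReal.ofReal (2 * Real.pi * p.lamT) * p.integralT k s r) := by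
  rw [laplaceFormula, ENNReal.ofReal_mul (mul_nonneg (expNeg_nonneg _) (expNeg_nonneg _)),
    ENNReal.ofReal_mul (expNeg_nonneg _), ofReal_expNeg, ofReal_expNeg, ofReal_expNeg, eN_add,
    eN_add]
  ring

lemma eN_farExponent {T : Set ℝ} {k : Kind} {r : ℝ} (s : ℝ)
    (hL : ∀ z, 0 < z → (p.power .los z ∉ T ↔ p.lowerL k r < z))
    (hN : ∀ z, 0 < z → (p.power .nlos z ∉ T ↔ p.lowerN k r < z))
    (hT : ∀ z, 0 < z → (p.power .tbs z ∉ T ↔ p.lowerT k r < z))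
    (hr : 0 ≤ p.lowerT k r) :
    eN (p.farExponent s T) = ENNReal.ofReal (p.laplaceFormula k s r) := by
  have h0L : 0 ≤ p.lowerL k r := by cases k <;> simp [lowerL]
  have h0N : 0 ≤ p.lowerN k r := by cases k <;> simp [lowerN]
  rw [ofReal_laplaceFormula, farExponent, kindSum,
    lintegral_weak ENNReal.ofReal_ne_top h0L hL fun z hz => p.loss_los s hz,
    lintegral_weak ENNReal.ofReal_ne_top h0N hN fun z hz => p.loss_nlos s hz,
    lintegral_weak ENNReal.ofReal_ne_top hr hT fun z hz => p.loss_tbs s hz]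
  rfl

/-- A station is weak exactly when its horizontal distance exceeds the lower limit for its kind. The
hypothesis excludes a TBS at distance 0: its power is 0 by convention, so no station would be weak.
-/
theorem condLaplace_eq (s : ℝ) {x : Kind × Plane × Plane}
    (hx : x.1 = .cluster ∨ 0 < p.infoPower x) : p.condLaplace s x
      = ENNReal.ofReal (p.laplaceFormula x.1 s (p.range x.1 (dist x.2.1 x.2.2))) := by
  by_cases hk : x.1 = .cluster
  · rw [condLaplace, if_pos hk, hk]
    exact p.eN_farExponent s (by simp [lowerL]) (by simp [lowerN]) (by simp [lowerT])
      (by simp [lowerT])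
  · have hpos := hx.resolve_left hk
    have hd : 0 ≤ dist x.2.1 x.2.2 := dist_nonneg
    rw [condLaplace, if_neg hk]
    refine p.eN_farExponent s (fun z hz => ?_) (fun z hz => ?_) (fun z hz => ?_) ?_
    · rw [Set.mem_Ici, not_le]
      exact p.power_los_lt_iff hpos hd hz
    · rw [Set.mem_Ici, not_le]
      exact p.power_nlos_lt_iff hpos hd hz
    · rw [Set.mem_Ici, not_le]
      exact p.power_tbs_lt_iff hpos hd hz
    · have h1 := p.rhoT_pos
      have h2 := p.rhoU_pos
      have h3 := p.etaL_pos
      have h4 := p.etaN_pos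
      rcases x.1 with _ | _ | _ | _ <;> simp only [lowerT, range, dlt, dnt] <;> positivity

end Params

lemma Network.servingDist_eq {Ω : Type*} (N : Network Ω) (p : Params) (ω : Ω) :
    N.servingDist p ω = p.range (N.servingInfo p ω).1
      (dist (N.servingInfo p ω).2.1 (N.servingInfo p ω).2.2) := by
  rcases h : N.serving p ω with _ | i | k
  · simp only [servingDist, servingInfo, servingKind, servingPos, h, Params.range]
  · simp only [servingDist, servingInfo, servingKind, servingPos, h, distU]
    split_ifs <;> rfl
  · simp only [servingDist, servingInfo, servingKind, servingPos, h, Params.range, distT]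

/-! ### The conditional expectation -/

lemma expNeg_eq_toReal (x : ℝ≥0∞) : expNeg x = (eN x).toReal := by
  rw [← ofReal_expNeg, ENNReal.toReal_ofReal (expNeg_nonneg x)]

section Model

variable {Ω : Type*} [mΩ : MeasurableSpace Ω] {μ : Measure Ω} [IsProbabilityMeasure μ]
  {p : Params} {N : Network Ω}

namespace IsModel

lemma ae_infoPower_pos (hN : IsModel p N μ) :
    ∀ᵐ ω ∂μ, (N.servingInfo p ω).1 = .cluster ∨ 0 < p.infoPower (N.servingInfo p ω) := by
  filter_upwards [hN.ae_strongest] with ω hω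
  cases hcl : N.clusterAvail ω
  · obtain ⟨t, ht, j, hj, hjt, hu⟩ := hω hcl
    rw [Network.servingInfo_of_serving_eq
      (Network.isServing_of_unique hcl hj hjt.le hu).serving_eq]
    exact Or.inr (ht.trans hjt)
  · rw [Network.servingInfo_of_serving_eq_cluster
      (Network.IsServing.serving_eq (Or.inl ⟨hcl, rfl⟩))]
    exact Or.inl rfl

theorem condExp_expNeg_interference (hN : IsModel p N μ) {s : ℝ} (hs : 0 ≤ s) :
    μ[fun ω => expNeg (ENNReal.ofReal s * N.interference p ω) |
        MeasurableSpace.comap (N.servingInfo p) inferInstance]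
      =ᵐ[μ] fun ω => p.laplaceFormula (N.servingKind p ω) s (N.servingDist p ω) := by
  have hinfo := hN.measurable_servingInfo
  have hfm : Measurable fun ω => eN (ENNReal.ofReal s * N.interference p ω) :=
    measurable_eN.comp (hN.measurable_mul_interference s)
  have hgm : Measurable fun ω => p.condLaplace s (N.servingInfo p ω) :=
    (p.measurable_condLaplace s).comp hinfo
  have hint : ∀ F : Ω → ℝ≥0∞, Measurable F → (∀ ω, F ω ≤ 1) →
      Integrable (fun ω => (F ω).toReal) μ := fun F hF hF1 =>
    integrable_toReal_of_lintegral_ne_top hF.aemeasurable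
      ((lintegral_mono hF1).trans_lt (by simp)).ne
  have hset : ∀ F : Ω → ℝ≥0∞, Measurable F → (∀ ω, F ω ≤ 1) → ∀ S : Set Ω,
      ∫ ω in S, (F ω).toReal ∂μ = (∫⁻ ω in S, F ω ∂μ).toReal := fun F hF hF1 S =>
    integral_toReal hF.aemeasurable (ae_of_all _ fun ω => (hF1 ω).trans_lt ENNReal.one_lt_top)
  have hle := fun ω => p.condLaplace_le_one s (N.servingInfo p ω)
  simp only [expNeg_eq_toReal]
  have hcond : (fun ω => (p.condLaplace s (N.servingInfo p ω)).toReal) =ᵐ[μ]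
      μ[fun ω => (eN (ENNReal.ofReal s * N.interference p ω)).toReal |
        MeasurableSpace.comap (N.servingInfo p) inferInstance] := by
    refine ae_eq_condExp_of_forall_setIntegral_eq hinfo.comap_le
      (hint _ hfm fun _ => eN_le_one _) (fun S _ _ => (hint _ hgm hle).integrableOn) ?_ ?_
    -- Events of the conditioning σ-algebra are preimages under `servingInfo`, which is the form of
    -- the integrated identity.
    · rintro S ⟨A, hA, rfl⟩ -
      rw [hset _ hgm hle, hset _ hfm fun _ => eN_le_one _, hN.setLIntegral_servingInfo hA hs]
    · exact (((p.measurable_condLaplace s).ennreal_toReal).comp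
        (comap_measurable (N.servingInfo p))).aestronglyMeasurable
  refine hcond.symm.trans ?_
  filter_upwards [hN.ae_infoPower_pos] with ω hω
  rw [p.condLaplace_eq s hω, ← N.servingDist_eq p ω, ENNReal.toReal_ofReal]
  · rfl
  · exact mul_nonneg (mul_nonneg (expNeg_nonneg _) (expNeg_nonneg _)) (expNeg_nonneg _)

end IsModel

end Model

end UAVNet

end

/-- Almost surely there is exactly one serving base station, and for every `s ≥ 0` the conditional
expectation of `exp (-s I)` given the serving base station is `𝓛_I(s, r)`, with `r` the distance of
the serving base station and the lower limits `a, b, c` those of its kind. -/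
theorem mainTheorem4 {Ω : Type*} [MeasurableSpace Ω] (μ : Measure Ω) [IsProbabilityMeasure μ]
    (p : UAVNet.Params) (N : UAVNet.Network Ω) (hN : UAVNet.IsModel p N μ) :
    (∀ᵐ ω ∂μ, ∃! b : UAVNet.Station, N.IsServing p ω b) ∧
    Measurable (N.servingInfo p) ∧
    ∀ s : ℝ, 0 ≤ s →
      μ[fun ω => UAVNet.expNeg (ENNReal.ofReal s * N.interference p ω) |
          MeasurableSpace.comap (N.servingInfo p) inferInstance]
        =ᵐ[μ] fun ω => p.laplaceFormula (N.servingKind p ω) s (N.servingDist p ω) := by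
  exact ⟨hN.ae_existsUnique_isServing, hN.measurable_servingInfo,
    fun _ hs => hN.condExp_expNeg_interference hs⟩
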